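/- **Model.** Fix an integer $K\ge 1$, a Rician factor $\kappa\ge 0$, mean link gains $\alpha_{sn},\alpha_{sr},\alpha_{rn}>0$, a transmit SNR $\rho>0$, power allocation factors $0<a_n<a_m$ with $a_n+a_m=1$, target rates $R_n,R_m>0$ and an interference power $\Omega_I>0$; put $\gamma_{th_n}=2^{R_n}-1$ and $\gamma_{th_m}=2^{R_m}-1$. Let $\tilde h_{sn},\tilde h_{sr}^k,\tilde h_{rn}^k\sim\mathcal{CN}(0,1)$ $(1\le k\le K)$ and $h_I\sim\mathcal{CN}(0,\Omega_I)$ be independent, and let $$h_{\bullet}=\sqrt{\alpha_\bullet}\Bigl(\sqrt{\tfrac{\kappa}{\kappa+1}}+\sqrt{\tfrac1{\kappa+1}}\,\tilde h_{\bullet}\Bigr)$$ be the Rician channels from the base station to user $n$ ($h_{sn}$), from the base station to the $k$-th reflecting element ($h_{sr}^k$) and from that element to user $n$ ($h_{rn}^k$). With $\mathbf h_{sr}=[h_{sr}^1\cdots h_{sr}^K]^H$, $\mathbf h_{rn}=[h_{rn}^1\cdots h_{rn}^K]^H$ and $\Theta_R=\mathrm{diag}(e^{j\theta_1},\dots,e^{j\theta_K})$,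 where the coherent phase shifts $\theta_k\in[0,2\pi)$ rotate every term of $\mathbf h_{rn}^H\Theta_R\mathbf h_{sr}$ onto the phase of $h_{sn}$, let $G=|h_{sn}+\mathbf h_{rn}^H\Theta_R\mathbf h_{sr}|^2$. The outage probability of user $n$ with imperfect SIC ($\varpi=1$) is $$P_{n}=\Pr(\gamma_{n\to m}<\gamma_{th_m})+\Pr(\gamma_{n\to m}>\gamma_{th_m},\ \gamma_n<\gamma_{th_n}),\qquad \gamma_{n\to m}=\frac{G\rho a_m}{G\rho a_n+1},\quad \gamma_n=\frac{G\rho a_n}{\varpi|h_I|^2\rho+1}.$$ **Notation.** Let $I_\nu$ be the modified Bessel function of the first kind, $Q(a,b)=\int_b^\infty x e^{-(x^2+a^2)/2}I_0(ax)\,dx$ the Marcum $Q$-function, $L_{1/2}(x)=e^{x/2}[(1-x)I_0(-\tfrac x2)-xI_1(-\tfrac x2)]$, and $$\mu_n=\frac{\pi\sqrt{\alpha_{sr}\alpha_{rn}}}{4(\kappa+1)}L_{1/2}(-\kappa)^2,\quad \Omega_n=\alpha_{sr}\alpha_{rn}\Bigl\{1-\frac{\pi^2}{16(1+\kappa)^2}L_{1/2}(-\kappa)^4\Bigr\},\quad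 \varphi_n=\frac{\mu_n^2K}{\Omega_n}-1,\quad \phi_n=\frac{\Omega_n}{\mu_n},$$ $$\Phi=\frac1{2^{\varphi_n}\phi_n^{\varphi_n+1}\Gamma(\varphi_n+1)},\quad \beta=\frac{\gamma_{th_n}}{a_n\rho},\quad \tau=\frac{\gamma_{th_m}}{\rho(a_m-\gamma_{th_m}a_n)}.$$ For $P,U\ge1$ let $x_u=\cos\frac{(2u-1)\pi}{2U}$ and $b_u=\frac{\pi}{2U}\sqrt{1-x_u^2}$ $(1\le u\le U)$, let $x_p$ $(1\le p\le P)$ be the zeros of the Laguerre polynomial $L_P(x)=e^x\frac{d^P}{dx^P}(x^Pe^{-x})$, let $H_p=\frac{(P!)^2x_p}{[L_{P+1}(x_p)]^2}$ and $\chi_p=\sqrt{\beta(\varpi x_p\Omega_I\rho+1)}$ with $\varpi=1$, and $$S_{P,U}=\Phi\sum_{p=1}^P\sum_{u=1}^U H_pb_u\,\chi_p^{\varphi_n+1}(x_u+1)^{\varphi_n}e^{-\frac{(x_u+1)\chi_p}{2\phi_n}}\Bigl\{1-Q\Bigl(\sqrt{2\kappa},\bigl[\chi_p-\tfrac{(x_u+1)\chi_p}2\bigr]\sqrt{\tfrac{2(\kappa+1)}{\alpha_{sn}}}\Bigr)\Bigr\}.$$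 Let $X=\sum_{k=1}^K|h_{sr}^kh_{rn}^k|$, let $\mathcal G_n$ be the Gamma law with density $\frac{x^{\varphi_n}e^{-x/\phi_n}}{\phi_n^{\varphi_n+1}\Gamma(\varphi_n+1)}$ on $(0,\infty)$, and let $\widetilde P_{n}$ be the outage probability obtained from the formula for $P_n$ when $G$ is replaced by $(|h_{sn}|+Y)^2$, where $Y\sim\mathcal G_n$, $h_{sn}$ and $h_I$ are independent. **Theorem.** There are numbers $\delta(\kappa,K)$, depending only on $\kappa$ and $K$, with $\delta(\kappa,K)\to0$ as $K\to\infty$ for every $\kappa\ge0$, such that for all parameters as above: 1. $X$ is square-integrable, and $\mathcal G_n$ has the same mean and the same variance as $X$; 2. $|\Pr(X\le x)-\mathcal G_n((-\infty,x])|\le\delta(\kappa,K)$ for all $x\in\mathbb R$; 3. $|P_{n}-\widetilde P_{n}|\le\delta(\kappa,K)$; 4. if $\gamma_{th_m}a_n<a_m$ and $\tau\le\beta$, then $S_{P,U}\to\widetilde P_{n}$ as $P,U\to\infty$ jointly. In this sense $P_{n}\approx S_{P,U}$. -/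

import Mathlib

open MeasureTheory ProbabilityTheory Filter Topology

namespace StarRis

noncomputable section

/-! ### Special functions -/

/-- The modified Bessel function of the first kind of integer order `n`, by Bessel's integral
`I_n(x) = (1/π) ∫_0^π e^{x cos t} cos (n t) dt`. -/
def besselI (n : ℕ) (x : ℝ) : ℝ :=
  (1 / Real.pi) * ∫ t in (0 : ℝ)..Real.pi, Real.exp (x * Real.cos t) * Real.cos (n * t)

/-- The Marcum Q-function `Q(a, b) = ∫_b^∞ x e^{-(x² + a²)/2} I₀(a x) dx`. -/
def marcumQ (a b : ℝ) : ℝ :=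
  ∫ x in Set.Ioi b, x * Real.exp (-(x ^ 2 + a ^ 2) / 2) * besselI 0 (a * x)

/-- The Laguerre function of degree `1/2`:
`L_{1/2}(x) = e^{x/2} [(1 - x) I₀(-x/2) - x I₁(-x/2)]`. -/
def laguerreHalf (x : ℝ) : ℝ :=
  Real.exp (x / 2) * ((1 - x) * besselI 0 (-x / 2) - x * besselI 1 (-x / 2))

/-- The Laguerre polynomial of degree `P` in the normalisation
`L_P(x) = e^x (d/dx)^P (x^P e^{-x}) = ∑_k (-1)^k (P choose k) (P! / k!) x^k`. -/
def laguerrePoly (P : ℕ) : Polynomial ℝ :=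
  ∑ k ∈ Finset.range (P + 1),
    Polynomial.C ((-1 : ℝ) ^ k * (P.choose k : ℝ) * ((P.factorial : ℝ) / (k.factorial : ℝ)))
      * Polynomial.X ^ k

/-! ### Quadrature nodes and weights -/

/-- The Gauss–Laguerre abscissas of order `P`: the zeros of the Laguerre polynomial `L_P`. -/
def laguerreNodes (P : ℕ) : Finset ℝ := (laguerrePoly P).roots.toFinset

/-- The Gauss–Laguerre weight `H = (P!)² x / [L_{P+1}(x)]²` at the abscissa `x`. -/
def laguerreWeight (P : ℕ) (x : ℝ) : ℝ :=
  (P.factorial : ℝ) ^ 2 * x / ((laguerrePoly (P + 1)).eval x) ^ 2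

/-- The Gauss–Chebyshev abscissa `x_u = cos ((2u - 1) π / (2U))`. -/
def chebyshevNode (U u : ℕ) : ℝ := Real.cos ((2 * (u : ℝ) - 1) / (2 * (U : ℝ)) * Real.pi)

/-- `b_u = (π / (2U)) √(1 - x_u²)`. -/
def chebyshevWeight (U u : ℕ) : ℝ :=
  Real.pi / (2 * (U : ℝ)) * Real.sqrt (1 - chebyshevNode U u ^ 2)

/-! ### System parameters -/

/-- The parameters of the network. -/
structure Params where
  /-- number of reflecting elements -/
  K : ℕ
  /-- Rician factor -/
  κ : ℝ
  /-- mean power gain of the direct link from the base station to user `n` -/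
  αsn : ℝ
  /-- mean power gain of the links from the base station to the reflecting elements -/
  αsr : ℝ
  /-- mean power gain of the links from the reflecting elements to user `n` -/
  αrn : ℝ
  /-- transmit signal-to-noise ratio -/
  ρ : ℝ
  /-- power allocation factor of user `n` -/
  an : ℝ
  /-- power allocation factor of user `m` -/
  am : ℝ
  /-- target rate of user `n` -/
  Rn : ℝ
  /-- target rate of user `m` -/
  Rm : ℝ
  /-- mean power of the residual interference -/
  ΩI : ℝ

namespace Params

/-- The standing assumptions on the parameters. -/
structure Valid (S : Params) : Prop where
  K_pos : 0 < S.K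
  κ_nonneg : 0 ≤ S.κ
  αsn_pos : 0 < S.αsn
  αsr_pos : 0 < S.αsr
  αrn_pos : 0 < S.αrn
  ρ_pos : 0 < S.ρ
  an_pos : 0 < S.an
  an_lt_am : S.an < S.am
  an_add_am : S.an + S.am = 1
  Rn_pos : 0 < S.Rn
  Rm_pos : 0 < S.Rm
  ΩI_pos : 0 < S.ΩI

variable (S : Params)

/-- Target SNR `2^{R_n} - 1` of user `n`. -/
def γthn : ℝ := (2 : ℝ) ^ S.Rn - 1

/-- Target SNR `2^{R_m} - 1` of user `m`. -/
def γthm : ℝ := (2 : ℝ) ^ S.Rm - 1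

/-- `β = γ_{th_n} / (a_n ρ)`. -/
def β : ℝ := S.γthn / (S.an * S.ρ)

/-- `τ = γ_{th_m} / (ρ (a_m - γ_{th_m} a_n))`. -/
def τ : ℝ := S.γthm / (S.ρ * (S.am - S.γthm * S.an))

/-- `μ_n`. -/
def μn : ℝ :=
  Real.pi * Real.sqrt (S.αsr * S.αrn) / (4 * (S.κ + 1)) * laguerreHalf (-S.κ) ^ 2

/-- `Ω_n`. -/
def Ωn : ℝ :=
  S.αsr * S.αrn * (1 - Real.pi ^ 2 / (16 * (1 + S.κ) ^ 2) * laguerreHalf (-S.κ) ^ 4)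

/-- `φ_n = K μ_n² / Ω_n - 1`. -/
def φn : ℝ := S.μn ^ 2 * (S.K : ℝ) / S.Ωn - 1

/-- `ϕ_n = Ω_n / μ_n`. -/
def ϕn : ℝ := S.Ωn / S.μn

/-! ### The closed-form double sum -/

/-- `Φ = 1 / (2^{φ_n} ϕ_n^{φ_n + 1} Γ(φ_n + 1))`. -/
def Φ : ℝ := 1 / ((2 : ℝ) ^ S.φn * S.ϕn ^ (S.φn + 1) * Real.Gamma (S.φn + 1))

/-- `χ = √(β (ϖ x Ω_I ρ + 1))` at the Gauss–Laguerre abscissa `x`. -/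
def χ (ϖ x : ℝ) : ℝ := Real.sqrt (S.β * (ϖ * x * S.ΩI * S.ρ + 1))

/-- The approximate outage probability: the double sum over the `P` Gauss–Laguerre and the
`U` Gauss–Chebyshev abscissas. -/
def quadratureOutage (ϖ : ℝ) (P U : ℕ) : ℝ :=
  S.Φ * ∑ x ∈ laguerreNodes P, ∑ u ∈ Finset.Icc 1 U,
    laguerreWeight P x * chebyshevWeight U u * S.χ ϖ x ^ (S.φn + 1)
      * (chebyshevNode U u + 1) ^ S.φn
      * Real.exp (-((chebyshevNode U u + 1) * S.χ ϖ x / (2 * S.ϕn)))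
      * (1 - marcumQ (Real.sqrt (2 * S.κ))
          ((S.χ ϖ x - (chebyshevNode U u + 1) * S.χ ϖ x / 2)
            * Real.sqrt (2 * (S.κ + 1) / S.αsn)))

/-! ### Outage events -/

/-- SINR `γ_{n → m}` of user `n` detecting the signal of user `m`, as a function of the
end-to-end power gain `g`. -/
def sinrNM (g : ℝ) : ℝ := g * S.ρ * S.am / (g * S.ρ * S.an + 1)

/-- SINR `γ_n` of user `n` detecting its own signal after interference cancellation, as a function
of the end-to-end power gain `g` and the residual interference power `i`. -/
def sinrN (ϖ g i : ℝ) : ℝ := g * S.ρ * S.an / (ϖ * i * S.ρ + 1)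

/-- The outage probability
`Pr(γ_{n→m} < γ_{th_m}) + Pr(γ_{n→m} > γ_{th_m}, γ_n < γ_{th_n})` of user `n` when its end-to-end
power gain is the random variable `g` and the residual interference power is `i`. -/
def outage {Ω : Type*} [MeasurableSpace Ω] (P : Measure Ω) (ϖ : ℝ) (g i : Ω → ℝ) : ℝ :=
  P.real {ω | S.sinrNM (g ω) < S.γthm}
    + P.real {ω | S.sinrNM (g ω) > S.γthm ∧ S.sinrN ϖ (g ω) (i ω) < S.γthn}

end Params

/-! ### Channels -/

/-- The circularly symmetric complex normal distribution `CN(0, v)`: independent real and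
imaginary parts, each of law `N(0, v / 2)`. -/
def complexNormal (v : ℝ) : Measure ℂ :=
  ((gaussianReal 0 (v / 2).toNNReal).prod (gaussianReal 0 (v / 2).toNNReal)).map
    fun p : ℝ × ℝ => (p.1 : ℂ) + (p.2 : ℂ) * Complex.I

/-- The Rician channel coefficient `√α (√(κ / (κ + 1)) + √(1 / (κ + 1)) w)` with scattered
component `w`. -/
def rician (κ α : ℝ) (w : ℂ) : ℂ :=
  (Real.sqrt α : ℂ) * ((Real.sqrt (κ / (κ + 1)) : ℂ) + (Real.sqrt (1 / (κ + 1)) : ℂ) * w)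

/-- The random fading components: the scattered components `wsn`, `wsr k`, `wrn k` of the links
from base station to user `n`, from base station to the `k`-th element, and from the `k`-th element
to user `n`; and the residual interference `hI`. -/
structure Fading (K : ℕ) (Ω : Type*) where
  wsn : Ω → ℂ
  hI : Ω → ℂ
  wsr : Fin K → Ω → ℂ
  wrn : Fin K → Ω → ℂ

namespace Fading

/-- All scattered components have law `CN(0, 1)`, the residual interference has law `CN(0, ΩI)`,
and all of these variables are independent. -/
structure IsRician {K : ℕ} {Ω : Type*} [MeasurableSpace Ω] (F : Fading K Ω) (P : Measure Ω)
    (ΩI : ℝ) : Prop where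
  law_sn : HasLaw F.wsn (complexNormal 1) P
  law_I : HasLaw F.hI (complexNormal ΩI) P
  law_sr : ∀ k, HasLaw (F.wsr k) (complexNormal 1) P
  law_rn : ∀ k, HasLaw (F.wrn k) (complexNormal 1) P
  indep : iIndepFun (Sum.elim ![F.wsn, F.hI] (Sum.elim F.wsr F.wrn)) P

variable {Ω : Type*} (S : Params) (F : Fading S.K Ω)

/-- Channel from the base station to user `n`. -/
def hsn (ω : Ω) : ℂ := rician S.κ S.αsn (F.wsn ω)

/-- Channel from the base station to the `k`-th element. -/
def hsr (k : Fin S.K) (ω : Ω) : ℂ := rician S.κ S.αsr (F.wsr k ω)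

/-- Channel from the `k`-th element to user `n`. -/
def hrn (k : Fin S.K) (ω : Ω) : ℂ := rician S.κ S.αrn (F.wrn k ω)

/-- Coherent phase shifts: `θ_k ∈ [0, 2π)` rotates the cascade term `h_rn^k conj(h_sr^k)` onto the
phase of the direct link. -/
def coherentPhase (ω : Ω) (k : Fin S.K) : ℝ :=
  toIcoMod Real.two_pi_pos 0
    (Complex.arg (F.hsn S ω) - Complex.arg (F.hrn S k ω * star (F.hsr S k ω)))

/-- The reflecting matrix `diag(√β_k e^{jθ_k})`, with energy coefficients `β_k = 1`. -/
def reflectingMatrix (ω : Ω) : Matrix (Fin S.K) (Fin S.K) ℂ :=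
  Matrix.diagonal fun k =>
    (Real.sqrt 1 : ℂ) * Complex.exp (Complex.I * (F.coherentPhase S ω k : ℂ))

/-- The end-to-end channel `h_sn + 𝐡_rnᴴ Θ_R 𝐡_sr`, where `𝐡_sr = [h_sr^1 ⋯ h_sr^K]ᴴ` and
`𝐡_rn = [h_rn^1 ⋯ h_rn^K]ᴴ`. -/
def endToEnd (ω : Ω) : ℂ :=
  F.hsn S ω + dotProduct (star fun k => star (F.hrn S k ω))
    (Matrix.mulVec (F.reflectingMatrix S ω) fun k => star (F.hsr S k ω))

/-- The exact outage probability of user `n`. -/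
def outageProb [MeasurableSpace Ω] (P : Measure Ω) (ϖ : ℝ) : ℝ :=
  S.outage P ϖ (fun ω => ‖F.endToEnd S ω‖ ^ 2) (fun ω => ‖F.hI ω‖ ^ 2)

/-- The cascade sum `X = ∑_k |h_sr^k h_rn^k|`. -/
def cascade (ω : Ω) : ℝ := ∑ k, ‖F.hsr S k ω * F.hrn S k ω‖

end Fading

/-! ### The Gamma surrogate -/

/-- The Gamma law with density `x^{φ_n} e^{-x/ϕ_n} / (ϕ_n^{φ_n + 1} Γ(φ_n + 1))` on `(0, ∞)`. -/
def Params.gammaLaw (S : Params) : Measure ℝ := gammaMeasure (S.φn + 1) (1 / S.ϕn)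

/-- The outage probability of user `n` under coherent phase shifting when the cascade sum is
replaced by a variable with the Gamma law, independent of the direct link and of the residual
interference. -/
def Params.gammaOutage (S : Params) (ϖ : ℝ) : ℝ :=
  S.outage (((complexNormal 1).prod (complexNormal S.ΩI)).prod S.gammaLaw) ϖ
    (fun p : (ℂ × ℂ) × ℝ => (‖rician S.κ S.αsn p.1.1‖ + p.2) ^ 2)
    (fun p : (ℂ × ℂ) × ℝ => ‖p.1.2‖ ^ 2)

end

end StarRis

open StarRis

namespace StarRis

open scoped ENNReal

/-! ### Laguerre polynomials -/

/-! Gamma approximation. The cascade sum is `cascadeScale` times a sum of `K` independent copies of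
a gain whose law `unitGainLaw κ` depends on `κ` alone. The matched Gamma law has the same structure:
Gamma laws are infinitely divisible, so it is `cascadeScale` times a sum of `K` independent Gamma
variables whose shape and rate depend on `κ` alone and which have the mean and variance of
`unitGainLaw κ` (`charFun_gammaMeasure_mul`, `gammaLaw_eq`). The central limit theorem, made uniform
by Pólya's theorem (`tendsto_cltError`), compares both distribution functions with the same normal
distribution function at the same standardised point. The scale cancels there, so the sum of the two
errors is a `δ` depending only on `κ` and `K` (`exists_cascade_error`). Matching requires the mean
of the Rice law, obtained by writing the modulus as a superposition of Gaussians
(`integral_norm_add_complexNormal`), and a nonzero variance (`laguerreHalf_sq_lt`).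

Outage. Coherent phases align all terms with the direct link, so the end-to-end modulus is `|h_sn| +
X` (`Fading.norm_endToEnd`). Up to a null set, outage means that this modulus lies below a threshold
depending on the interference only (`outageOfLaw_eq`). For fixed direct link and interference this
is a half-line in `X`, so integrating a uniform bound on distribution functions bounds the change of
the outage probability by the same `δ` (`abs_outageOfLaw_sub_le`). If the SINR cannot reach its
target, both probabilities are 1.

Quadrature. When `τ ≤ β` the threshold is `χ`; the interference power is exponential, so the
surrogate outage is `∫ gainCdf (χ x) e^{-x} dx`. The substitution `y = (cos t + 1) c / 2` writes
`gainCdf c` as an integral over `(0, π)` (`gainCdf_eq`), and the double sum is exactly the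
Gauss–Laguerre rule in `x` applied to midpoint sums in `t` (`quadratureOutage_eq`). The midpoint
sums converge locally uniformly in `x` by dominated convergence, despite an integrable singularity
at `t = π` (`tendstoLocallyUniformlyOn_midpoint_sum`). For the Laguerre rule, the
Christoffel–Darboux identity gives real simple zeros, positive weights and exactness on monomials of
degree below the number of nodes. Taylor expansion then reaches the functions `e^{-jx/2}`, and the
Weierstrass theorem all continuous functions with a limit at infinity (`laguerreConv_of_tendsto`). A
polynomial majorant controls the tail in the joint limit (`tendsto_gaussLaguerre_joint`). -/

lemma laguerrePoly_coeff (n k : ℕ) :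
    (laguerrePoly n).coeff k
      = (-1 : ℝ) ^ k * (n.choose k : ℝ) * ((n.factorial : ℝ) / (k.factorial : ℝ)) := by
  simp only [laguerrePoly, Polynomial.finsetSum_coeff, Polynomial.coeff_C_mul,
    Polynomial.coeff_X_pow]
  simp only [mul_ite, mul_one, mul_zero, Finset.sum_ite_eq, Finset.mem_range]
  split_ifs with h
  · rfl
  · rw [Nat.choose_eq_zero_of_lt (by omega)]; simp

/-- Working over `ℝ` avoids truncated subtraction: for `j > n` both binomials vanish, so coefficient
comparisons need no case split. -/
lemma succ_mul_choose_real (n j : ℕ) :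
    ((j : ℝ) + 1) * (n.choose (j + 1) : ℝ) = ((n : ℝ) - j) * (n.choose j : ℝ) := by
  rcases le_or_gt j n with h | h
  · have := Nat.choose_succ_right_eq n j
    rw [← Nat.cast_sub h]
    have h2 : ((n.choose (j + 1) * (j + 1) : ℕ) : ℝ) = ((n.choose j * (n - j) : ℕ) : ℝ) := by
      rw [this]
    push_cast at h2 ⊢
    linarith
  · rw [Nat.choose_eq_zero_of_lt h, Nat.choose_eq_zero_of_lt (by omega)]; simp

/-- Comparison of coefficients reduces to Pascal's rule and absorption. This three-term recurrence
drives the Christoffel–Darboux induction. -/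
lemma laguerrePoly_rec (n : ℕ) :
    laguerrePoly (n + 2) = (Polynomial.C (2 * (n : ℝ) + 3) - Polynomial.X) * laguerrePoly (n + 1)
      - Polynomial.C (((n : ℝ) + 1) ^ 2) * laguerrePoly n := by
  ext k
  rw [Polynomial.coeff_sub, sub_mul, Polynomial.coeff_sub, Polynomial.coeff_C_mul,
    Polynomial.coeff_C_mul]
  cases k with
  | zero =>
    simp only [Polynomial.mul_coeff_zero, Polynomial.coeff_X_zero, zero_mul, laguerrePoly_coeff,
      pow_zero, Nat.choose_zero_right, Nat.factorial_zero, Nat.factorial_succ]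
    push_cast
    ring
  | succ j =>
    rw [Polynomial.coeff_X_mul]
    simp only [laguerrePoly_coeff]
    have hf : (j.factorial : ℝ) ≠ 0 := by positivity
    have hj : (j : ℝ) + 1 ≠ 0 := by positivity
    have h1 := succ_mul_choose_real n j
    have h2 := succ_mul_choose_real (n + 1) j
    have e1 : ((n + 1).choose (j + 1) : ℝ) = n.choose j + n.choose (j + 1) := by
      rw [Nat.choose_succ_succ]; push_cast; ring
    have e2 : ((n + 2).choose (j + 1) : ℝ) = (n + 1).choose j + (n + 1).choose (j + 1) := by
      rw [Nat.choose_succ_succ]; push_cast; ring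
    rw [e2]
    rw [e1] at h2 ⊢
    simp only [Nat.factorial_succ]
    push_cast at h2 ⊢
    field_simp
    set x := (n.choose j : ℝ)
    set B := (n.choose (j + 1) : ℝ)
    set e := ((n + 1).choose j : ℝ)
    have : ((n : ℝ) + 1 + 1) * (e + (x + B)) = (2 * n + 3) * (x + B) + (j + 1) * e - (n + 1) * B := by
      linarith
    rw [pow_succ]
    linear_combination (-(-1 : ℝ) ^ j) * this

/-- At a zero of `L_n` this trades the derivative for `L_{n+1}`, which is how `L_{P+1}` enters the
quadrature weight. -/
lemma laguerrePoly_derivative (n : ℕ) :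
    Polynomial.X * (laguerrePoly n).derivative = laguerrePoly (n + 1)
      - (Polynomial.C ((n : ℝ) + 1) - Polynomial.X) * laguerrePoly n := by
  ext k
  rw [Polynomial.coeff_sub, sub_mul, Polynomial.coeff_sub, Polynomial.coeff_C_mul]
  cases k with
  | zero =>
    simp only [Polynomial.mul_coeff_zero, Polynomial.coeff_X_zero, zero_mul, laguerrePoly_coeff,
      pow_zero, Nat.choose_zero_right, Nat.factorial_zero, Nat.factorial_succ]
    push_cast
    ring
  | succ j =>
    rw [Polynomial.coeff_X_mul, Polynomial.coeff_X_mul, Polynomial.coeff_derivative]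
    simp only [laguerrePoly_coeff]
    have hf : (j.factorial : ℝ) ≠ 0 := by positivity
    have hj : (j : ℝ) + 1 ≠ 0 := by positivity
    have h1 := succ_mul_choose_real n j
    have e1 : ((n + 1).choose (j + 1) : ℝ) = n.choose j + n.choose (j + 1) := by
      rw [Nat.choose_succ_succ]; push_cast; ring
    rw [e1]
    simp only [Nat.factorial_succ]
    push_cast
    field_simp
    rw [pow_succ]
    linear_combination (-(-1 : ℝ) ^ j) * h1

/-- The Laguerre polynomials normalised to be orthonormal, evaluated in a real algebra. -/
noncomputable def laguerreON {A : Type*} [Field A] [Algebra ℝ A] (z : A) (n : ℕ) : A :=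
  Polynomial.aeval z (laguerrePoly n) / (n.factorial : A)

section
variable {A : Type*} [Field A] [Algebra ℝ A]

lemma laguerreON_zero (z : A) : laguerreON z 0 = 1 := by
  simp [laguerreON, laguerrePoly]

lemma laguerreON_one (z : A) : laguerreON z 1 = 1 - z := by
  simp [laguerreON, laguerrePoly, Finset.sum_range_succ, sub_eq_add_neg]

/-- Division by `n!` makes the recurrence symmetric (a Jacobi matrix), so that the
Christoffel–Darboux sum telescopes. A general field is kept because complex points are needed to
show that the zeros are real. -/
lemma laguerreON_rec [CharZero A] (z : A) (n : ℕ) :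
    ((n : A) + 2) * laguerreON z (n + 2)
      = (2 * (n : A) + 3 - z) * laguerreON z (n + 1) - ((n : A) + 1) * laguerreON z n := by
  have hf : (n.factorial : A) ≠ 0 := by exact_mod_cast n.factorial_ne_zero
  have h1 : (n : A) + 1 ≠ 0 := by exact_mod_cast (n.succ_ne_zero)
  have h2 : (n : A) + 2 ≠ 0 := by exact_mod_cast (by omega : n + 2 ≠ 0)
  have h2' : (n : A) + 1 + 1 ≠ 0 := by exact_mod_cast (by omega : n + 2 ≠ 0)
  simp only [laguerreON, laguerrePoly_rec, Nat.factorial_succ, map_sub, map_mul, map_add, map_pow,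
    Polynomial.aeval_X, map_natCast, map_ofNat, map_one]
  push_cast
  field_simp
  ring

/-- The Christoffel–Darboux identity. -/
lemma christoffel_darboux [CharZero A] (z w : A) (n : ℕ) :
    (z - w) * ∑ k ∈ Finset.range (n + 1), laguerreON z k * laguerreON w k
      = ((n : A) + 1) * (laguerreON z n * laguerreON w (n + 1)
        - laguerreON z (n + 1) * laguerreON w n) := by
  induction n with
  | zero => simp [laguerreON_zero, laguerreON_one]
  | succ n ih =>
    rw [Finset.sum_range_succ, mul_add, ih]
    have hz := laguerreON_rec z n
    have hw := laguerreON_rec w n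
    push_cast
    linear_combination (-laguerreON z (n+1)) * hw + laguerreON w (n + 1) * hz

end

lemma laguerreON_derivative (x : ℝ) (n : ℕ) :
    x * ((laguerrePoly n).derivative.eval x / n.factorial)
      = ((n : ℝ) + 1) * laguerreON x (n + 1) - ((n : ℝ) + 1 - x) * laguerreON x n := by
  have hf : (n.factorial : ℝ) ≠ 0 := by positivity
  have h1 : (n : ℝ) + 1 ≠ 0 := by positivity
  have := congrArg (Polynomial.eval x) (laguerrePoly_derivative n)
  simp only [Polynomial.eval_mul, Polynomial.eval_X, Polynomial.eval_sub, Polynomial.eval_C] at this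
  simp only [laguerreON, Polynomial.coe_aeval_eq_eval, Nat.factorial_succ]
  push_cast
  field_simp
  linarith

lemma laguerreON_hasDerivAt (x : ℝ) (n : ℕ) :
    HasDerivAt (fun y : ℝ => laguerreON y n) ((laguerrePoly n).derivative.eval x / n.factorial) x := by
  simp only [laguerreON, Polynomial.coe_aeval_eq_eval]
  exact ((laguerrePoly n).hasDerivAt x).div_const _

/-- The confluent Christoffel–Darboux identity. -/
lemma christoffel_darboux_confluent (x : ℝ) (n : ℕ) :
    ∑ k ∈ Finset.range (n + 1), laguerreON x k ^ 2
      = ((n : ℝ) + 1) * ((laguerrePoly n).derivative.eval x / n.factorial * laguerreON x (n + 1)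
        - (laguerrePoly (n + 1)).derivative.eval x / (n + 1).factorial * laguerreON x n) := by
  -- Both sides of Christoffel–Darboux are differentiated in the first variable on the diagonal; the
  -- factor `z - x` kills the derivative of the sum.
  have h1 : HasDerivAt (fun z : ℝ => (z - x) * ∑ k ∈ Finset.range (n + 1),
      laguerreON z k * laguerreON x k) (1 * (∑ k ∈ Finset.range (n + 1),
      laguerreON x k * laguerreON x k) + (x - x) * ∑ k ∈ Finset.range (n + 1),
        ((laguerrePoly k).derivative.eval x / k.factorial) * laguerreON x k) x :=
    ((hasDerivAt_id x).sub_const x).mul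
      (HasDerivAt.fun_sum fun k _ => (laguerreON_hasDerivAt x k).mul_const _)
  have h2 : HasDerivAt (fun z : ℝ => ((n : ℝ) + 1) * (laguerreON z n * laguerreON x (n + 1)
        - laguerreON z (n + 1) * laguerreON x n)) _ x :=
    (((laguerreON_hasDerivAt x n).mul_const _).sub
      ((laguerreON_hasDerivAt x (n + 1)).mul_const _)).const_mul _
  simp_rw [← christoffel_darboux] at h2
  have := h1.unique h2
  rw [← this]
  simp [sq]

/-! ### Zeros of the Laguerre polynomials and exactness of the Gauss–Laguerre rule. -/

lemma natDegree_laguerrePoly (n : ℕ) : (laguerrePoly n).natDegree = n := by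
  apply Polynomial.natDegree_eq_of_le_of_coeff_ne_zero
  · rw [Polynomial.natDegree_le_iff_coeff_eq_zero]
    intro k hk
    rw [laguerrePoly_coeff, Nat.choose_eq_zero_of_lt hk]; simp
  · rw [laguerrePoly_coeff]
    have : (n.factorial : ℝ) ≠ 0 := by positivity
    simp [this]

lemma laguerrePoly_ne_zero (n : ℕ) : laguerrePoly n ≠ 0 := by
  intro h
  have := laguerrePoly_coeff n 0
  rw [h] at this
  have hf : (n.factorial : ℝ) ≠ 0 := by positivity
  simp at this
  exact hf this.symm

/-- The alternating signs cancel those of the powers of `x`, and the constant term `n!` is positive.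
Hence all real zeros are positive. -/
lemma laguerrePoly_eval_pos {x : ℝ} (n : ℕ) (hx : x ≤ 0) : 0 < (laguerrePoly n).eval x := by
  simp only [laguerrePoly, Polynomial.eval_finsetSum, Polynomial.eval_mul, Polynomial.eval_C,
    Polynomial.eval_pow, Polynomial.eval_X]
  apply Finset.sum_pos'
  · intro k _
    have : (-1 : ℝ) ^ k * (n.choose k : ℝ) * ((n.factorial : ℝ) / (k.factorial : ℝ)) * x ^ k
      = (n.choose k : ℝ) * ((n.factorial : ℝ) / (k.factorial : ℝ)) * (-x) ^ k := by
      rw [neg_pow x]; ring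
    rw [this]
    have : 0 ≤ -x := by linarith
    positivity
  · exact ⟨0, by simp, by simp; positivity⟩

lemma laguerreON_eq_zero {x : ℝ} {n : ℕ} (h : x ∈ laguerreNodes n) : laguerreON x n = 0 := by
  simp only [laguerreNodes, Multiset.mem_toFinset, Polynomial.mem_roots', Polynomial.IsRoot] at h
  simp [laguerreON, h.2]

lemma laguerreNodes_pos {x : ℝ} {n : ℕ} (h : x ∈ laguerreNodes n) : 0 < x := by
  by_contra hx
  have := laguerrePoly_eval_pos n (not_lt.mp hx)
  simp only [laguerreNodes, Multiset.mem_toFinset, Polynomial.mem_roots', Polynomial.IsRoot] at h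
  exact this.ne' h.2

lemma sum_laguerreON_sq_pos (x : ℝ) (n : ℕ) :
    0 < ∑ k ∈ Finset.range (n + 1), laguerreON x k ^ 2 :=
  Finset.sum_pos' (fun k _ => sq_nonneg _) ⟨0, by simp, by simp [laguerreON_zero]⟩

/-- At a double zero the right side of the confluent identity would vanish, whereas its left side is
a sum of squares containing `1`. -/
lemma laguerrePoly_derivative_ne_zero {x : ℝ} {n : ℕ} (h : x ∈ laguerreNodes n) :
    (laguerrePoly n).derivative.eval x ≠ 0 := by
  intro h0
  have h1 := christoffel_darboux_confluent x n
  rw [laguerreON_eq_zero h, h0] at h1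
  have := sum_laguerreON_sq_pos x n
  simp at h1
  linarith

/-- Christoffel–Darboux at `z` and its conjugate: the right side vanishes at a zero, and the sum is
`∑ |ℓ_k(z)|² > 0`, so `z` equals its conjugate. -/
lemma laguerre_complex_root_real {z : ℂ} {n : ℕ} (h : Polynomial.aeval z (laguerrePoly n) = 0) :
    z.im = 0 := by
  by_contra hz
  have hcd := christoffel_darboux z (star z) n
  have hconj : ∀ k, laguerreON (star z) k = star (laguerreON z k) := by
    intro k
    simp only [laguerreON, star_div₀, star_natCast]
    congr 1
    have := Polynomial.aeval_conj (laguerrePoly k) z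
    simpa using this
  have h0 : laguerreON z n = 0 := by simp [laguerreON, h]
  rw [hconj n, h0] at hcd
  simp only [hconj] at hcd
  simp only [star_zero, mul_zero, zero_mul, sub_zero, mul_eq_zero] at hcd
  rcases hcd with hcd | hcd
  · apply hz
    have := congrArg Complex.im hcd
    simp at this
    linarith
  · have h1 : ∑ k ∈ Finset.range (n + 1), laguerreON z k * star (laguerreON z k)
        = ((∑ k ∈ Finset.range (n + 1), Complex.normSq (laguerreON z k) : ℝ) : ℂ) := by
      push_cast
      exact Finset.sum_congr rfl fun k _ => Complex.mul_conj _
    rw [h1] at hcd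
    have h2 : ∑ k ∈ Finset.range (n + 1), Complex.normSq (laguerreON z k) = 0 := by
      exact_mod_cast hcd
    have h3 : 0 < ∑ k ∈ Finset.range (n + 1), Complex.normSq (laguerreON z k) :=
      Finset.sum_pos' (fun k _ => Complex.normSq_nonneg _) ⟨0, by simp, by simp [laguerreON_zero]⟩
    linarith

lemma laguerrePoly_splits (n : ℕ) : (laguerrePoly n).Splits := by
  refine Polynomial.Splits.of_splits_map (algebraMap ℝ ℂ) (IsAlgClosed.splits _) fun z hz => ?_
  have hz' := (Polynomial.mem_roots'.1 hz).2
  rw [Polynomial.IsRoot, Polynomial.eval_map_algebraMap] at hz'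
  refine ⟨z.re, Complex.ext (by simp) ?_⟩
  simp [laguerre_complex_root_real hz']

/-- The zeros are real and simple. The exact count makes the matrix in the discrete orthonormality
argument square. -/
lemma card_laguerreNodes (n : ℕ) : (laguerreNodes n).card = n := by
  have hnd : (laguerrePoly n).roots.Nodup := by
    rw [Multiset.nodup_iff_count_le_one]
    intro x
    rw [Polynomial.count_roots]
    by_contra hx
    have := (Polynomial.one_lt_rootMultiplicity_iff_isRoot (laguerrePoly_ne_zero n)).1 (not_le.1 hx)
    have hx' : x ∈ laguerreNodes n := by
      simp [laguerreNodes, laguerrePoly_ne_zero, this.1.eq_zero]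
    exact laguerrePoly_derivative_ne_zero hx' this.2
  rw [laguerreNodes, Multiset.toFinset_card_of_nodup hnd]
  rw [← (laguerrePoly_splits n).natDegree_eq_card_roots, natDegree_laguerrePoly]

/-- The Christoffel numbers of the Gauss–Laguerre rule. -/
lemma laguerreWeight_mul_sum {x : ℝ} {n : ℕ} (h : x ∈ laguerreNodes n) :
    laguerreWeight n x * ∑ k ∈ Finset.range n, laguerreON x k ^ 2 = 1 := by
  have h0 := laguerreON_eq_zero h
  have hx := laguerreNodes_pos h
  have h1 := christoffel_darboux_confluent x n
  have h2 := laguerreON_derivative x n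
  have hpos := sum_laguerreON_sq_pos x n
  rw [Finset.sum_range_succ, h0] at h1 hpos
  rw [h0] at h2
  simp only [mul_zero, sub_zero, ne_eq, OfNat.ofNat_ne_zero, not_false_eq_true, zero_pow,
    add_zero] at h1 h2 hpos
  -- With the derivative expressed by `ℓ_{n+1}`, the confluent sum becomes `((n+1) ℓ_{n+1}(x))² /
  -- x`, the reciprocal of the weight.
  have hD : (laguerrePoly n).derivative.eval x / n.factorial
      = ((n : ℝ) + 1) * laguerreON x (n + 1) / x := by
    rw [← h2]; field_simp
  rw [hD] at h1
  have hl : laguerreON x (n + 1) ≠ 0 := by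
    intro hl; rw [hl] at h1; simp at h1; linarith
  have hfn : (n.factorial : ℝ) ≠ 0 := by positivity
  have hn1 : (n : ℝ) + 1 ≠ 0 := by positivity
  have hLe : (laguerrePoly (n + 1)).eval x = laguerreON x (n + 1) * ((n + 1) * n.factorial) := by
    simp only [laguerreON, Polynomial.coe_aeval_eq_eval, Nat.factorial_succ]
    push_cast
    field_simp
  rw [h1, laguerreWeight, hLe]
  field_simp

lemma laguerreWeight_nonneg {x : ℝ} {n : ℕ} (h : x ∈ laguerreNodes n) :
    0 ≤ laguerreWeight n x := by
  have := laguerreNodes_pos h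
  unfold laguerreWeight; positivity

/-- Discrete orthonormality of the Laguerre polynomials. -/
lemma sum_laguerreWeight_laguerreON {n k : ℕ} (hk : k < n) :
    ∑ x ∈ laguerreNodes n, laguerreWeight n x * laguerreON x k = if k = 0 then 1 else 0 := by
  -- The columns are orthonormal: off the diagonal by Christoffel–Darboux at two zeros, on it by the
  -- Christoffel numbers. A square matrix with orthonormal columns has orthonormal rows; row `k`
  -- against row `0` is the claim.
  let A : Matrix (Fin n) (laguerreNodes n) ℝ :=
    Matrix.of fun k x => laguerreON (x : ℝ) k * Real.sqrt (laguerreWeight n x)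
  have hA : ∀ k x, A k x = laguerreON (x : ℝ) k * Real.sqrt (laguerreWeight n x) := fun _ _ => rfl
  have hAA : A.transpose * A = 1 := by
    ext x y
    simp only [Matrix.mul_apply, Matrix.transpose_apply, hA]
    have hs : ∑ j : Fin n, laguerreON (x : ℝ) j * Real.sqrt (laguerreWeight n x)
        * (laguerreON (y : ℝ) j * Real.sqrt (laguerreWeight n y))
        = Real.sqrt (laguerreWeight n x) * Real.sqrt (laguerreWeight n y) *
          ∑ j ∈ Finset.range n, laguerreON (x : ℝ) j * laguerreON (y : ℝ) j := by
      rw [Finset.sum_range, Finset.mul_sum]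
      exact Finset.sum_congr rfl fun j _ => by ring
    rw [hs]
    by_cases hxy : x = y
    · subst hxy
      rw [Real.mul_self_sqrt (laguerreWeight_nonneg x.2), Matrix.one_apply_eq]
      simp_rw [← sq]
      exact laguerreWeight_mul_sum x.2
    · rw [Matrix.one_apply_ne hxy]
      have hcd := christoffel_darboux (x : ℝ) y n
      rw [Finset.sum_range_succ, laguerreON_eq_zero x.2, laguerreON_eq_zero y.2] at hcd
      simp only [mul_zero, zero_mul, sub_zero, add_zero, mul_eq_zero] at hcd
      rcases hcd with hcd | hcd
      · exact absurd (Subtype.ext (sub_eq_zero.1 hcd)) hxy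
      · rw [hcd, mul_zero]
  have hcard : Fintype.card (Fin n) = Fintype.card (laguerreNodes n) := by
    simp [card_laguerreNodes]
  have hAA' : A * A.transpose = 1 := by
    rwa [Matrix.mul_eq_one_comm_of_card_eq _ _ _ hcard.symm] at hAA
  have := congrFun (congrFun hAA' ⟨k, hk⟩) ⟨0, by omega⟩
  simp only [Matrix.mul_apply, Matrix.transpose_apply, hA, Matrix.one_apply, Fin.mk.injEq,
    laguerreON_zero] at this
  rw [← this, ← Finset.sum_coe_sort]
  refine Finset.sum_congr rfl fun x _ => ?_
  have := Real.mul_self_sqrt (laguerreWeight_nonneg x.2)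
  linear_combination -(laguerreON (x : ℝ) k) * this

/-- The Gauss–Laguerre rule integrates monomials of degree less than `n` exactly. -/
lemma sum_laguerreWeight_pow {n k : ℕ} (hk : k < n) :
    ∑ x ∈ laguerreNodes n, laguerreWeight n x * x ^ k = k.factorial := by
  induction k using Nat.strong_induction_on with
  | _ k ih =>
  have h1 := sum_laguerreWeight_laguerreON hk
  have hexp : ∀ x : ℝ, laguerreON x k = ∑ j ∈ Finset.range (k + 1),
      (-1 : ℝ) ^ j * (k.choose j : ℝ) / (j.factorial : ℝ) * x ^ j := by
    intro x
    have hf : (k.factorial : ℝ) ≠ 0 := by positivity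
    simp only [laguerreON, laguerrePoly, Polynomial.coe_aeval_eq_eval, Polynomial.eval_finsetSum,
      Polynomial.eval_mul, Polynomial.eval_C, Polynomial.eval_pow, Polynomial.eval_X,
      Finset.sum_div]
    exact Finset.sum_congr rfl fun j _ => by field_simp
  simp_rw [hexp, Finset.mul_sum] at h1
  rw [Finset.sum_comm] at h1
  have hf : ∀ j : ℕ, (j.factorial : ℝ) ≠ 0 := fun j => by positivity
  have h2 : ∀ j ∈ Finset.range k, ∑ x ∈ laguerreNodes n, laguerreWeight n x *
      ((-1 : ℝ) ^ j * (k.choose j : ℝ) / (j.factorial : ℝ) * x ^ j)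
      = (-1 : ℝ) ^ j * (k.choose j : ℝ) := by
    intro j hj
    have hj := Finset.mem_range.1 hj
    have := ih j hj (by omega)
    have e : ∑ x ∈ laguerreNodes n, laguerreWeight n x *
      ((-1 : ℝ) ^ j * (k.choose j : ℝ) / (j.factorial : ℝ) * x ^ j)
      = (-1 : ℝ) ^ j * (k.choose j : ℝ) / (j.factorial : ℝ) *
        ∑ x ∈ laguerreNodes n, laguerreWeight n x * x ^ j := by
      rw [Finset.mul_sum]; exact Finset.sum_congr rfl fun x _ => by ring
    rw [e, this, div_mul_cancel₀ _ (hf j)]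
  rw [Finset.sum_range_succ, Finset.sum_congr rfl h2] at h1
  -- The alternating binomial sum has the value given by discrete orthonormality and the same terms
  -- for `j < k`; cancelling them isolates the moment of order `k`.
  have h3 : ∑ j ∈ Finset.range (k + 1), (-1 : ℝ) ^ j * (k.choose j : ℝ) = if k = 0 then 1 else 0 := by
    exact_mod_cast Int.alternating_sum_range_choose (n := k)
  rw [← h3, Finset.sum_range_succ] at h1
  have h4 := add_left_cancel h1
  have e : ∑ x ∈ laguerreNodes n, laguerreWeight n x *
      ((-1 : ℝ) ^ k * (k.choose k : ℝ) / (k.factorial : ℝ) * x ^ k)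
      = (-1 : ℝ) ^ k / (k.factorial : ℝ) *
        ∑ x ∈ laguerreNodes n, laguerreWeight n x * x ^ k := by
    rw [Finset.mul_sum]; exact Finset.sum_congr rfl fun x _ => by simp; ring
  rw [e] at h4
  have hk0 := hf k
  have hs : (-1 : ℝ) ^ k ≠ 0 := by positivity
  simp only [Nat.choose_self, Nat.cast_one, mul_one] at h4
  field_simp at h4
  exact h4

/-! ### Convergence of Gauss–Laguerre quadrature -/

/-- The Gauss–Laguerre rule with `n` nodes. -/
noncomputable def gaussLaguerre (n : ℕ) (f : ℝ → ℝ) : ℝ :=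
  ∑ x ∈ laguerreNodes n, laguerreWeight n x * f x

/-- The Gauss–Laguerre rules converge at the exponentially integrable function `f`. -/
def LaguerreConv (f : ℝ → ℝ) : Prop :=
  IntegrableOn (fun x => f x * Real.exp (-x)) (Set.Ioi 0) ∧
    Tendsto (fun n => gaussLaguerre n f) atTop (𝓝 (∫ x in Set.Ioi 0, f x * Real.exp (-x)))

lemma gaussLaguerre_add (n : ℕ) (f g : ℝ → ℝ) :
    gaussLaguerre n (fun x => f x + g x) = gaussLaguerre n f + gaussLaguerre n g := by
  simp [gaussLaguerre, mul_add, Finset.sum_add_distrib]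

lemma gaussLaguerre_const_mul (n : ℕ) (c : ℝ) (f : ℝ → ℝ) :
    gaussLaguerre n (fun x => c * f x) = c * gaussLaguerre n f := by
  simp only [gaussLaguerre, Finset.mul_sum]
  exact Finset.sum_congr rfl fun _ _ => by ring

/-- Nonnegative weights at positive nodes make the rule a positive functional, so a majorant on `(0,
∞)` suffices. -/
lemma abs_gaussLaguerre_sub_le (n : ℕ) {f g h : ℝ → ℝ} (hfg : ∀ x, 0 < x → |f x - g x| ≤ h x) :
    |gaussLaguerre n f - gaussLaguerre n g| ≤ gaussLaguerre n h := by
  simp only [gaussLaguerre, ← Finset.sum_sub_distrib]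
  refine (Finset.abs_sum_le_sum_abs _ _).trans (Finset.sum_le_sum fun x hx => ?_)
  rw [← mul_sub, abs_mul, abs_of_nonneg (laguerreWeight_nonneg hx)]
  exact mul_le_mul_of_nonneg_left (hfg x (laguerreNodes_pos hx)) (laguerreWeight_nonneg hx)

lemma LaguerreConv.add {f g : ℝ → ℝ} (hf : LaguerreConv f) (hg : LaguerreConv g) :
    LaguerreConv fun x => f x + g x := by
  constructor
  · simp_rw [add_mul]; exact hf.1.add hg.1
  · simp_rw [gaussLaguerre_add, add_mul]
    rw [integral_add hf.1 hg.1]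
    exact hf.2.add hg.2

lemma LaguerreConv.const_mul {f : ℝ → ℝ} (hf : LaguerreConv f) (c : ℝ) :
    LaguerreConv fun x => c * f x := by
  constructor
  · simp_rw [mul_assoc]; exact hf.1.const_mul c
  · simp_rw [gaussLaguerre_const_mul, mul_assoc]
    rw [integral_const_mul]
    exact hf.2.const_mul c

lemma LaguerreConv.sum {ι : Type*} (s : Finset ι) {f : ι → ℝ → ℝ}
    (hf : ∀ i ∈ s, LaguerreConv (f i)) : LaguerreConv fun x => ∑ i ∈ s, f i x := by
  classical
  induction s using Finset.induction_on with
  | empty =>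
    simp only [Finset.sum_empty]
    exact ⟨by simp, by simp [gaussLaguerre]⟩
  | insert a s ha ih =>
    simp_rw [Finset.sum_insert ha]
    exact (hf a (by simp)).add (ih fun i hi => hf i (by simp [hi]))

/-- By exactness the sequence of sums is eventually constant, equal to `Γ(k + 1)`. -/
lemma laguerreConv_pow (k : ℕ) : LaguerreConv fun x => x ^ k := by
  have h1 : ∀ x ∈ Set.Ioi (0 : ℝ), Real.exp (-x) * x ^ ((k : ℝ) + 1 - 1) = x ^ k * Real.exp (-x) := by
    intro x _
    rw [add_sub_cancel_right, Real.rpow_natCast, mul_comm]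
  have hk : (0 : ℝ) < k + 1 := by positivity
  refine ⟨(Real.GammaIntegral_convergent hk).congr_fun h1 measurableSet_Ioi, ?_⟩
  rw [← setIntegral_congr_fun measurableSet_Ioi h1, ← Real.Gamma_eq_integral hk,
    Real.Gamma_nat_eq_factorial]
  refine tendsto_const_nhds.congr' ?_
  filter_upwards [eventually_gt_atTop k] with n hn
  exact (sum_laguerreWeight_pow hn).symm

lemma integral_pow_mul_exp_neg (k : ℕ) :
    ∫ x in Set.Ioi (0 : ℝ), x ^ k * Real.exp (-x) = k.factorial := by
  have h := (laguerreConv_pow k).2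
  refine tendsto_nhds_unique h (tendsto_const_nhds.congr' ?_)
  filter_upwards [eventually_gt_atTop k] with n hn
  exact (sum_laguerreWeight_pow hn).symm

/-- A function approximated in the sense of integrable majorants by functions for which the
Gauss–Laguerre rules converge has the same property. -/
lemma LaguerreConv.of_approx {f : ℝ → ℝ} (hf : Measurable f)
    (H : ∀ ε > 0, ∃ g h, LaguerreConv g ∧ LaguerreConv h ∧ (∀ x, 0 < x → |f x - g x| ≤ h x) ∧
      ∫ x in Set.Ioi 0, h x * Real.exp (-x) ≤ ε) : LaguerreConv f := by
  have hsub : ∀ {g h : ℝ → ℝ}, LaguerreConv g → LaguerreConv h →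
      (∀ x, 0 < x → |f x - g x| ≤ h x) →
      IntegrableOn (fun x => f x * Real.exp (-x) - g x * Real.exp (-x)) (Set.Ioi 0) := by
    intro g h hg hh hfg
    refine Integrable.mono' hh.1 ?_ ?_
    · exact ((hf.mul (by fun_prop)).aestronglyMeasurable).sub hg.1.aestronglyMeasurable
    · refine (ae_restrict_iff' measurableSet_Ioi).2 (ae_of_all _ fun x hx => ?_)
      rw [← sub_mul, norm_mul, Real.norm_eq_abs, Real.norm_eq_abs, Real.abs_exp]
      exact mul_le_mul_of_nonneg_right (hfg x hx) (Real.exp_pos _).le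
  have hint : IntegrableOn (fun x => f x * Real.exp (-x)) (Set.Ioi 0) := by
    obtain ⟨g, h, hg, hh, hfg, -⟩ := H 1 one_pos
    have := (hsub hg hh hfg).add hg.1
    refine this.congr (ae_of_all _ fun x => ?_)
    simp
  refine ⟨hint, Metric.tendsto_atTop'.2 fun ε hε => ?_⟩
  -- Error budget: the rule at `h` is below `∫ h + ε/4 ≤ ε/2`, the rule at `g` costs `ε/4`, and
  -- passing from `∫ g` to `∫ f` costs `ε/4`.
  obtain ⟨g, h, hg, hh, hfg, hle⟩ := H (ε / 4) (by linarith)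
  have h1 := (Metric.tendsto_atTop'.1 hg.2 (ε / 4) (by linarith))
  have h2 := (Metric.tendsto_atTop'.1 hh.2 (ε / 4) (by linarith))
  obtain ⟨N1, h1⟩ := h1
  obtain ⟨N2, h2⟩ := h2
  refine ⟨max N1 N2, fun n hn => ?_⟩
  have h1 := h1 n (lt_of_le_of_lt (le_max_left _ _) hn)
  have h2 := h2 n (lt_of_le_of_lt (le_max_right _ _) hn)
  have h3 := abs_gaussLaguerre_sub_le n hfg
  have h4 : |∫ x in Set.Ioi 0, f x * Real.exp (-x) - g x * Real.exp (-x)| ≤ ε / 4 := by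
    refine le_trans ?_ hle
    refine (abs_integral_le_integral_abs).trans (integral_mono_ae (hsub hg hh hfg).abs hh.1 ?_)
    refine (ae_restrict_iff' measurableSet_Ioi).2 (ae_of_all _ fun x hx => ?_)
    simp only
    rw [← sub_mul, abs_mul, Real.abs_exp]
    exact mul_le_mul_of_nonneg_right (hfg x hx) (Real.exp_pos _).le
  rw [integral_sub hint hg.1] at h4
  rw [Real.dist_eq] at h1 h2 ⊢
  rw [abs_lt] at h1 h2 ⊢
  rw [abs_le] at h3 h4
  constructor <;> linarith [h1.1, h1.2, h2.1, h2.2, h3.1, h3.2, h4.1, h4.2]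

/-- The alternating Taylor bound for `e^{-y}`. -/
lemma exp_neg_sub_taylor (N : ℕ) : ∀ y : ℝ, 0 ≤ y →
    |Real.exp (-y) - ∑ j ∈ Finset.range N, (-y) ^ j / j.factorial| ≤ y ^ N / N.factorial := by
  induction N with
  | zero =>
    intro y hy
    simpa [abs_of_pos (Real.exp_pos _)] using hy
  | succ N ih =>
    intro y hy
    -- The derivative of each Taylor remainder is minus the preceding one, so the bound of order `N`
    -- integrates to the bound of order `N + 1`.
    have hR : ∀ (n : ℕ) (z : ℝ), HasDerivAt (fun z : ℝ => Real.exp (-z) -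
        ∑ j ∈ Finset.range (n + 1), (-z) ^ j / j.factorial)
        (-(Real.exp (-z) - ∑ j ∈ Finset.range n, (-z) ^ j / j.factorial)) z := by
      intro n z
      have h1 : HasDerivAt (fun z : ℝ => Real.exp (-z)) (-Real.exp (-z)) z := by
        simpa using (hasDerivAt_neg z).exp
      have h2 : HasDerivAt (fun z : ℝ => ∑ j ∈ Finset.range (n + 1), (-z) ^ j / (j.factorial : ℝ))
          (∑ j ∈ Finset.range (n + 1), ((j : ℝ) * (-z) ^ (j - 1) * (-1)) / j.factorial) z :=
        HasDerivAt.fun_sum fun j _ => ((hasDerivAt_neg z).pow j).div_const _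
      refine (h1.sub h2).congr_deriv ?_
      rw [Finset.sum_range_succ']
      simp only [Nat.cast_add, Nat.cast_one, add_tsub_cancel_right, Nat.factorial_succ,
        Nat.cast_mul, CharP.cast_eq_zero, zero_mul, zero_div, add_zero]
      rw [neg_sub, sub_eq_add_neg, sub_eq_add_neg, add_comm, ← Finset.sum_neg_distrib]
      congr 1
      refine Finset.sum_congr rfl fun j _ => ?_
      have : (j : ℝ) + 1 ≠ 0 := by positivity
      have : (j.factorial : ℝ) ≠ 0 := by positivity
      field_simp
    have hB : ∀ z : ℝ, HasDerivAt (fun z : ℝ => z ^ (N + 1) / ((N + 1).factorial : ℝ))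
        (z ^ N / N.factorial) z := by
      intro z
      refine ((hasDerivAt_pow (N + 1) z).div_const ((N + 1).factorial : ℝ)).congr_deriv ?_
      have : (N : ℝ) + 1 ≠ 0 := by positivity
      have : (N.factorial : ℝ) ≠ 0 := by positivity
      rw [Nat.factorial_succ]
      push_cast
      field_simp
    have := image_norm_le_of_norm_deriv_right_le_deriv_boundary
      (a := 0) (b := y) (f := fun z : ℝ => Real.exp (-z) -
        ∑ j ∈ Finset.range (N + 1), (-z) ^ j / j.factorial)
      (B := fun z => z ^ (N + 1) / ((N + 1).factorial : ℝ))
      (fun z _ => (hR N z).continuousAt.continuousWithinAt)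
      (fun z _ => (hR N z).hasDerivWithinAt) (by simp [Finset.sum_range_succ'])
      (fun z => hB z) (fun z hz => by
        rw [norm_neg]; exact ih z hz.1) (Set.right_mem_Icc.2 hy)
    exact this

/-- One factor `e^{-x/2}` is peeled off per induction step and replaced by its Taylor polynomial.
The remainder integrates to `(N+k)! / (N! 2^N)`, which tends to 0; with `e^{-x}` in place of
`e^{-x/2}` the factor `2^{-N}` would be missing. -/
lemma laguerreConv_exp_mul_pow (m : ℕ) : ∀ k : ℕ,
    LaguerreConv fun x => Real.exp (-((m : ℝ) * (x / 2))) * x ^ k := by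
  induction m with
  | zero =>
    intro k
    simpa using laguerreConv_pow k
  | succ m ih =>
    intro k
    refine LaguerreConv.of_approx (by fun_prop) fun ε hε => ?_
    have hlim : Tendsto (fun N : ℕ => (k.factorial : ℝ) *
        (((N + k).choose k : ℝ) * (1 / 2 : ℝ) ^ N)) atTop (𝓝 ((k.factorial : ℝ) * 0)) :=
      (summable_choose_mul_geometric_of_norm_lt_one k (r := (1 / 2 : ℝ))
        (by norm_num)).tendsto_atTop_zero.const_mul _
    rw [mul_zero] at hlim
    obtain ⟨N, hN⟩ := (hlim.eventually (ge_mem_nhds hε)).exists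
    refine ⟨fun x => ∑ j ∈ Finset.range N, ((-1 / 2 : ℝ) ^ j / j.factorial) *
        (Real.exp (-((m : ℝ) * (x / 2))) * x ^ (k + j)),
      fun x => ((1 / 2 : ℝ) ^ N / N.factorial) * x ^ (k + N),
      LaguerreConv.sum _ fun j _ => (ih (k + j)).const_mul _,
      (laguerreConv_pow _).const_mul _, fun x hx => ?_, ?_⟩
    · have h1 := exp_neg_sub_taylor N (x / 2) (by positivity)
      have h2 : Real.exp (-(((m + 1 : ℕ) : ℝ) * (x / 2))) * x ^ k - ∑ j ∈ Finset.range N,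
          ((-1 / 2 : ℝ) ^ j / j.factorial) * (Real.exp (-((m : ℝ) * (x / 2))) * x ^ (k + j))
          = Real.exp (-((m : ℝ) * (x / 2))) * x ^ k * (Real.exp (-(x / 2)) -
            ∑ j ∈ Finset.range N, (-(x / 2)) ^ j / j.factorial) := by
        rw [mul_sub, Finset.mul_sum]
        congr 1
        · rw [mul_right_comm, ← Real.exp_add]
          congr 2
          push_cast
          ring
        · refine Finset.sum_congr rfl fun j _ => ?_
          rw [show -(x / 2) = (-1 / 2) * x by ring, mul_pow, pow_add]
          ring
      rw [h2, abs_mul, abs_of_nonneg (by positivity)]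
      have h3 : Real.exp (-((m : ℝ) * (x / 2))) ≤ 1 := by
        rw [Real.exp_le_one_iff]
        have : 0 ≤ (m : ℝ) * (x / 2) := by positivity
        linarith
      calc _ ≤ 1 * x ^ k * ((x / 2) ^ N / N.factorial) := by gcongr
        _ = (1 / 2 : ℝ) ^ N / N.factorial * x ^ (k + N) := by
          rw [div_pow, pow_add, div_pow, one_pow]; field_simp
    · have e : ∀ x : ℝ, ((1 / 2 : ℝ) ^ N / N.factorial) * x ^ (k + N) * Real.exp (-x)
          = ((1 / 2 : ℝ) ^ N / N.factorial) * (x ^ (k + N) * Real.exp (-x)) := fun x => by ring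
      simp_rw [e]
      rw [integral_const_mul, integral_pow_mul_exp_neg]
      refine le_trans (le_of_eq ?_) hN
      have := Nat.add_choose_mul_factorial_mul_factorial N k
      have h' : (((N + k).choose k * N.factorial * k.factorial : ℕ) : ℝ) = ((N + k).factorial : ℕ) := by
        rw [← this]
      push_cast at h'
      rw [add_comm k N, ← h']
      have : (N.factorial : ℝ) ≠ 0 := by positivity
      field_simp

/-- Gauss–Laguerre rules converge at continuous functions with a limit at infinity. -/
lemma laguerreConv_of_tendsto {f : ℝ → ℝ} (hm : Measurable f) (hf : ContinuousOn f (Set.Ici 0))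
    {L : ℝ} (hL : Tendsto f atTop (𝓝 L)) : LaguerreConv f := by
  -- Under `y = e^{-x/2}` the half-line becomes `(0, 1]` and the limit `L` fills in `y = 0`. A
  -- Weierstrass polynomial in `y` is then a combination of the exponentials `e^{-jx/2}`.
  let g : ℝ → ℝ := fun y => if y = 0 then L else f (-2 * Real.log y)
  have hg : ContinuousOn g (Set.Icc 0 1) := by
    intro y hy
    rcases hy.1.eq_or_lt with h0 | h0
    · subst h0
      rw [← continuousWithinAt_sdiff_self, ContinuousWithinAt]
      have hg0 : g 0 = L := by simp [g]
      rw [hg0]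
      have h1 : Tendsto (fun y => f (-2 * Real.log y)) (𝓝[Set.Icc 0 1 \ {0}] 0) (𝓝 L) := by
        refine hL.comp ?_
        have : Tendsto Real.log (𝓝[Set.Icc 0 1 \ {0}] 0) atBot :=
          Real.tendsto_log_nhdsNE_zero.mono_left (nhdsWithin_mono _ fun y hy => hy.2)
        exact this.const_mul_atBot_of_neg (by norm_num)
      refine h1.congr' ?_
      filter_upwards [self_mem_nhdsWithin] with y hy
      simp only [g]
      rw [if_neg (show y ≠ 0 from hy.2)]
    · have h1 : ContinuousWithinAt (fun y => f (-2 * Real.log y)) (Set.Icc 0 1) y := by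
        have h2 : ContinuousWithinAt (fun y => -2 * Real.log y) (Set.Icc 0 1) y :=
          ((Real.continuousAt_log h0.ne').const_mul _).continuousWithinAt
        refine ContinuousWithinAt.comp (t := Set.Ici 0) (hf (-2 * Real.log y) ?_) h2 ?_
        · have := Real.log_nonpos h0.le hy.2
          simp only [Set.mem_Ici]; linarith
        · intro z hz
          have := Real.log_nonpos hz.1 hz.2
          simp only [Set.mem_Ici]; linarith
      refine h1.congr_of_eventuallyEq ?_ ?_
      · filter_upwards [mem_nhdsWithin_of_mem_nhds (isOpen_ne.mem_nhds h0.ne')] with z hz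
        simp only [g]
        rw [if_neg hz]
      · simp only [g]
        rw [if_neg h0.ne']
  refine LaguerreConv.of_approx hm fun ε hε => ?_
  obtain ⟨p, hp⟩ := exists_polynomial_near_of_continuousOn 0 1 g hg ε hε
  refine ⟨fun x => ∑ j ∈ Finset.range (p.natDegree + 1), p.coeff j *
    (Real.exp (-((j : ℝ) * (x / 2))) * x ^ 0), fun x => ε * x ^ 0,
    LaguerreConv.sum _ fun j _ => (laguerreConv_exp_mul_pow j 0).const_mul _,
    (laguerreConv_pow 0).const_mul _, fun x hx => ?_, ?_⟩
  · have h1 := hp (Real.exp (-(x / 2))) ⟨(Real.exp_pos _).le, by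
      rw [Real.exp_le_one_iff]; linarith⟩
    have h2 : g (Real.exp (-(x / 2))) = f x := by
      simp only [g]
      rw [if_neg (Real.exp_pos _).ne', Real.log_exp]
      congr 1; ring
    rw [h2, Polynomial.eval_eq_sum_range, abs_sub_comm] at h1
    simp only [pow_zero, mul_one]
    refine le_of_eq_of_le ?_ h1.le
    congr 2
    refine Finset.sum_congr rfl fun j _ => ?_
    rw [← Real.exp_nat_mul]
    congr 2
    ring
  · simp_rw [mul_assoc]
    rw [integral_const_mul, integral_pow_mul_exp_neg]
    simp

/-- Joint convergence of Gauss–Laguerre rules applied to a locally uniformly convergent sequence of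
functions of polynomial growth. -/
lemma tendsto_gaussLaguerre_joint {f : ℝ → ℝ} {F : ℕ → ℝ → ℝ} (hm : Measurable f)
    (hf : ContinuousOn f (Set.Ici 0)) {L : ℝ} (hL : Tendsto f atTop (𝓝 L))
    (hF : TendstoLocallyUniformlyOn F f atTop (Set.Ici 0)) {C : ℝ} {M : ℕ}
    (hFb : ∀ᶠ n in atTop, ∀ x, 0 ≤ x → |F n x| ≤ C * (1 + x) ^ M) :
    Tendsto (fun N : ℕ × ℕ => gaussLaguerre N.1 (F N.2)) atTop
      (𝓝 (∫ x in Set.Ioi 0, f x * Real.exp (-x))) := by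
  have hfb : ∀ x, 0 ≤ x → |f x| ≤ C * (1 + x) ^ M := by
    intro x hx
    have h1 : Tendsto (fun n => F n x) atTop (𝓝 (f x)) := hF.tendsto_at hx
    refine le_of_tendsto h1.abs ?_
    filter_upwards [hFb] with n hn using hn x hx
  have hpoly : ∀ d : ℕ, LaguerreConv fun x => (1 + x) ^ d := by
    intro d
    simp_rw [add_comm (1 : ℝ), add_pow, one_pow, mul_one]
    refine LaguerreConv.sum _ fun j _ => ?_
    simp_rw [mul_comm _ (((d.choose j : ℕ)) : ℝ)]
    exact (laguerreConv_pow j).const_mul _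
  set J := ∫ x in Set.Ioi 0, (1 + x) ^ (M + 1) * Real.exp (-x) with hJ
  have hJ0 : 0 ≤ J := setIntegral_nonneg measurableSet_Ioi fun x hx => by
    have : (0 : ℝ) < x := hx
    positivity
  have hC0 : 0 ≤ C := by
    have := hfb 0 le_rfl
    simp at this
    exact (abs_nonneg _).trans this
  have hmain := laguerreConv_of_tendsto hm hf hL
  rw [Metric.tendsto_atTop]
  intro ε hε
  obtain ⟨R, hR0, hR⟩ : ∃ R : ℝ, 0 < R ∧ 2 * C / R * J < ε / 8 := by
    refine ⟨16 * (C * J + 1) / ε, by positivity, ?_⟩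
    rw [div_div_eq_mul_div, div_mul_eq_mul_div, div_lt_div_iff₀ (by positivity) (by norm_num)]
    have : 0 ≤ C * J := by positivity
    nlinarith
  have hunif : TendstoUniformlyOn F f atTop (Set.Icc 0 R) :=
    (tendstoLocallyUniformlyOn_iff_tendstoUniformlyOn_of_compact isCompact_Icc).1
      (hF.mono Set.Icc_subset_Ici_self)
  -- The first term covers uniform convergence on `[0, R]`. Beyond `R` the growth bound `2C(1+x)^M`
  -- is multiplied by `(1+x)/R ≥ 1`, which leaves a small coefficient.
  let h : ℝ → ℝ := fun x => ε / 8 * x ^ 0 + 2 * C / R * (1 + x) ^ (M + 1)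
  have hh : LaguerreConv h := ((laguerreConv_pow 0).const_mul _).add ((hpoly _).const_mul _)
  have hhI : ∫ x in Set.Ioi 0, h x * Real.exp (-x) < ε / 4 := by
    have e : ∀ x, h x * Real.exp (-x) = ε / 8 * (x ^ 0 * Real.exp (-x))
        + 2 * C / R * ((1 + x) ^ (M + 1) * Real.exp (-x)) := fun x => by simp only [h]; ring
    simp_rw [e]
    rw [integral_add ((laguerreConv_pow 0).1.const_mul _) ((hpoly _).1.const_mul _),
      integral_const_mul, integral_const_mul, integral_pow_mul_exp_neg, ← hJ]
    simp only [Nat.factorial_zero, Nat.cast_one]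
    linarith
  have h1 := (hh.2.eventually (gt_mem_nhds hhI))
  have h2 := Metric.tendsto_atTop.1 hmain.2 (ε / 2) (by linarith)
  have h3 := (Metric.tendstoUniformlyOn_iff.1 hunif (ε / 8) (by linarith)).and hFb
  obtain ⟨N1, h1⟩ := eventually_atTop.1 h1
  obtain ⟨N2, h2⟩ := h2
  obtain ⟨N3, h3⟩ := eventually_atTop.1 h3
  refine ⟨(max N1 N2, N3), fun N hN => ?_⟩
  have hN1 := (max_le_iff.1 hN.1).1
  have hN2 := (max_le_iff.1 hN.1).2
  have hclose : ∀ x, 0 < x → |F N.2 x - f x| ≤ h x := by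
    intro x hx
    obtain ⟨ha, hb⟩ := h3 N.2 hN.2
    rcases le_or_gt x R with hxR | hxR
    · have := ha x ⟨hx.le, hxR⟩
      rw [dist_comm, Real.dist_eq] at this
      have h5 : 0 ≤ 2 * C / R * (1 + x) ^ (M + 1) := by positivity
      simp only [h, pow_zero, mul_one]
      linarith
    · have h5 := (abs_sub (F N.2 x) (f x)).trans (add_le_add (hb x hx.le) (hfb x hx.le))
      have h6 : C * (1 + x) ^ M + C * (1 + x) ^ M ≤ 2 * C / R * (1 + x) ^ (M + 1) := by
        rw [pow_succ, div_mul_eq_mul_div, le_div_iff₀ hR0]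
        have : 0 ≤ C * (1 + x) ^ M := by positivity
        nlinarith
      simp only [h, pow_zero, mul_one]
      linarith
  have h4 := abs_gaussLaguerre_sub_le N.1 hclose
  have h5 := h1 N.1 hN1
  have h6 := h2 N.1 hN2
  rw [Real.dist_eq] at h6 ⊢
  rw [abs_lt] at h6 ⊢
  rw [abs_le] at h4
  constructor <;> linarith [h4.1, h4.2, h6.1, h6.2]

/-! ### The midpoint rule for functions with an integrable endpoint singularity -/

/-- The midpoint of the cell of the partition of `(0, π]` into `U` equal cells that contains `t`. -/
noncomputable def cellMidpoint (U : ℕ) (t : ℝ) : ℝ :=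
  ((⌈t * U / Real.pi⌉ : ℝ) - 1 / 2) * Real.pi / U

lemma abs_cellMidpoint_sub_le {U : ℕ} (hU : 0 < U) (t : ℝ) :
    |cellMidpoint U t - t| ≤ Real.pi / (2 * U) := by
  have hU' : (0 : ℝ) < U := by exact_mod_cast hU
  have hpi := Real.pi_pos
  set y := t * U / Real.pi with hy
  have ht : t = y * Real.pi / U := by rw [hy]; field_simp
  have h1 := Int.le_ceil y
  have h2 := Int.ceil_lt_add_one y
  have e : cellMidpoint U t - t = ((⌈y⌉ : ℝ) - 1 / 2 - y) * (Real.pi / U) := by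
    calc cellMidpoint U t - t = ((⌈y⌉ : ℝ) - 1 / 2) * Real.pi / U - y * Real.pi / U := by
          rw [← ht, cellMidpoint]
      _ = _ := by ring
  rw [e, abs_mul, abs_of_pos (by positivity : 0 < Real.pi / U)]
  have : |(⌈y⌉ : ℝ) - 1 / 2 - y| ≤ 1 / 2 := by rw [abs_le]; constructor <;> linarith
  calc _ ≤ 1 / 2 * (Real.pi / U) := by gcongr
    _ = _ := by field_simp

lemma cellMidpoint_mem {U : ℕ} (hU : 0 < U) {t : ℝ} (ht : t ∈ Set.Ioc 0 Real.pi) :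
    Real.pi / (2 * U) ≤ cellMidpoint U t ∧ cellMidpoint U t ≤ Real.pi - Real.pi / (2 * U) := by
  have hU' : (0 : ℝ) < U := by exact_mod_cast hU
  have hpi := Real.pi_pos
  have h1 : (1 : ℤ) ≤ ⌈t * U / Real.pi⌉ := by
    have : 0 < ⌈t * U / Real.pi⌉ := Int.ceil_pos.2 (div_pos (mul_pos ht.1 hU') hpi)
    omega
  have h2 : ⌈t * U / Real.pi⌉ ≤ (U : ℤ) := by
    rw [Int.ceil_le, div_le_iff₀ hpi]
    push_cast
    nlinarith [ht.2]
  have h1' : (1 : ℝ) ≤ (⌈t * U / Real.pi⌉ : ℝ) := by exact_mod_cast h1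
  have h2' : (⌈t * U / Real.pi⌉ : ℝ) ≤ U := by exact_mod_cast h2
  constructor
  · rw [cellMidpoint, div_le_div_iff₀ (by positivity) hU']
    nlinarith [mul_pos hpi hU', mul_nonneg (mul_pos hpi hU').le (sub_nonneg.2 h1')]
  · have e : Real.pi - Real.pi / (2 * U) = ((U : ℝ) - 1 / 2) * Real.pi / U := by field_simp
    rw [e, cellMidpoint]
    gcongr

lemma cellMidpoint_mem_Ioo {U : ℕ} (hU : 0 < U) {t : ℝ} (ht : t ∈ Set.Ioc 0 Real.pi) :
    cellMidpoint U t ∈ Set.Ioo 0 Real.pi := by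
  have hU' : (0 : ℝ) < U := by exact_mod_cast hU
  have h := cellMidpoint_mem hU ht
  have : 0 < Real.pi / (2 * U) := by have := Real.pi_pos; positivity
  exact ⟨by linarith [h.1], by linarith [h.2]⟩

/-- The midpoint factors through an integer-valued ceiling, and every function on `ℤ` is measurable.
-/
lemma measurable_cellMidpoint_comp (U : ℕ) (g : ℝ → ℝ) :
    Measurable fun t => g (cellMidpoint U t) := by
  have h1 : Measurable fun n : ℤ => g (((n : ℝ) - 1 / 2) * Real.pi / U) := measurable_from_top
  have h2 : Measurable fun t : ℝ => ⌈t * U / Real.pi⌉ := Int.measurable_ceil.comp (by fun_prop)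
  exact h1.comp h2

/-- The integrand is constant on each cell. In this form the rule is an integral over a fixed
interval, open to dominated convergence. -/
lemma midpoint_sum_eq_integral {U : ℕ} (hU : 0 < U) (g : ℝ → ℝ) :
    ∑ u ∈ Finset.Icc 1 U, Real.pi / U * g ((2 * (u : ℝ) - 1) / (2 * (U : ℝ)) * Real.pi)
      = ∫ t in (0 : ℝ)..Real.pi, g (cellMidpoint U t) := by
  have hU' : (0 : ℝ) < U := by exact_mod_cast hU
  have hpi := Real.pi_pos
  let a : ℕ → ℝ := fun k => k * Real.pi / U
  have hcell : ∀ k : ℕ, ∀ t ∈ Set.uIoc (a k) (a (k + 1)),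
      g (cellMidpoint U t) = g ((2 * ((k + 1 : ℕ) : ℝ) - 1) / (2 * (U : ℝ)) * Real.pi) := by
    intro k t ht
    have hle : a k ≤ a (k + 1) := by
      simp only [a]; push_cast; gcongr; linarith
    rw [Set.uIoc_of_le hle] at ht
    have hc : ⌈t * U / Real.pi⌉ = (k : ℤ) + 1 := by
      rw [Int.ceil_eq_iff]
      simp only [a, Set.mem_Ioc] at ht
      obtain ⟨h1, h2⟩ := ht
      rw [div_lt_iff₀ hU'] at h1
      rw [le_div_iff₀ hU'] at h2
      push_cast at h2 ⊢
      constructor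
      · rw [lt_div_iff₀ hpi]; linarith
      · rw [div_le_iff₀ hpi]; linarith
    congr 1
    rw [cellMidpoint, hc]
    push_cast
    field_simp
  have h1 := intervalIntegral.sum_integral_adjacent_intervals (μ := volume) (n := U) (a := a)
    (f := fun t => g (cellMidpoint U t)) fun k _ => by
      have h : IntervalIntegrable (fun _ : ℝ =>
        g ((2 * ((k + 1 : ℕ) : ℝ) - 1) / (2 * (U : ℝ)) * Real.pi)) volume (a k) (a (k + 1)) :=
        intervalIntegrable_const
      exact h.congr fun t ht => (hcell k t ht).symm
  have ha0 : a 0 = 0 := by simp [a]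
  have haU : a U = Real.pi := by simp only [a]; field_simp
  rw [ha0, haU] at h1
  rw [← h1, Finset.sum_bij' (s := Finset.Icc 1 U) (t := Finset.range U)
    (fun u _ => u - 1) (fun k _ => k + 1) (fun u hu => by simp at hu ⊢; omega)
    (fun k hk => by simp at hk ⊢; omega) (fun u hu => by simp at hu ⊢; omega)
    (fun k hk => by simp) fun u hu => ?_]
  have hu' : u - 1 + 1 = u := Nat.sub_add_cancel (Finset.mem_Icc.1 hu).1
  rw [intervalIntegral.integral_congr_ae (ae_of_all _ (hcell (u - 1))), intervalIntegral.integral_const, hu']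
  have : ((u - 1 : ℕ) : ℝ) = u - 1 := by
    rw [Nat.cast_sub (Finset.mem_Icc.1 hu).1]; simp
  simp only [a, this, smul_eq_mul]
  ring

/-- Convergence of the midpoint rule, locally uniformly in a parameter, for a function with an
integrable algebraic singularity at `π`. -/
lemma tendsto_midpoint_sum {X : Type*} [TopologicalSpace X] [FirstCountableTopology X] {s : Set X}
    {g : X → ℝ → ℝ} (hg : ContinuousOn (Function.uncurry g) (s ×ˢ Set.Ioo 0 Real.pi))
    {x₀ : X} (hx₀ : x₀ ∈ s) {C e : ℝ} (hC : 0 ≤ C) (he : -1 < e)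
    (hb : ∀ᶠ x in 𝓝[s] x₀, ∀ t ∈ Set.Ioo 0 Real.pi, |g x t| ≤ C * (1 + (Real.pi - t) ^ e)) :
    Tendsto (fun p : ℕ × X => ∑ u ∈ Finset.Icc 1 p.1, Real.pi / p.1 *
        g p.2 ((2 * (u : ℝ) - 1) / (2 * (p.1 : ℝ)) * Real.pi)) (atTop ×ˢ 𝓝[s] x₀)
      (𝓝 (∫ t in (0 : ℝ)..Real.pi, g x₀ t)) ∧
    Tendsto (fun x => ∫ t in (0 : ℝ)..Real.pi, g x t) (𝓝[s] x₀)
      (𝓝 (∫ t in (0 : ℝ)..Real.pi, g x₀ t)) := by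
  have hpi := Real.pi_pos
  have hpe : 0 < Real.pi ^ e := Real.rpow_pos_of_pos hpi e
  have hI : IntervalIntegrable (fun t => (Real.pi - t) ^ e) volume 0 Real.pi := by
    have := (intervalIntegral.intervalIntegrable_rpow' (a := 0) (b := Real.pi) he).comp_sub_left
      Real.pi
    simpa using this.symm
  have hne : ∀ᵐ t : ℝ ∂volume, t ≠ Real.pi := by
    simp [ae_iff, measure_singleton]
  constructor
  · have hev : ∀ᶠ p : ℕ × X in atTop ×ˢ 𝓝[s] x₀, 0 < p.1 ∧ p.2 ∈ s ∧
        ∀ t ∈ Set.Ioo 0 Real.pi, |g p.2 t| ≤ C * (1 + (Real.pi - t) ^ e) :=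
      ((eventually_gt_atTop 0).prod_inl _).and
        (((eventually_mem_nhdsWithin).prod_inr _).and (hb.prod_inr _))
    have key : Tendsto (fun p : ℕ × X => ∫ t in (0 : ℝ)..Real.pi, g p.2 (cellMidpoint p.1 t))
        (atTop ×ˢ 𝓝[s] x₀) (𝓝 (∫ t in (0 : ℝ)..Real.pi, g x₀ t)) := by
      refine intervalIntegral.tendsto_integral_filter_of_dominated_convergence
        (fun t => C * (1 + Real.pi ^ e + 2 ^ (-e) * (Real.pi - t) ^ e)) ?_ ?_ ?_ ?_
      · exact Eventually.of_forall fun p =>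
          (measurable_cellMidpoint_comp p.1 (g p.2)).aestronglyMeasurable
      · filter_upwards [hev] with p hp
        filter_upwards [hne] with t htne ht
        rw [Set.uIoc_of_le hpi.le] at ht
        refine (hp.2.2 _ (cellMidpoint_mem_Ioo hp.1 ht)).trans ?_
        have h1 := cellMidpoint_mem hp.1 ht
        have h2 := abs_le.1 (abs_cellMidpoint_sub_le hp.1 t)
        have h3 := cellMidpoint_mem_Ioo hp.1 ht
        set m := cellMidpoint p.1 t
        have htp : 0 < Real.pi - t := sub_pos.2 (lt_of_le_of_ne ht.2 htne)
        -- A midpoint is at least half a cell from `π` and at most half a cell from `t`, so `π - m ≥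
        -- (π - t) / 2`. This handles `e < 0`; otherwise the power is bounded by `π ^ e`.
        have h4 : (Real.pi - m) ^ e ≤ Real.pi ^ e + 2 ^ (-e) * (Real.pi - t) ^ e := by
          rcases le_or_gt 0 e with h0 | h0
          · have : (Real.pi - m) ^ e ≤ Real.pi ^ e :=
              Real.rpow_le_rpow (by linarith [h3.2]) (by linarith [h3.1]) h0
            have : 0 ≤ (2 : ℝ) ^ (-e) * (Real.pi - t) ^ e := by positivity
            linarith
          · have h5 : (Real.pi - m) ^ e ≤ ((Real.pi - t) / 2) ^ e :=
              Real.rpow_le_rpow_of_nonpos (by positivity) (by linarith) h0.le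
            rw [Real.div_rpow htp.le (by norm_num), div_eq_inv_mul,
              ← Real.rpow_neg (by norm_num)] at h5
            linarith
        refine mul_le_mul_of_nonneg_left ?_ hC
        linarith
      · exact (((intervalIntegrable_const).add (hI.const_mul _))).const_mul _
      · filter_upwards [hne] with t htne ht
        rw [Set.uIoc_of_le hpi.le] at ht
        have ht' : t ∈ Set.Ioo 0 Real.pi := ⟨ht.1, lt_of_le_of_ne ht.2 htne⟩
        have hc := hg (x₀, t) ⟨hx₀, ht'⟩
        refine hc.tendsto.comp (f := fun p : ℕ × X => (p.2, cellMidpoint p.1 t))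
          (tendsto_nhdsWithin_iff.2 ⟨?_, ?_⟩)
        · refine Tendsto.prodMk_nhds ?_ ?_
          · exact tendsto_snd.mono_right nhdsWithin_le_nhds
          · have h1 : Tendsto (fun U : ℕ => cellMidpoint U t) atTop (𝓝 t) := by
              rw [tendsto_iff_norm_sub_tendsto_zero]
              have h2 : Tendsto (fun U : ℕ => Real.pi / 2 / (U : ℝ)) atTop (𝓝 0) :=
                tendsto_const_div_atTop_nhds_zero_nat _
              refine squeeze_zero' (Eventually.of_forall fun _ => norm_nonneg _) ?_ h2
              filter_upwards [eventually_gt_atTop 0] with U hU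
              rw [Real.norm_eq_abs, div_div]
              exact abs_cellMidpoint_sub_le hU t
            exact h1.comp tendsto_fst
        · filter_upwards [hev] with p hp using ⟨hp.2.1, cellMidpoint_mem_Ioo hp.1 ht⟩
    refine key.congr' ?_
    filter_upwards [hev] with p hp
    exact (midpoint_sum_eq_integral hp.1 (g p.2)).symm
  · refine intervalIntegral.tendsto_integral_filter_of_dominated_convergence
      (fun t => C * (1 + (Real.pi - t) ^ e)) ?_ ?_ ?_ ?_
    · filter_upwards [self_mem_nhdsWithin] with x hx
      rw [Set.uIoc_of_le hpi.le, ← restrict_Ioo_eq_restrict_Ioc]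
      have : ContinuousOn (g x) (Set.Ioo 0 Real.pi) :=
        hg.comp (f := fun t => (x, t)) (by fun_prop) fun t ht => ⟨hx, ht⟩
      exact this.aestronglyMeasurable measurableSet_Ioo
    · filter_upwards [hb] with x hx
      filter_upwards [hne] with t htne ht
      rw [Set.uIoc_of_le hpi.le] at ht
      exact hx t ⟨ht.1, lt_of_le_of_ne ht.2 htne⟩
    · exact ((intervalIntegrable_const).add hI).const_mul _
    · filter_upwards [hne] with t htne ht
      rw [Set.uIoc_of_le hpi.le] at ht
      have ht' : t ∈ Set.Ioo 0 Real.pi := ⟨ht.1, lt_of_le_of_ne ht.2 htne⟩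
      refine (hg (x₀, t) ⟨hx₀, ht'⟩).tendsto.comp (f := fun x : X => (x, t))
        (tendsto_nhdsWithin_iff.2 ⟨?_, ?_⟩)
      · exact (Continuous.tendsto (by fun_prop) x₀).mono_left nhdsWithin_le_nhds
      · filter_upwards [self_mem_nhdsWithin] with x hx using ⟨hx, ht'⟩

/-- Local uniform convergence of midpoint sums, and continuity of the limit. -/
lemma tendstoLocallyUniformlyOn_midpoint_sum {X : Type*} [TopologicalSpace X]
    [FirstCountableTopology X] {s : Set X} {g : X → ℝ → ℝ}
    (hg : ContinuousOn (Function.uncurry g) (s ×ˢ Set.Ioo 0 Real.pi)) {e : ℝ} (he : -1 < e)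
    (hb : ∀ x₀ ∈ s, ∃ C, 0 ≤ C ∧ ∀ᶠ x in 𝓝[s] x₀, ∀ t ∈ Set.Ioo 0 Real.pi,
      |g x t| ≤ C * (1 + (Real.pi - t) ^ e)) :
    TendstoLocallyUniformlyOn (fun (U : ℕ) x => ∑ u ∈ Finset.Icc 1 U, Real.pi / U *
        g x ((2 * (u : ℝ) - 1) / (2 * (U : ℝ)) * Real.pi))
      (fun x => ∫ t in (0 : ℝ)..Real.pi, g x t) atTop s ∧
    ContinuousOn (fun x => ∫ t in (0 : ℝ)..Real.pi, g x t) s := by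
  constructor
  · rw [tendstoLocallyUniformlyOn_iff_forall_tendsto]
    intro x hx
    obtain ⟨C, hC, hbx⟩ := hb x hx
    obtain ⟨h1, h2⟩ := tendsto_midpoint_sum hg hx hC he hbx
    rw [tendsto_uniformity_iff_dist_tendsto_zero]
    -- Along the product filter in `(U, x')`, the sums and the integrals at `x'` both tend to the
    -- integral at `x`, so their distance tends to 0.
    have h3 := (h2.comp tendsto_snd).dist h1
    rw [dist_self] at h3
    exact h3
  · intro x hx
    obtain ⟨C, hC, hbx⟩ := hb x hx
    exact (tendsto_midpoint_sum hg hx hC he hbx).2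

/-! ### The complex normal law and the Rice distribution -/

lemma complexNormal_eq_withDensity {v : ℝ} (hv : 0 < v) :
    complexNormal v = (volume : Measure ℂ).withDensity
      fun z => ENNReal.ofReal (1 / (Real.pi * v) * Real.exp (-(‖z‖ ^ 2 / v))) := by
  have hv' : (v / 2).toNNReal ≠ 0 := by
    rw [Ne, Real.toNNReal_eq_zero]; linarith
  have hvv : ((v / 2).toNNReal : ℝ) = v / 2 := Real.coe_toNNReal _ (by linarith)
  have hpi := Real.pi_pos
  have hfun : (fun p : ℝ × ℝ => (p.1 : ℂ) + (p.2 : ℂ) * Complex.I)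
      = Complex.measurableEquivRealProd.symm := by
    funext p
    apply Complex.ext <;> simp [Complex.measurableEquivRealProd]
  have hdens : ∀ p : ℝ × ℝ, gaussianPDF 0 (v / 2).toNNReal p.1 * gaussianPDF 0 (v / 2).toNNReal p.2
      = ENNReal.ofReal (1 / (Real.pi * v) *
        Real.exp (-(‖Complex.measurableEquivRealProd.symm p‖ ^ 2 / v))) := by
    intro p
    rw [gaussianPDF, gaussianPDF, ← ENNReal.ofReal_mul (gaussianPDFReal_nonneg _ _ _),
      gaussianPDFReal, gaussianPDFReal, hvv]
    congr 1
    have h2 : 2 * Real.pi * (v / 2) = Real.pi * v := by ring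
    have h3 : ‖Complex.measurableEquivRealProd.symm p‖ ^ 2 = p.1 ^ 2 + p.2 ^ 2 := by
      rw [← hfun, Complex.sq_norm, Complex.normSq_apply]
      simp; ring
    rw [h2, h3, mul_mul_mul_comm, ← mul_inv, Real.mul_self_sqrt (by positivity), ← Real.exp_add,
      one_div]
    congr 2
    field_simp
    ring
  have hvol : Measure.map Complex.measurableEquivRealProd.symm (volume : Measure (ℝ × ℝ))
      = (volume : Measure ℂ) := Complex.volume_preserving_equiv_real_prod.symm.map_eq
  rw [complexNormal, gaussianReal_of_var_ne_zero _ hv',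
    prod_withDensity (measurable_gaussianPDF _ _) (measurable_gaussianPDF _ _), hfun]
  ext s hs
  rw [Measure.map_apply (MeasurableEquiv.measurable _) hs, withDensity_apply _ hs,
    withDensity_apply _ ((MeasurableEquiv.measurable _) hs)]
  simp_rw [hdens]
  rw [← hvol, setLIntegral_map hs (by fun_prop) (MeasurableEquiv.measurable _)]
  rfl

instance isProbabilityMeasure_complexNormal (v : ℝ) : IsProbabilityMeasure (complexNormal v) := by
  unfold complexNormal
  exact Measure.isProbabilityMeasure_map (by fun_prop)

lemma complexNormal_absolutelyContinuous {v : ℝ} (hv : 0 < v) :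
    complexNormal v ≪ (volume : Measure ℂ) := by
  rw [complexNormal_eq_withDensity hv]
  exact withDensity_absolutelyContinuous _ _

lemma continuous_besselI (n : ℕ) : Continuous (besselI n) := by
  unfold besselI
  refine continuous_const.mul ?_
  exact intervalIntegral.continuous_parametric_intervalIntegral_of_continuous' (by fun_prop) _ _

lemma besselI_zero_nonneg (x : ℝ) : 0 ≤ besselI 0 x := by
  unfold besselI
  have : 0 ≤ ∫ t in (0 : ℝ)..Real.pi, Real.exp (x * Real.cos t) * Real.cos ((0 : ℕ) * t) := by
    refine intervalIntegral.integral_nonneg Real.pi_pos.le fun t _ => ?_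
    simp [(Real.exp_pos _).le]
  have := Real.pi_pos
  positivity

lemma lintegral_exp_mul_cos (x : ℝ) :
    ∫⁻ θ in Set.Ioo (-Real.pi) Real.pi, ENNReal.ofReal (Real.exp (x * Real.cos θ))
      = ENNReal.ofReal (2 * Real.pi * besselI 0 x) := by
  have hc : Continuous fun θ => Real.exp (x * Real.cos θ) := by fun_prop
  have hpi := Real.pi_pos
  rw [← ofReal_integral_eq_lintegral_ofReal]
  · congr 1
    rw [← integral_Ioc_eq_integral_Ioo, ← intervalIntegral.integral_of_le (by linarith),
      ← intervalIntegral.integral_add_adjacent_intervals (b := 0)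
        (hc.intervalIntegrable _ _) (hc.intervalIntegrable _ _)]
    have h1 : ∫ θ in (-Real.pi)..0, Real.exp (x * Real.cos θ)
        = ∫ θ in (0 : ℝ)..Real.pi, Real.exp (x * Real.cos θ) := by
      have := intervalIntegral.integral_comp_neg (a := 0) (b := Real.pi)
        (fun θ => Real.exp (x * Real.cos θ))
      simp only [Real.cos_neg, neg_zero] at this
      exact this.symm
    rw [h1, besselI]
    simp
    field_simp
    ring
  · exact (hc.integrableOn_Icc).mono_set Set.Ioo_subset_Icc_self
  · exact ae_of_all _ fun _ => (Real.exp_pos _).le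

/-- The density of `‖a + w‖` for `w` of law `CN(0, v)`. -/
noncomputable def riceDensity (v a r : ℝ) : ℝ :=
  2 * r / v * Real.exp (-((r ^ 2 + a ^ 2) / v)) * besselI 0 (2 * a * r / v)

lemma continuous_riceDensity (v a : ℝ) : Continuous (riceDensity v a) := by
  unfold riceDensity
  exact (by fun_prop : Continuous fun r : ℝ => 2 * r / v * Real.exp (-((r ^ 2 + a ^ 2) / v))).mul
    ((continuous_besselI 0).comp (by fun_prop))

lemma riceDensity_nonneg {v a r : ℝ} (hv : 0 < v) (hr : 0 ≤ r) : 0 ≤ riceDensity v a r := by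
  unfold riceDensity
  have := besselI_zero_nonneg (2 * a * r / v)
  positivity

/-- Translate the Gaussian to centre `a` and pass to polar coordinates; the angular integral is
Bessel's. With `g` arbitrary, the same computation yields the total mass, the distribution function
and the law of the squared modulus. -/
lemma lintegral_norm_add_complexNormal {v : ℝ} (hv : 0 < v) (a : ℝ) {g : ℝ → ℝ≥0∞}
    (hg : Measurable g) :
    ∫⁻ w, g ‖(a : ℂ) + w‖ ∂complexNormal v
      = ∫⁻ r in Set.Ioi 0, ENNReal.ofReal (riceDensity v a r) * g r := by
  have hpi := Real.pi_pos
  rw [complexNormal_eq_withDensity hv, lintegral_withDensity_eq_lintegral_mul _ (by fun_prop)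
    (by fun_prop)]
  have h1 : ∫⁻ w : ℂ, ((fun z : ℂ => ENNReal.ofReal (1 / (Real.pi * v) * Real.exp (-(‖z‖ ^ 2 / v))))
      * fun w => g ‖(a : ℂ) + w‖) w
      = ∫⁻ z : ℂ, ENNReal.ofReal (1 / (Real.pi * v) * Real.exp (-(‖z - a‖ ^ 2 / v))) * g ‖z‖ := by
    rw [← lintegral_add_left_eq_self (fun z : ℂ => ENNReal.ofReal (1 / (Real.pi * v) *
      Real.exp (-(‖z - a‖ ^ 2 / v))) * g ‖z‖) (a : ℂ)]
    simp
  rw [h1, ← Complex.lintegral_comp_polarCoord_symm, polarCoord_target,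
    Measure.volume_eq_prod, ← Measure.prod_restrict, lintegral_prod _ (by
      refine Measurable.aemeasurable ?_
      have : Measurable Complex.polarCoord.symm := by
        have : (Complex.polarCoord.symm : ℝ × ℝ → ℂ)
          = fun p => p.1 * (Real.cos p.2 + Real.sin p.2 * Complex.I) := by
          funext p; exact Complex.polarCoord_symm_apply p
        rw [this]; fun_prop
      simp only [smul_eq_mul]
      fun_prop)]
  refine setLIntegral_congr_fun measurableSet_Ioi fun r (hr : 0 < r) => ?_
  have hns : ∀ θ : ℝ, ‖Complex.polarCoord.symm (r, θ) - a‖ ^ 2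
      = r ^ 2 + a ^ 2 - 2 * a * r * Real.cos θ := by
    intro θ
    rw [Complex.polarCoord_symm_apply, Complex.sq_norm, Complex.normSq_apply]
    simp [Complex.cos_ofReal_re, Complex.sin_ofReal_re]
    nlinarith [Real.sin_sq_add_cos_sq θ]
  have h2 : ∀ θ : ℝ, ENNReal.ofReal r • (ENNReal.ofReal (1 / (Real.pi * v) *
      Real.exp (-(‖Complex.polarCoord.symm (r, θ) - a‖ ^ 2 / v))) *
        g ‖Complex.polarCoord.symm (r, θ)‖) =
      (ENNReal.ofReal (r / (Real.pi * v) * Real.exp (-((r ^ 2 + a ^ 2) / v))) * g r) *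
        ENNReal.ofReal (Real.exp (2 * a * r / v * Real.cos θ)) := by
    intro θ
    rw [hns, Complex.norm_polarCoord_symm, abs_of_pos hr, smul_eq_mul, ← mul_assoc,
      ← ENNReal.ofReal_mul hr.le, mul_right_comm _ (g r), ← ENNReal.ofReal_mul (by positivity)]
    congr 2
    rw [mul_assoc (r / (Real.pi * v)), ← Real.exp_add, ← mul_assoc, mul_one_div]
    congr 2
    ring
  simp only [h2]
  rw [lintegral_const_mul _ (by fun_prop), lintegral_exp_mul_cos, mul_right_comm,
    ← ENNReal.ofReal_mul (by positivity)]
  congr 2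
  unfold riceDensity
  field_simp

/-- The squared modulus of a `CN(0, v)` variable is exponential with mean `v`. -/
lemma lintegral_norm_sq_complexNormal {v : ℝ} (hv : 0 < v) {g : ℝ → ℝ≥0∞} (hg : Measurable g) :
    ∫⁻ w, g (‖w‖ ^ 2) ∂complexNormal v
      = ∫⁻ x in Set.Ioi 0, ENNReal.ofReal (Real.exp (-x)) * g (v * x) := by
  have h1 := lintegral_norm_add_complexNormal hv 0 (g := fun r => g (r ^ 2)) (by fun_prop)
  simp only [Complex.ofReal_zero, zero_add] at h1
  rw [h1]
  have himg : (fun r : ℝ => r ^ 2 / v) '' Set.Ioi 0 = Set.Ioi 0 := by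
    ext y
    constructor
    · rintro ⟨r, hr, rfl⟩
      have : (0 : ℝ) < r := hr
      simp only [Set.mem_Ioi]; positivity
    · intro hy
      have hy' : 0 < y := hy
      refine ⟨Real.sqrt (v * y), Real.sqrt_pos.2 (by positivity), ?_⟩
      simp only
      rw [Real.sq_sqrt (by positivity)]; field_simp
  have h2 := lintegral_image_eq_lintegral_abs_deriv_mul (s := Set.Ioi (0 : ℝ))
    (f := fun r : ℝ => r ^ 2 / v) (f' := fun r => 2 * r / v) measurableSet_Ioi
    (fun r _ => by
      have := ((hasDerivAt_pow 2 r).div_const v).hasDerivWithinAt (s := Set.Ioi 0)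
      simpa using this)
    (fun r hr s hs h => by
      have h' : r ^ 2 = s ^ 2 := by
        simp only at h; field_simp at h; exact h
      exact (pow_left_inj₀ (le_of_lt hr) (le_of_lt hs) (by norm_num)).1 h')
    (fun x => ENNReal.ofReal (Real.exp (-x)) * g (v * x))
  rw [himg] at h2
  rw [h2]
  refine setLIntegral_congr_fun measurableSet_Ioi fun r (hr : 0 < r) => ?_
  rw [abs_of_pos (by positivity), ← mul_assoc, ← ENNReal.ofReal_mul (by positivity)]
  have hv0 : v * (r ^ 2 / v) = r ^ 2 := by field_simp
  rw [hv0]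
  congr 2
  have hb : besselI 0 0 = 1 := by
    simp [besselI]
  simp [riceDensity, hb]

lemma integrableOn_riceDensity {v : ℝ} (hv : 0 < v) (a : ℝ) :
    IntegrableOn (riceDensity v a) (Set.Ioi 0) ∧ ∫ r in Set.Ioi 0, riceDensity v a r = 1 := by
  have h := lintegral_norm_add_complexNormal hv a (g := fun _ => 1) measurable_const
  simp only [lintegral_const, measure_univ, mul_one] at h
  have hnn : 0 ≤ᵐ[volume.restrict (Set.Ioi 0)] riceDensity v a :=
    (ae_restrict_iff' measurableSet_Ioi).2
      (ae_of_all _ fun r (hr : 0 < r) => riceDensity_nonneg hv hr.le)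
  have hm := (continuous_riceDensity v a).aestronglyMeasurable (μ := volume.restrict (Set.Ioi 0))
  constructor
  · refine ⟨hm, ?_⟩
    rw [hasFiniteIntegral_iff_ofReal hnn, ← h]
    exact ENNReal.one_lt_top
  · rw [integral_eq_lintegral_of_nonneg_ae hnn hm, ← h]
    simp

lemma complexNormal_real_norm_add_le {v : ℝ} (hv : 0 < v) (a : ℝ) {b : ℝ} (hb : 0 ≤ b) :
    (complexNormal v).real {w | ‖(a : ℂ) + w‖ ≤ b} = ∫ r in (0 : ℝ)..b, riceDensity v a r := by
  have hm : MeasurableSet {w : ℂ | ‖(a : ℂ) + w‖ ≤ b} :=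
    measurableSet_le (by fun_prop) measurable_const
  have h := lintegral_norm_add_complexNormal hv a (g := (Set.Iic b).indicator 1)
    (measurable_one.indicator measurableSet_Iic)
  have h1 : ∫⁻ w, (Set.Iic b).indicator 1 ‖(a : ℂ) + w‖ ∂complexNormal v
      = complexNormal v {w | ‖(a : ℂ) + w‖ ≤ b} := by
    rw [← lintegral_indicator_one hm]; rfl
  have h2 : ∫⁻ r in Set.Ioi 0, ENNReal.ofReal (riceDensity v a r) * (Set.Iic b).indicator 1 r
      = ∫⁻ r in Set.Ioc 0 b, ENNReal.ofReal (riceDensity v a r) := by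
    rw [← Set.Iic_inter_Ioi, ← setLIntegral_indicator measurableSet_Iic]
    congr 1
    funext r
    by_cases hr : r ∈ Set.Iic b <;> simp [hr]
  rw [Measure.real, ← h1, h, h2, intervalIntegral.integral_of_le hb,
    integral_eq_lintegral_of_nonneg_ae _ ((continuous_riceDensity v a).aestronglyMeasurable)]
  exact (ae_restrict_iff' measurableSet_Ioc).2
      (ae_of_all _ fun r hr => riceDensity_nonneg hv hr.1.le)

/-- Rescaling by `√2` turns the Marcum integrand into the Rice density with `v = 1`; since that has
mass 1, the complement of the tail is the integral up to `b`. -/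
lemma one_sub_marcumQ {a : ℝ} {b : ℝ} (hb : 0 ≤ b) :
    1 - marcumQ (Real.sqrt 2 * a) (Real.sqrt 2 * b) = ∫ r in (0 : ℝ)..b, riceDensity 1 a r := by
  have h2 : (0 : ℝ) < Real.sqrt 2 := by positivity
  have hs : Real.sqrt 2 ^ 2 = 2 := Real.sq_sqrt (by norm_num)
  have h1 : marcumQ (Real.sqrt 2 * a) (Real.sqrt 2 * b) = ∫ r in Set.Ioi b, riceDensity 1 a r := by
    rw [marcumQ]
    have := integral_comp_mul_left_Ioi (fun x => x * Real.exp (-(x ^ 2 + (Real.sqrt 2 * a) ^ 2) / 2)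
      * besselI 0 (Real.sqrt 2 * a * x)) b h2
    rw [smul_eq_mul, eq_inv_mul_iff_mul_eq₀ h2.ne'] at this
    rw [← this, ← integral_const_mul]
    refine setIntegral_congr_fun measurableSet_Ioi fun r _ => ?_
    simp only [riceDensity]
    have e1 : Real.sqrt 2 * a * (Real.sqrt 2 * r) = 2 * a * r / 1 := by
      rw [div_one]; linear_combination (a * r) * hs
    have e2 : -((Real.sqrt 2 * r) ^ 2 + (Real.sqrt 2 * a) ^ 2) / 2 = -((r ^ 2 + a ^ 2) / 1) := by
      rw [mul_pow, mul_pow, hs]; ring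
    rw [e1, e2, div_one (2 * r)]
    linear_combination (r * Real.exp (-((r ^ 2 + a ^ 2) / 1)) * besselI 0 (2 * a * r / 1)) * hs
  obtain ⟨hi, hI⟩ := integrableOn_riceDensity one_pos a
  have := intervalIntegral.integral_interval_add_Ioi (a := 0) (b := b) (f := riceDensity 1 a)
    (μ := volume) hi (hi.mono_set (Set.Ioi_subset_Ioi hb))
  rw [h1]
  linarith

/-! ### The distribution of the modulus of a Rician channel. -/

lemma norm_rician {κ α : ℝ} (hκ : 0 ≤ κ) (hα : 0 < α) (w : ℂ) :
    ‖rician κ α w‖ = Real.sqrt (α / (κ + 1)) * ‖(Real.sqrt κ : ℂ) + w‖ := by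
  have hk : 0 < κ + 1 := by linarith
  have e : rician κ α w = ((Real.sqrt (α / (κ + 1)) : ℝ) : ℂ) * ((Real.sqrt κ : ℂ) + w) := by
    rw [rician, Real.sqrt_div hκ, Real.sqrt_div hα.le, Real.sqrt_div (by norm_num), Real.sqrt_one]
    have : (Real.sqrt (κ + 1) : ℂ) ≠ 0 := by
      exact_mod_cast (Real.sqrt_pos.2 hk).ne'
    push_cast
    field_simp
  rw [e, norm_mul, Complex.norm_real, Real.norm_of_nonneg (Real.sqrt_nonneg _)]

lemma norm_rician_le_iff {κ α : ℝ} (hκ : 0 ≤ κ) (hα : 0 < α) (w : ℂ) (r : ℝ) :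
    ‖rician κ α w‖ ≤ r ↔ ‖(Real.sqrt κ : ℂ) + w‖ ≤ r * Real.sqrt ((κ + 1) / α) := by
  have hk : 0 < κ + 1 := by linarith
  rw [norm_rician hκ hα, Real.sqrt_div hk.le, Real.sqrt_div hα.le]
  have h1 := Real.sqrt_pos.2 hk
  have h2 := Real.sqrt_pos.2 hα
  rw [div_mul_eq_mul_div, div_le_iff₀ h1, mul_div_assoc', le_div_iff₀ h2, mul_comm]

/-- The distribution function of the modulus of a Rician channel. -/
lemma complexNormal_real_norm_rician_le {κ α : ℝ} (hκ : 0 ≤ κ) (hα : 0 < α) {r : ℝ} (hr : 0 ≤ r) :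
    (complexNormal 1).real {w | ‖rician κ α w‖ ≤ r}
      = 1 - marcumQ (Real.sqrt (2 * κ)) (r * Real.sqrt (2 * (κ + 1) / α)) := by
  simp_rw [norm_rician_le_iff hκ hα]
  rw [complexNormal_real_norm_add_le one_pos _ (by positivity), ← one_sub_marcumQ (by positivity)]
  congr 2
  · rw [Real.sqrt_mul (by norm_num)]
  · rw [mul_div_assoc, Real.sqrt_mul (by norm_num)]; ring

lemma continuousOn_one_sub_marcumQ {κ c : ℝ} (hc : 0 ≤ c) :
    ContinuousOn (fun r => 1 - marcumQ (Real.sqrt (2 * κ)) (r * c)) (Set.Ici 0) := by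
  have h : ∀ r ∈ Set.Ici (0 : ℝ), 1 - marcumQ (Real.sqrt (2 * κ)) (r * c)
      = ∫ x in (0 : ℝ)..(r * (c / Real.sqrt 2)), riceDensity 1 (Real.sqrt κ) x := by
    intro r (hr : 0 ≤ r)
    rw [← one_sub_marcumQ (by positivity)]
    congr 2
    · rw [Real.sqrt_mul (by norm_num)]
    · have : Real.sqrt 2 ≠ 0 := by positivity
      field_simp
  refine ContinuousOn.congr (Continuous.continuousOn ?_) h
  have h1 : Continuous fun b : ℝ => ∫ x in (0 : ℝ)..b, riceDensity 1 (Real.sqrt κ) x :=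
    intervalIntegral.continuous_primitive
      (fun a b => (continuous_riceDensity 1 _).intervalIntegrable a b) 0
  exact h1.comp (by fun_prop)

/-- The level set is a circle, hence Lebesgue-null. This makes strict and weak inequalities
interchangeable and shows that the modulus is not almost surely constant. -/
lemma complexNormal_norm_rician_eq {κ α : ℝ} (hκ : 0 ≤ κ) (hα : 0 < α) (r : ℝ) :
    complexNormal 1 {w | ‖rician κ α w‖ = r} = 0 := by
  refine complexNormal_absolutelyContinuous one_pos ?_
  have hk : 0 < κ + 1 := by linarith
  have hpos : 0 < Real.sqrt (α / (κ + 1)) := Real.sqrt_pos.2 (by positivity)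
  have : {w | ‖rician κ α w‖ = r} = Metric.sphere (-(Real.sqrt κ : ℂ)) (r / Real.sqrt (α / (κ + 1))) := by
    ext w
    simp only [Set.mem_ofPred_eq, norm_rician hκ hα, mem_sphere_iff_norm, sub_neg_eq_add]
    rw [eq_div_iff hpos.ne', mul_comm, add_comm]
  rw [this]
  exact Measure.addHaar_sphere _ _ _

/-! ### Moments of the Rician modulus -/

lemma memLp_add_gaussian (b : ℝ) (v : NNReal) : MemLp (fun x : ℝ => b + x) 2 (gaussianReal 0 v) :=
  (memLp_const b).add (memLp_id_gaussianReal 2)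

lemma integral_sq_add_gaussian (b : ℝ) (v : NNReal) :
    ∫ x, (b + x) ^ 2 ∂gaussianReal 0 v = v + b ^ 2 := by
  have h1 := variance_eq_sub (memLp_add_gaussian b v)
  have hid : Integrable (fun x : ℝ => x) (gaussianReal 0 v) :=
    (memLp_id_gaussianReal 1).integrable (by norm_num)
  rw [variance_const_add (by fun_prop)] at h1
  rw [variance_fun_id_gaussianReal, integral_add (integrable_const b) hid,
    integral_id_gaussianReal] at h1
  simp only [integral_const, probReal_univ, smul_eq_mul, one_mul, add_zero] at h1
  have h2 : ∫ x, ((fun x : ℝ => b + x) ^ 2) x ∂gaussianReal 0 v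
    = ∫ x, (b + x) ^ 2 ∂gaussianReal 0 v := rfl
  linarith

lemma integral_norm_sq_complexNormal {v : ℝ} (hv : 0 ≤ v) (b : ℝ) :
    Integrable (fun w => ‖(b : ℂ) + w‖ ^ 2) (complexNormal v) ∧
      ∫ w, ‖(b : ℂ) + w‖ ^ 2 ∂complexNormal v = v + b ^ 2 := by
  have hvv : ((v / 2).toNNReal : ℝ) = v / 2 := Real.coe_toNNReal _ (by linarith)
  have e : ∀ p : ℝ × ℝ, ‖(b : ℂ) + ((p.1 : ℂ) + (p.2 : ℂ) * Complex.I)‖ ^ 2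
      = (b + p.1) ^ 2 + (0 + p.2) ^ 2 := by
    intro p
    rw [Complex.sq_norm, Complex.normSq_apply]; simp; ring
  have hm : Measurable fun p : ℝ × ℝ => (p.1 : ℂ) + (p.2 : ℂ) * Complex.I := by fun_prop
  have h1 : Integrable (fun p : ℝ × ℝ => (b + p.1) ^ 2)
      ((gaussianReal 0 (v / 2).toNNReal).prod (gaussianReal 0 (v / 2).toNNReal)) :=
    (memLp_add_gaussian b _).integrable_sq.comp_fst _
  have h2 : Integrable (fun p : ℝ × ℝ => (0 + p.2) ^ 2)
      ((gaussianReal 0 (v / 2).toNNReal).prod (gaussianReal 0 (v / 2).toNNReal)) :=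
    (memLp_add_gaussian 0 _).integrable_sq.comp_snd _
  constructor
  · rw [complexNormal, integrable_map_measure (by fun_prop) hm.aemeasurable]
    refine (h1.add h2).congr (ae_of_all _ fun p => (e p).symm)
  · rw [complexNormal, integral_map hm.aemeasurable (by fun_prop)]
    simp_rw [e]
    rw [integral_add h1 h2, integral_fun_fst (fun x : ℝ => (b + x) ^ 2),
      integral_fun_snd (fun x : ℝ => (0 + x) ^ 2), integral_sq_add_gaussian,
      integral_sq_add_gaussian, hvv]
    simp
    ring

/-- Completing the square: with `s = 1 + u²`, the exponential times the Gaussian density centred at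
`a` is `e^{-a²u²/s} / s` times the density of variance `1/s` centred at `a/s`, whose second moment
is `1/s + (a/s)²`. -/
lemma lintegral_norm_sq_mul_exp {u : ℝ} (a : ℝ) :
    ∫⁻ w, ENNReal.ofReal (‖(a : ℂ) + w‖ ^ 2 * Real.exp (-(u ^ 2 * ‖(a : ℂ) + w‖ ^ 2)))
        ∂complexNormal 1
      = ENNReal.ofReal (Real.exp (-(a ^ 2 * u ^ 2 / (1 + u ^ 2)))
          * (1 / (1 + u ^ 2) ^ 2 + a ^ 2 / (1 + u ^ 2) ^ 3)) := by
  have hs : 0 < 1 + u ^ 2 := by positivity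
  have hpi := Real.pi_pos
  set s := 1 + u ^ 2 with hsdef
  have hs1 : 0 < 1 / s := by positivity
  have hu : u ^ 2 = s - 1 := by rw [hsdef]; ring
  obtain ⟨hI, hE⟩ := integral_norm_sq_complexNormal hs1.le (a / s)
  have h3 : ∫⁻ w, ENNReal.ofReal (‖((a / s : ℝ) : ℂ) + w‖ ^ 2) ∂complexNormal (1 / s)
      = ENNReal.ofReal (1 / s + (a / s) ^ 2) := by
    rw [← hE, ofReal_integral_eq_lintegral_ofReal hI (ae_of_all _ fun _ => by positivity)]
  rw [complexNormal_eq_withDensity hs1, lintegral_withDensity_eq_lintegral_mul _ (by fun_prop)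
    (by fun_prop)] at h3
  rw [complexNormal_eq_withDensity one_pos, lintegral_withDensity_eq_lintegral_mul _ (by fun_prop)
    (by fun_prop)]
  have hA : ∫⁻ w : ℂ, ((fun z : ℂ => ENNReal.ofReal (1 / (Real.pi * 1) * Real.exp (-(‖z‖ ^ 2 / 1))))
      * fun w => ENNReal.ofReal (‖(a : ℂ) + w‖ ^ 2 * Real.exp (-(u ^ 2 * ‖(a : ℂ) + w‖ ^ 2)))) w
      = ∫⁻ z : ℂ, ENNReal.ofReal (1 / Real.pi * Real.exp (-(‖z - a‖ ^ 2))
        * (‖z‖ ^ 2 * Real.exp (-(u ^ 2 * ‖z‖ ^ 2)))) := by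
    rw [← lintegral_add_left_eq_self (fun z : ℂ => ENNReal.ofReal (1 / Real.pi *
      Real.exp (-(‖z - a‖ ^ 2)) * (‖z‖ ^ 2 * Real.exp (-(u ^ 2 * ‖z‖ ^ 2))))) (a : ℂ)]
    refine lintegral_congr fun w => ?_
    simp only [Pi.mul_apply]
    rw [← ENNReal.ofReal_mul (by positivity)]
    simp
  have hB : ∫⁻ w : ℂ, ((fun z : ℂ => ENNReal.ofReal (1 / (Real.pi * (1 / s)) *
        Real.exp (-(‖z‖ ^ 2 / (1 / s)))))
      * fun w => ENNReal.ofReal (‖((a / s : ℝ) : ℂ) + w‖ ^ 2)) w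
      = ∫⁻ z : ℂ, ENNReal.ofReal (s / Real.pi * Real.exp (-(s * ‖z - (a / s : ℝ)‖ ^ 2)) * ‖z‖ ^ 2) := by
    rw [← lintegral_add_left_eq_self (fun z : ℂ => ENNReal.ofReal (s / Real.pi *
      Real.exp (-(s * ‖z - (a / s : ℝ)‖ ^ 2)) * ‖z‖ ^ 2)) ((a / s : ℝ) : ℂ)]
    refine lintegral_congr fun w => ?_
    simp only [Pi.mul_apply]
    rw [← ENNReal.ofReal_mul (by positivity), add_sub_cancel_left]
    congr 3
    · field_simp
    · congr 1; field_simp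
  rw [hA]
  rw [hB] at h3
  have e : ∀ z : ℂ, 1 / Real.pi * Real.exp (-(‖z - a‖ ^ 2))
        * (‖z‖ ^ 2 * Real.exp (-(u ^ 2 * ‖z‖ ^ 2)))
      = (1 / s * Real.exp (-(a ^ 2 * u ^ 2 / s))) *
        (s / Real.pi * Real.exp (-(s * ‖z - (a / s : ℝ)‖ ^ 2)) * ‖z‖ ^ 2) := by
    intro z
    have hexp : Real.exp (-(‖z - a‖ ^ 2)) * Real.exp (-(u ^ 2 * ‖z‖ ^ 2))
        = Real.exp (-(a ^ 2 * u ^ 2 / s)) * Real.exp (-(s * ‖z - (a / s : ℝ)‖ ^ 2)) := by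
      rw [← Real.exp_add, ← Real.exp_add]
      congr 1
      rw [Complex.sq_norm, Complex.sq_norm, Complex.sq_norm, Complex.normSq_apply,
        Complex.normSq_apply, Complex.normSq_apply]
      simp only [Complex.sub_re, Complex.sub_im, Complex.ofReal_re, Complex.ofReal_im]
      rw [hu]
      field_simp
      ring
    calc _ = 1 / Real.pi * ‖z‖ ^ 2 * (Real.exp (-(‖z - a‖ ^ 2)) * Real.exp (-(u ^ 2 * ‖z‖ ^ 2))) := by
          ring
      _ = _ := by rw [hexp]; field_simp
  simp_rw [e]
  simp_rw [ENNReal.ofReal_mul (by positivity : 0 ≤ 1 / s * Real.exp (-(a ^ 2 * u ^ 2 / s)))]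
  rw [lintegral_const_mul _ (by fun_prop), h3, ← ENNReal.ofReal_mul (by positivity)]
  congr 1
  field_simp

/-- Substitute `u = tan (t/2)`: then `1 / (1 + u²) = (1 + cos t) / 2`, and the exponent takes the
form of Bessel's integral. -/
lemma lintegral_tan_half_subst (κ : ℝ) (hκ : 0 ≤ κ) :
    ∫⁻ u in Set.Ioi 0, ENNReal.ofReal (Real.exp (-(κ * u ^ 2 / (1 + u ^ 2)))
          * (1 / (1 + u ^ 2) ^ 2 + κ / (1 + u ^ 2) ^ 3))
      = ENNReal.ofReal (∫ t in (0 : ℝ)..Real.pi, 1 / 2 * (Real.exp (-(κ / 2)) *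
          Real.exp (κ / 2 * Real.cos t) *
          ((1 + Real.cos t) / 2 + κ * ((1 + Real.cos t) / 2) ^ 2))) := by
  have hpi := Real.pi_pos
  have hcos : ∀ t ∈ Set.Ioo 0 Real.pi, 0 < Real.cos (t / 2) := fun t ht =>
    Real.cos_pos_of_mem_Ioo ⟨by linarith [ht.1], by linarith [ht.2]⟩
  have himg : (fun t : ℝ => Real.tan (t / 2)) '' Set.Ioo 0 Real.pi = Set.Ioi 0 := by
    ext y
    constructor
    · rintro ⟨t, ht, rfl⟩
      exact Real.tan_pos_of_pos_of_lt_pi_div_two (by linarith [ht.1]) (by linarith [ht.2])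
    · intro hy
      have hy' : 0 < y := hy
      refine ⟨2 * Real.arctan y, ⟨by have := Real.arctan_pos.2 hy'; linarith,
        by have := Real.arctan_lt_pi_div_two y; linarith⟩, ?_⟩
      simp only
      rw [mul_div_cancel_left₀ _ (by norm_num), Real.tan_arctan]
  have h2 := lintegral_image_eq_lintegral_abs_deriv_mul (s := Set.Ioo 0 Real.pi)
    (f := fun t : ℝ => Real.tan (t / 2)) (f' := fun t => 1 / Real.cos (t / 2) ^ 2 * (1 / 2))
    measurableSet_Ioo
    (fun t ht => (HasDerivAt.comp (h₂ := Real.tan) (h := fun t : ℝ => t / 2) t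
      (Real.hasDerivAt_tan (hcos t ht).ne') ((hasDerivAt_id t).div_const 2)).hasDerivWithinAt)
    (fun r hr s hs h => by
      have := Real.injOn_tan (x₁ := r / 2) (x₂ := s / 2)
        (by constructor <;> linarith [hr.1, hr.2]) (by constructor <;> linarith [hs.1, hs.2]) h
      linarith)
    (fun u => ENNReal.ofReal (Real.exp (-(κ * u ^ 2 / (1 + u ^ 2)))
          * (1 / (1 + u ^ 2) ^ 2 + κ / (1 + u ^ 2) ^ 3)))
  rw [himg] at h2
  rw [h2, intervalIntegral.integral_of_le hpi.le, integral_Ioc_eq_integral_Ioo,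
    ofReal_integral_eq_lintegral_ofReal]
  · refine setLIntegral_congr_fun measurableSet_Ioo fun t ht => ?_
    have hc := hcos t ht
    rw [abs_of_pos (by positivity), ← ENNReal.ofReal_mul (by positivity)]
    congr 1
    have hct : (1 + Real.cos t) / 2 = Real.cos (t / 2) ^ 2 := by
      have := Real.cos_sq (t / 2)
      rw [mul_div_cancel₀ _ (by norm_num : (2 : ℝ) ≠ 0)] at this
      rw [this]; ring
    have hs : Real.sin (t / 2) ^ 2 = (1 - Real.cos t) / 2 := by
      have := Real.sin_sq_add_cos_sq (t / 2)
      linarith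
    have h1t : 1 + Real.tan (t / 2) ^ 2 = 1 / Real.cos (t / 2) ^ 2 := by
      rw [one_div, ← Real.inv_one_add_tan_sq hc.ne', inv_inv]
    have he : κ * Real.tan (t / 2) ^ 2 / (1 / Real.cos (t / 2) ^ 2) = κ / 2 - κ / 2 * Real.cos t := by
      rw [Real.tan_eq_sin_div_cos, div_pow, hs]
      field_simp
    rw [h1t, he, hct, ← Real.exp_add, neg_sub, sub_eq_neg_add]
    field_simp
  · refine (Continuous.integrableOn_Icc (a := 0) (b := Real.pi) ?_).mono_set Set.Ioo_subset_Icc_self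
    fun_prop
  · refine ae_of_all _ fun t => ?_
    have := Real.neg_one_le_cos t
    have : 0 ≤ 1 + Real.cos t := by linarith
    simp only [Pi.zero_apply]
    positivity

/-- The derivative of `sin t · e^{(κ/2) cos t}` integrates to 0 over `[0, π]`. Splitting it off
absorbs the `cos²` term and leaves the integrands of `I₀` and `I₁`. -/
lemma trig_integral_eq_laguerreHalf (κ : ℝ) :
    ∫ t in (0 : ℝ)..Real.pi, 1 / 2 * (Real.exp (-(κ / 2)) * Real.exp (κ / 2 * Real.cos t) *
          ((1 + Real.cos t) / 2 + κ * ((1 + Real.cos t) / 2) ^ 2))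
      = Real.pi / 4 * laguerreHalf (-κ) := by
  have hpi := Real.pi_pos
  have h1 : ∫ t in (0 : ℝ)..Real.pi, (Real.cos t * Real.exp (κ / 2 * Real.cos t) +
      Real.sin t * (Real.exp (κ / 2 * Real.cos t) * (κ / 2 * -Real.sin t)))
      = Real.sin Real.pi * Real.exp (κ / 2 * Real.cos Real.pi)
        - Real.sin 0 * Real.exp (κ / 2 * Real.cos 0) := by
    refine intervalIntegral.integral_eq_sub_of_hasDerivAt
      (f := fun t => Real.sin t * Real.exp (κ / 2 * Real.cos t)) (fun t _ => ?_)
      (Continuous.intervalIntegrable (by fun_prop) _ _)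
    exact (Real.hasDerivAt_sin t).mul (((Real.hasDerivAt_cos t).const_mul _).exp)
  rw [Real.sin_pi, Real.sin_zero, zero_mul, zero_mul, sub_zero] at h1
  have h2 : ∀ t : ℝ, 1 / 2 * (Real.exp (-(κ / 2)) * Real.exp (κ / 2 * Real.cos t) *
          ((1 + Real.cos t) / 2 + κ * ((1 + Real.cos t) / 2) ^ 2))
      = Real.exp (-(κ / 2)) / 4 * (((1 + κ) * (Real.exp (κ / 2 * Real.cos t) * Real.cos ((0 : ℕ) * t))
        + κ * (Real.exp (κ / 2 * Real.cos t) * Real.cos ((1 : ℕ) * t)))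
        + (Real.cos t * Real.exp (κ / 2 * Real.cos t) +
      Real.sin t * (Real.exp (κ / 2 * Real.cos t) * (κ / 2 * -Real.sin t)))) := by
    intro t
    have hs := Real.sin_sq_add_cos_sq t
    simp only [Nat.cast_zero, zero_mul, Real.cos_zero, Nat.cast_one, one_mul]
    linear_combination (Real.exp (-(κ / 2)) * Real.exp (κ / 2 * Real.cos t) * κ / 8) * hs
  simp_rw [h2]
  rw [intervalIntegral.integral_const_mul, intervalIntegral.integral_add
    (Continuous.intervalIntegrable (by fun_prop) _ _)
    (Continuous.intervalIntegrable (by fun_prop) _ _), h1, intervalIntegral.integral_add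
    (Continuous.intervalIntegrable (by fun_prop) _ _)
    (Continuous.intervalIntegrable (by fun_prop) _ _), intervalIntegral.integral_const_mul,
    intervalIntegral.integral_const_mul, laguerreHalf, besselI, besselI]
  simp only [neg_neg, neg_div]
  field_simp
  ring

/-- The mean of the Rice distribution. -/
lemma integral_norm_add_complexNormal {κ : ℝ} (hκ : 0 ≤ κ) :
    ∫ w, ‖(Real.sqrt κ : ℂ) + w‖ ∂complexNormal 1
      = Real.sqrt Real.pi / 2 * laguerreHalf (-κ) := by
  have hpi := Real.pi_pos
  have hsp : 0 < Real.sqrt Real.pi := Real.sqrt_pos.2 hpi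
  -- The modulus is a superposition of Gaussians in itself, whose expectations are explicit; Tonelli
  -- then exchanges the two integrations.
  have hg : ∀ r : ℝ, 0 ≤ r → ∫⁻ u in Set.Ioi (0 : ℝ), ENNReal.ofReal (r ^ 2 * Real.exp (-(u ^ 2 * r ^ 2)))
      = ENNReal.ofReal (Real.sqrt Real.pi / 2) * ENNReal.ofReal r := by
    intro r hr
    rcases hr.eq_or_lt with h0 | h0
    · subst h0; simp
    · have hb : 0 < r ^ 2 := by positivity
      rw [← ofReal_integral_eq_lintegral_ofReal, ← ENNReal.ofReal_mul (by positivity)]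
      · congr 1
        rw [integral_const_mul]
        have := integral_gaussian_Ioi (r ^ 2)
        simp_rw [neg_mul, mul_comm (r ^ 2)] at this
        rw [this, Real.sqrt_div hpi.le, Real.sqrt_sq hr]
        field_simp
      · have := (integrable_exp_neg_mul_sq hb).integrableOn (s := Set.Ioi 0)
        simp_rw [neg_mul, mul_comm (r ^ 2)] at this
        exact this.const_mul _
      · exact ae_of_all _ fun u => by simp only [Pi.zero_apply]; positivity
  have h1 : ENNReal.ofReal (Real.sqrt Real.pi / 2) *
      ∫⁻ w, ENNReal.ofReal ‖(Real.sqrt κ : ℂ) + w‖ ∂complexNormal 1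
      = ENNReal.ofReal (Real.pi / 4 * laguerreHalf (-κ)) := by
    rw [← trig_integral_eq_laguerreHalf, ← lintegral_tan_half_subst κ hκ,
      ← lintegral_const_mul _ (by fun_prop)]
    simp_rw [← hg _ (norm_nonneg _)]
    rw [lintegral_lintegral_swap (by fun_prop)]
    refine lintegral_congr fun u => ?_
    rw [lintegral_norm_sq_mul_exp, Real.sq_sqrt hκ]
  have h2 : 0 ≤ laguerreHalf (-κ) := by
    have h3 : 0 ≤ Real.pi / 4 * laguerreHalf (-κ) := by
      rw [← trig_integral_eq_laguerreHalf]
      refine intervalIntegral.integral_nonneg hpi.le fun t _ => ?_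
      have := Real.neg_one_le_cos t
      have : 0 ≤ 1 + Real.cos t := by linarith
      positivity
    exact nonneg_of_mul_nonneg_right h3 (by positivity)
  rw [integral_eq_lintegral_of_nonneg_ae (ae_of_all _ fun _ => norm_nonneg _) (by fun_prop)]
  have h4 := congrArg ENNReal.toReal h1
  rw [ENNReal.toReal_mul, ENNReal.toReal_ofReal (by positivity),
    ENNReal.toReal_ofReal (by positivity)] at h4
  have hsq : Real.sqrt Real.pi * Real.sqrt Real.pi = Real.pi := Real.mul_self_sqrt hpi.le
  have h5 : Real.sqrt Real.pi / 2 ≠ 0 := by positivity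
  apply mul_left_cancel₀ h5
  rw [h4, ← mul_assoc]
  congr 1
  linear_combination (-1 / 4) * hsq

lemma memLp_norm_rician {κ α : ℝ} (hκ : 0 ≤ κ) (hα : 0 < α) :
    MemLp (fun w => ‖rician κ α w‖) 2 (complexNormal 1) := by
  simp_rw [norm_rician hκ hα]
  refine MemLp.const_mul ?_ _
  rw [memLp_two_iff_integrable_sq (by fun_prop)]
  exact (integral_norm_sq_complexNormal zero_le_one _).1

/-- The mean modulus of a Rician channel. -/
lemma integral_norm_rician {κ α : ℝ} (hκ : 0 ≤ κ) (hα : 0 < α) :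
    ∫ w, ‖rician κ α w‖ ∂complexNormal 1
      = Real.sqrt (α / (κ + 1)) * (Real.sqrt Real.pi / 2 * laguerreHalf (-κ)) := by
  simp_rw [norm_rician hκ hα]
  rw [integral_const_mul, integral_norm_add_complexNormal hκ]

lemma integral_norm_rician_sq {κ α : ℝ} (hκ : 0 ≤ κ) (hα : 0 < α) :
    ∫ w, ‖rician κ α w‖ ^ 2 ∂complexNormal 1 = α := by
  have hk : 0 < κ + 1 := by linarith
  simp_rw [norm_rician hκ hα, mul_pow]
  rw [integral_const_mul, (integral_norm_sq_complexNormal zero_le_one _).2, Real.sq_sqrt hκ,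
    Real.sq_sqrt (by positivity)]
  field_simp
  ring

lemma laguerreHalf_pos {κ : ℝ} (hκ : 0 ≤ κ) : 0 < laguerreHalf (-κ) := by
  have hpi := Real.pi_pos
  have h : 0 < Real.pi / 4 * laguerreHalf (-κ) := by
    rw [← trig_integral_eq_laguerreHalf]
    refine intervalIntegral.intervalIntegral_pos_of_pos_on
      (Continuous.intervalIntegrable (by fun_prop) _ _) (fun t ht => ?_) hpi
    have h1 : Real.cos Real.pi < Real.cos t :=
      Real.cos_lt_cos_of_nonneg_of_le_pi ht.1.le le_rfl ht.2
    rw [Real.cos_pi] at h1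
    have : 0 < 1 + Real.cos t := by linarith
    positivity
  exact pos_of_mul_pos_right h (by positivity)

/-- The modulus of a Rician channel is not almost surely constant, whence the strict inequality of
its first two moments. -/
lemma laguerreHalf_sq_lt {κ : ℝ} (hκ : 0 ≤ κ) :
    Real.pi / (4 * (1 + κ)) * laguerreHalf (-κ) ^ 2 < 1 := by
  have hk : 0 < κ + 1 := by linarith
  have hpi := Real.pi_pos
  have hmem := memLp_norm_rician hκ one_pos
  have hvar := variance_eq_sub hmem
  have h0 : Var[fun w => ‖rician κ 1 w‖; complexNormal 1] ≠ 0 := by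
    intro h0
    have h1 := ae_eq_integral_of_variance_eq_zero hmem h0
    have h2 := complexNormal_norm_rician_eq hκ one_pos (∫ w, ‖rician κ 1 w‖ ∂complexNormal 1)
    have h3 : ∀ᵐ w ∂complexNormal 1, ¬ ‖rician κ 1 w‖ = ∫ w, ‖rician κ 1 w‖ ∂complexNormal 1 := by
      rw [ae_iff]; simpa using h2
    obtain ⟨w, hw1, hw2⟩ := (h1.and h3).exists
    exact hw2 hw1
  have h1 := (variance_nonneg (fun w => ‖rician κ 1 w‖) (complexNormal 1)).lt_of_ne' h0
  rw [hvar] at h1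
  have h2 : ∫ w, ((fun w => ‖rician κ 1 w‖) ^ 2) w ∂complexNormal 1 = 1 :=
    integral_norm_rician_sq hκ one_pos
  rw [h2, integral_norm_rician hκ one_pos, mul_pow, mul_pow, div_pow, Real.sq_sqrt (by positivity),
    Real.sq_sqrt hpi.le] at h1
  have e : 1 / (κ + 1) * (Real.pi / 2 ^ 2 * laguerreHalf (-κ) ^ 2)
    = Real.pi / (4 * (1 + κ)) * laguerreHalf (-κ) ^ 2 := by
    field_simp; ring
  linarith

/-! ### Uniform convergence of distribution functions -/

lemma continuous_cdf (μ : Measure ℝ) [IsProbabilityMeasure μ] (h : ∀ x, μ {x} = 0) :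
    Continuous (cdf μ) := by
  rw [continuous_iff_continuousAt]
  intro x
  have h1 := (cdf μ).measure_singleton x
  rw [measure_cdf, h x] at h1
  have h2 : cdf μ x - Function.leftLim (cdf μ) x ≤ 0 := ENNReal.ofReal_eq_zero.1 h1.symm
  have h3 := (monotone_cdf μ).leftLim_le (le_refl x)
  rw [(monotone_cdf μ).continuousAt_iff_leftLim_eq_rightLim, (cdf μ).rightLim_eq]
  linarith

/-- A continuous distribution function is controlled, up to a given error, by its values on a
finite set. -/
lemma exists_finset_cdf_approx (μ : Measure ℝ) [IsProbabilityMeasure μ] (h : ∀ x, μ {x} = 0)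
    {ε : ℝ} (hε : 0 < ε) : ∃ T : Finset ℝ, ∀ x : ℝ,
      ((∃ q ∈ T, x ≤ q ∧ cdf μ q ≤ cdf μ x + ε) ∨ 1 ≤ cdf μ x + ε) ∧
      ((∃ p ∈ T, p ≤ x ∧ cdf μ x ≤ cdf μ p + ε) ∨ cdf μ x ≤ ε) := by
  obtain ⟨m, hm⟩ := exists_nat_gt (1 / ε)
  have hm0 : (0 : ℝ) < m := lt_trans (by positivity) hm
  have hmε : 1 / (m : ℝ) ≤ ε := by
    rw [div_le_iff₀ hm0]; rw [div_lt_iff₀ hε] at hm; linarith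
  -- Quantiles at mesh `1/m ≤ ε`. The levels 0 and 1 need not be attained, whence the second
  -- alternatives in the statement.
  have hivt : ∀ j : ℕ, 0 < j → j < m → ∃ x, cdf μ x = j / m := by
    intro j hj hjm
    have hj' : (0 : ℝ) < j := by exact_mod_cast hj
    have hjm' : (j : ℝ) < m := by exact_mod_cast hjm
    have ha := ((tendsto_cdf_atBot μ).eventually (ge_mem_nhds (by positivity : (0 : ℝ) < j / m))).exists
    have hb := ((tendsto_cdf_atTop μ).eventually (le_mem_nhds
      (by rw [div_lt_one hm0]; exact hjm' : (j / m : ℝ) < 1))).exists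
    exact mem_range_of_exists_le_of_exists_ge (continuous_cdf μ h) ha hb
  choose! X hX using hivt
  refine ⟨(Finset.range m).image X, fun x => ⟨?_, ?_⟩⟩
  · set y := (m : ℝ) * cdf μ x with hy
    have hy0 : 0 ≤ y := mul_nonneg hm0.le (cdf_nonneg μ x)
    have h1 := Nat.lt_floor_add_one y
    have h2 := Nat.floor_le hy0
    by_cases hlt : ⌊y⌋₊ + 1 < m
    · left
      have hv := hX (⌊y⌋₊ + 1) (by omega) hlt
      push_cast at hv
      refine ⟨X (⌊y⌋₊ + 1), Finset.mem_image_of_mem _ (Finset.mem_range.2 hlt), ?_, ?_⟩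
      · by_contra hc
        have := monotone_cdf μ (not_le.1 hc).le
        rw [hv, div_le_iff₀ hm0] at this
        linarith
      · rw [hv, div_le_iff₀ hm0]
        rw [div_le_iff₀ hm0] at hmε
        nlinarith
    · right
      have h3 : (m : ℝ) ≤ ⌊y⌋₊ + 1 := by exact_mod_cast not_lt.1 hlt
      rw [div_le_iff₀ hm0] at hmε
      have : (m : ℝ) * 1 ≤ m * (cdf μ x + ε) := by nlinarith
      exact le_of_mul_le_mul_left this hm0
  · set y := (m : ℝ) * cdf μ x with hy
    have hy0 : 0 ≤ y := mul_nonneg hm0.le (cdf_nonneg μ x)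
    have hym : y ≤ m := by
      have := cdf_le_one μ x
      nlinarith
    have h1 := Nat.le_ceil y
    have h2 := Nat.ceil_lt_add_one hy0
    rw [div_le_iff₀ hm0] at hmε
    by_cases hlt : 1 < ⌈y⌉₊
    · left
      have hc1 : ((⌈y⌉₊ - 1 : ℕ) : ℝ) = ⌈y⌉₊ - 1 := by
        rw [Nat.cast_sub hlt.le]; simp
      have hle : ⌈y⌉₊ ≤ m := Nat.ceil_le.2 hym
      have hlt' : ⌈y⌉₊ - 1 < m := by omega
      have hv := hX (⌈y⌉₊ - 1) (by omega) hlt'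
      rw [hc1] at hv
      refine ⟨X (⌈y⌉₊ - 1), Finset.mem_image_of_mem _ (Finset.mem_range.2 hlt'), ?_, ?_⟩
      · by_contra hc
        have := monotone_cdf μ (not_le.1 hc).le
        rw [hv, le_div_iff₀ hm0] at this
        linarith
      · rw [hv]
        have : (m : ℝ) * cdf μ x ≤ m * ((⌈y⌉₊ - 1) / m + ε) := by
          rw [mul_add, mul_div_cancel₀ _ hm0.ne']
          nlinarith
        exact le_of_mul_le_mul_left this hm0
    · right
      have h3 : (⌈y⌉₊ : ℝ) ≤ 1 := by exact_mod_cast not_lt.1 hlt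
      have : (m : ℝ) * cdf μ x ≤ m * ε := by nlinarith
      exact le_of_mul_le_mul_left this hm0

/-- **Pólya's theorem**: weak convergence to a law without atoms is uniform convergence of the
distribution functions. -/
lemma tendsto_cdf_uniform {μs : ℕ → ProbabilityMeasure ℝ} {μ : ProbabilityMeasure ℝ}
    (hμ : Tendsto μs atTop (𝓝 μ)) (h : ∀ x, (μ : Measure ℝ) {x} = 0) {ε : ℝ} (hε : 0 < ε) :
    ∀ᶠ n in atTop, ∀ x : ℝ,
      |(μs n : Measure ℝ).real (Set.Iic x) - (μ : Measure ℝ).real (Set.Iic x)| ≤ ε := by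
  obtain ⟨T, hT⟩ := exists_finset_cdf_approx (μ : Measure ℝ) h (half_pos hε)
  have hpt : ∀ x : ℝ, Tendsto (fun n => cdf (μs n : Measure ℝ) x) atTop (𝓝 (cdf (μ : Measure ℝ) x)) := by
    intro x
    have h1 := ProbabilityMeasure.tendsto_measure_of_null_frontier_of_tendsto' hμ
      (E := Set.Iic x) (by rw [frontier_Iic]; exact h x)
    simp_rw [cdf_eq_real]
    exact (ENNReal.tendsto_toReal (measure_ne_top _ _)).comp h1
  have hev : ∀ᶠ n in atTop, ∀ q ∈ T, |cdf (μs n : Measure ℝ) q - cdf (μ : Measure ℝ) q| < ε / 2 := by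
    rw [Filter.eventually_all_finset]
    intro q _
    have := (Metric.tendsto_nhds.1 (hpt q)) (ε / 2) (half_pos hε)
    simpa [Real.dist_eq] using this
  filter_upwards [hev] with n hn x
  rw [← cdf_eq_real, ← cdf_eq_real, abs_le]
  obtain ⟨h1, h2⟩ := hT x
  constructor
  · rcases h2 with ⟨p, hp, hpx, hpF⟩ | h2
    · have := monotone_cdf (μs n : Measure ℝ) hpx
      have := abs_lt.1 (hn p hp)
      linarith [this.1]
    · have := cdf_nonneg (μs n : Measure ℝ) x
      linarith
  · rcases h1 with ⟨q, hq, hqx, hqF⟩ | h1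
    · have := monotone_cdf (μs n : Measure ℝ) hqx
      have := abs_lt.1 (hn q hq)
      linarith [this.2]
    · have := cdf_le_one (μs n : Measure ℝ) x
      linarith

/-! ### Sums of independent copies -/

/-- The law of the sum of `K` independent variables of law `ν`. -/
noncomputable def sumLaw (ν : Measure ℝ) [IsProbabilityMeasure ν] (K : ℕ) : Measure ℝ :=
  (Measure.infinitePi fun _ : ℕ => ν).map fun ω => ∑ i ∈ Finset.range K, ω i

section
variable (ν : Measure ℝ) [IsProbabilityMeasure ν]

lemma hasLaw_eval (i : ℕ) : HasLaw (fun ω : ℕ → ℝ => ω i) ν (Measure.infinitePi fun _ : ℕ => ν) :=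
  (measurePreserving_eval_infinitePi (fun _ : ℕ => ν) i).hasLaw

lemma iIndepFun_eval : iIndepFun (fun i (ω : ℕ → ℝ) => ω i) (Measure.infinitePi fun _ : ℕ => ν) :=
  iIndepFun_infinitePi (X := fun _ x => x) fun _ => measurable_id

instance isProbabilityMeasure_sumLaw (K : ℕ) : IsProbabilityMeasure (sumLaw ν K) :=
  Measure.isProbabilityMeasure_map (by fun_prop)

lemma charFun_sumLaw (K : ℕ) (t : ℝ) : charFun (sumLaw ν K) t = charFun ν t ^ K := by
  rw [sumLaw, ((iIndepFun_eval ν).restrict _).charFun_map_fun_finsetSum_eq_prod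
    fun i _ => (hasLaw_eval ν i).aemeasurable]
  simp [(hasLaw_eval ν _).map_eq]

lemma mgf_sumLaw (K : ℕ) (t : ℝ) : mgf id (sumLaw ν K) t = mgf id ν t ^ K := by
  rw [sumLaw, mgf_id_map (by fun_prop)]
  have h := (iIndepFun_eval ν).mgf_sum (t := t) (fun i => measurable_pi_apply i) (Finset.range K)
  have e : (∑ i ∈ Finset.range K, fun ω : ℕ → ℝ => ω i) = fun ω => ∑ i ∈ Finset.range K, ω i := by
    funext ω; simp
  rw [e] at h
  rw [h]
  have h2 : ∀ i : ℕ, mgf (fun ω : ℕ → ℝ => ω i) (Measure.infinitePi fun _ : ℕ => ν) t = mgf id ν t := by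
    intro i
    rw [← mgf_id_map (hasLaw_eval ν i).aemeasurable, (hasLaw_eval ν i).map_eq]
  simp [h2]

/-- The centred and scaled sum of `K` independent copies. -/
noncomputable def cltLaw (K : ℕ) : Measure ℝ :=
  (sumLaw ν K).map fun x => (Real.sqrt K)⁻¹ * (x - K * ∫ x, x ∂ν)

instance isProbabilityMeasure_cltLaw (K : ℕ) : IsProbabilityMeasure (cltLaw ν K) :=
  Measure.isProbabilityMeasure_map (by fun_prop)

/-- The uniform distance between the distribution functions of the centred and scaled sum and of
the normal law of the same variance. -/
noncomputable def cltError (K : ℕ) : ℝ :=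
  ⨆ x : ℝ, |(cltLaw ν K).real (Set.Iic x)
    - (gaussianReal 0 Var[id; ν].toNNReal).real (Set.Iic x)|

lemma abs_cltLaw_sub_le (K : ℕ) (x : ℝ) : |(cltLaw ν K).real (Set.Iic x)
    - (gaussianReal 0 Var[id; ν].toNNReal).real (Set.Iic x)| ≤ cltError ν K := by
  refine le_ciSup (f := fun x : ℝ => |(cltLaw ν K).real (Set.Iic x)
    - (gaussianReal 0 Var[id; ν].toNNReal).real (Set.Iic x)|) ⟨1, ?_⟩ x
  rintro _ ⟨y, rfl⟩
  simp only
  rw [abs_le]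
  have h1 := measureReal_le_one (μ := cltLaw ν K) (s := Set.Iic y)
  have h2 := measureReal_le_one (μ := gaussianReal 0 Var[id; ν].toNNReal) (s := Set.Iic y)
  have h3 := measureReal_nonneg (μ := cltLaw ν K) (s := Set.Iic y)
  have h4 := measureReal_nonneg (μ := gaussianReal 0 Var[id; ν].toNNReal) (s := Set.Iic y)
  constructor <;> linarith

/-- The central limit theorem on the infinite product gives weak convergence; positive variance
makes the normal limit atomless, so Pólya's theorem makes it uniform. -/
lemma tendsto_cltError (h2 : MemLp id 2 ν) (hv : 0 < Var[id; ν]) :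
    Tendsto (cltError ν) atTop (𝓝 0) := by
  let P := Measure.infinitePi fun _ : ℕ => ν
  have hv' : Var[id; ν].toNNReal ≠ 0 := by
    rw [Ne, Real.toNNReal_eq_zero]; linarith
  have h0 := hasLaw_eval ν 0
  have hvar : Var[fun ω : ℕ → ℝ => ω 0; P] = Var[id; ν] := h0.variance_eq
  have hmean : P[fun ω : ℕ → ℝ => ω 0] = ∫ x, x ∂ν := h0.integral_eq
  have hclt := tendstoInDistribution_inv_sqrt_mul_sum_sub (P := P)
    (P' := gaussianReal 0 Var[id; ν].toNNReal) (Y := id) (X := fun i (ω : ℕ → ℝ) => ω i)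
    (by rw [hvar]; exact HasLaw.id)
    (by
      have : MemLp id 2 (P.map fun ω : ℕ → ℝ => ω 0) := by rw [h0.map_eq]; exact h2
      exact (memLp_map_measure_iff aestronglyMeasurable_id h0.aemeasurable).1 this)
    (iIndepFun_eval ν)
    (fun i => (hasLaw_eval ν i).identDistrib h0)
  have ht := hclt.tendsto
  have hna : ∀ x : ℝ, gaussianReal 0 Var[id; ν].toNNReal {x} = 0 := fun x => by
    have := nullSingletonClass_gaussianReal (μ := 0) hv'
    exact measure_singleton x
  rw [Metric.tendsto_atTop']
  intro ε hε
  have hu := tendsto_cdf_uniform ht (by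
    intro x
    simp only [ProbabilityMeasure.coe_mk, Measure.map_id]
    exact hna x) (half_pos hε)
  obtain ⟨N, hN⟩ := eventually_atTop.1 hu
  refine ⟨N, fun n hn => ?_⟩
  have hN := hN n hn.le
  simp only [ProbabilityMeasure.coe_mk, Measure.map_id] at hN
  have hlaw : P.map (fun ω : ℕ → ℝ => (Real.sqrt n)⁻¹ * (∑ k ∈ Finset.range n, ω k
      - n * P[fun ω : ℕ → ℝ => ω 0])) = cltLaw ν n := by
    rw [cltLaw, sumLaw, Measure.map_map (by fun_prop) (by fun_prop), hmean]
    rfl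
  rw [hlaw] at hN
  have hle : cltError ν n ≤ ε / 2 := ciSup_le hN
  have hge : 0 ≤ cltError ν n := (abs_nonneg _).trans (abs_cltLaw_sub_le ν n 0)
  rw [Real.dist_eq, sub_zero, abs_of_nonneg hge]
  linarith

/-- The normal approximation of a scaled sum of independent copies. -/
lemma abs_real_Iic_sub_gaussian_le {m : Measure ℝ} [IsProbabilityMeasure m] {K : ℕ} (hK : 0 < K)
    {s : ℝ} (hs : 0 < s) (hm : ∀ t, charFun m t = charFun ν (s * t) ^ K) (x : ℝ) :
    |m.real (Set.Iic x) - (gaussianReal 0 Var[id; ν].toNNReal).real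
      (Set.Iic ((Real.sqrt K)⁻¹ * (x / s - K * ∫ x, x ∂ν)))| ≤ cltError ν K := by
  -- Characteristic functions identify `m` as a scaled sum. The normal value to which it is compared
  -- depends on `ν` through mean and variance only, so two laws sharing these are compared with the
  -- same number.
  have hmap : m = (sumLaw ν K).map (fun x => s * x) := by
    refine Measure.ext_of_charFun ?_
    funext t
    rw [charFun_map_mul, charFun_sumLaw, hm]
  have hK' : (0 : ℝ) < K := by exact_mod_cast hK
  have hset : m.real (Set.Iic x) = (cltLaw ν K).real
      (Set.Iic ((Real.sqrt K)⁻¹ * (x / s - K * ∫ x, x ∂ν))) := by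
    rw [hmap, cltLaw, map_measureReal_apply (by fun_prop) measurableSet_Iic,
      map_measureReal_apply (by fun_prop) measurableSet_Iic]
    congr 1
    ext y
    simp only [Set.mem_preimage, Set.mem_Iic]
    rw [mul_le_mul_iff_right₀ (inv_pos.2 (Real.sqrt_pos.2 hK')), sub_le_sub_iff_right,
      le_div_iff₀ hs, mul_comm]
  rw [hset]
  exact abs_cltLaw_sub_le ν K _

end

/-! ### The Gamma law -/

section
variable {a r : ℝ}

lemma toReal_gammaPDF_smul (ha : 0 < a) (hr : 0 < r) (f : ℝ → ℝ) :
    (fun x => (gammaPDF a r x).toReal • f x) = (Set.Ici 0).indicator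
      fun x => r ^ a / Real.Gamma a * x ^ (a - 1) * Real.exp (-(r * x)) * f x := by
  funext x
  rw [gammaPDF, ENNReal.toReal_ofReal (gammaPDFReal_nonneg ha hr x), gammaPDFReal]
  by_cases hx : 0 ≤ x <;> simp [hx]

lemma measurable_gammaPDF (a r : ℝ) : Measurable (gammaPDF a r) :=
  (measurable_gammaPDFReal a r).ennreal_ofReal

lemma integrable_gammaMeasure_iff (ha : 0 < a) (hr : 0 < r) (f : ℝ → ℝ) :
    Integrable f (gammaMeasure a r) ↔ IntegrableOn (fun x => r ^ a / Real.Gamma a * x ^ (a - 1)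
      * Real.exp (-(r * x)) * f x) (Set.Ioi 0) := by
  rw [gammaMeasure, integrable_withDensity_iff_integrable_smul' (measurable_gammaPDF a r)
    (ae_of_all _ fun _ => ENNReal.ofReal_lt_top), toReal_gammaPDF_smul ha hr,
    integrable_indicator_iff measurableSet_Ici, integrableOn_Ici_iff_integrableOn_Ioi]

lemma integral_gammaMeasure (ha : 0 < a) (hr : 0 < r) (f : ℝ → ℝ) :
    ∫ x, f x ∂gammaMeasure a r = ∫ x in Set.Ioi 0, r ^ a / Real.Gamma a * x ^ (a - 1)
      * Real.exp (-(r * x)) * f x := by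
  rw [gammaMeasure, integral_withDensity_eq_integral_toReal_smul (measurable_gammaPDF a r)
    (ae_of_all _ fun _ => ENNReal.ofReal_lt_top), toReal_gammaPDF_smul ha hr,
    integral_indicator measurableSet_Ici, integral_Ici_eq_integral_Ioi]

lemma gammaMeasure_absolutelyContinuous (a r : ℝ) : gammaMeasure a r ≪ volume :=
  withDensity_absolutelyContinuous _ _

lemma gammaMeasure_singleton (x : ℝ) : gammaMeasure a r {x} = 0 :=
  gammaMeasure_absolutelyContinuous a r (measure_singleton x)

lemma ae_gammaMeasure_pos (ha : 0 < a) (hr : 0 < r) : ∀ᵐ x ∂gammaMeasure a r, 0 < x := by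
  have : IsProbabilityMeasure (gammaMeasure a r) := isProbabilityMeasure_gammaMeasure ha hr
  have h0 : gammaMeasure a r (Set.Iio 0) = 0 := by
    rw [gammaMeasure, withDensity_apply _ measurableSet_Iio]
    exact lintegral_gammaPDF_of_nonpos le_rfl
  have h1 : gammaMeasure a r (Set.Iic 0) = 0 := by
    rw [← Set.Iio_union_right]
    exact measure_union_null h0 (gammaMeasure_singleton 0)
  rw [ae_iff]
  convert h1 using 2
  ext x; simp

lemma integrableOn_rpow_mul_exp_neg (ha : 0 < a) (hr : 0 < r) :
    IntegrableOn (fun x : ℝ => x ^ (a - 1) * Real.exp (-(r * x))) (Set.Ioi 0) := by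
  have := integrableOn_rpow_mul_exp_neg_mul_rpow (s := a - 1) (p := 1) (b := r) (by linarith)
    one_pos hr
  simpa using this

lemma gamma_moment (ha : 0 < a) (hr : 0 < r) (k : ℕ) :
    Integrable (fun x : ℝ => x ^ k) (gammaMeasure a r) ∧
    ∫ x, x ^ k ∂gammaMeasure a r = Real.Gamma (a + k) / (Real.Gamma a * r ^ k) := by
  have hak : 0 < a + k := by positivity
  have hG := Real.Gamma_pos_of_pos ha
  have e : ∀ x ∈ Set.Ioi (0 : ℝ), r ^ a / Real.Gamma a * x ^ (a - 1) * Real.exp (-(r * x)) * x ^ k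
      = r ^ a / Real.Gamma a * (x ^ (a + k - 1) * Real.exp (-(r * x))) := by
    intro x (hx : 0 < x)
    rw [show a + (k : ℝ) - 1 = (a - 1) + k by ring, Real.rpow_add hx, Real.rpow_natCast]
    ring
  constructor
  · rw [integrable_gammaMeasure_iff ha hr, integrableOn_congr_fun e measurableSet_Ioi]
    exact (integrableOn_rpow_mul_exp_neg hak hr).const_mul _
  · rw [integral_gammaMeasure ha hr, setIntegral_congr_fun measurableSet_Ioi e, integral_const_mul,
      Real.integral_rpow_mul_exp_neg_mul_Ioi hak hr, Real.rpow_add (by positivity),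
      Real.rpow_natCast, one_div, Real.inv_rpow hr.le, inv_pow]
    have : r ^ a ≠ 0 := (Real.rpow_pos_of_pos hr a).ne'
    field_simp

lemma memLp_gammaMeasure (ha : 0 < a) (hr : 0 < r) : MemLp id 2 (gammaMeasure a r) :=
  (memLp_two_iff_integrable_sq aestronglyMeasurable_id).2 (gamma_moment ha hr 2).1

lemma integral_id_gammaMeasure (ha : 0 < a) (hr : 0 < r) :
    ∫ x, x ∂gammaMeasure a r = a / r := by
  have h := (gamma_moment ha hr 1).2
  have hG := Real.Gamma_pos_of_pos ha
  simp only [pow_one, Nat.cast_one, Real.Gamma_add_one ha.ne'] at h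
  rw [h]; field_simp

lemma variance_id_gammaMeasure (ha : 0 < a) (hr : 0 < r) :
    Var[id; gammaMeasure a r] = a / r ^ 2 := by
  have : IsProbabilityMeasure (gammaMeasure a r) := isProbabilityMeasure_gammaMeasure ha hr
  have h := (gamma_moment ha hr 2).2
  have hG := Real.Gamma_pos_of_pos ha
  rw [Nat.cast_ofNat, show a + 2 = (a + 1) + 1 by ring, Real.Gamma_add_one (by positivity),
    Real.Gamma_add_one ha.ne'] at h
  rw [variance_eq_sub (memLp_gammaMeasure ha hr)]
  have h1 : ∫ x, id x ∂gammaMeasure a r = a / r := integral_id_gammaMeasure ha hr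
  have h2 : ∫ x, (id ^ 2 : ℝ → ℝ) x ∂gammaMeasure a r = ∫ x, x ^ 2 ∂gammaMeasure a r := rfl
  rw [h1, h2, h]
  field_simp
  ring

lemma mgf_gammaMeasure (ha : 0 < a) (hr : 0 < r) {t : ℝ} (ht : t < r) :
    Integrable (fun x => Real.exp (t * x)) (gammaMeasure a r) ∧
    mgf id (gammaMeasure a r) t = (1 - t / r) ^ (-a) := by
  have hrt : 0 < r - t := by linarith
  have hG := Real.Gamma_pos_of_pos ha
  have e : ∀ x ∈ Set.Ioi (0 : ℝ), r ^ a / Real.Gamma a * x ^ (a - 1) * Real.exp (-(r * x))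
        * Real.exp (t * x)
      = r ^ a / Real.Gamma a * (x ^ (a - 1) * Real.exp (-((r - t) * x))) := by
    intro x _
    rw [mul_assoc _ (Real.exp _), ← Real.exp_add, mul_assoc]
    congr 3
    ring
  constructor
  · rw [integrable_gammaMeasure_iff ha hr, integrableOn_congr_fun e measurableSet_Ioi]
    exact (integrableOn_rpow_mul_exp_neg ha hrt).const_mul _
  · simp only [mgf, id]
    rw [integral_gammaMeasure ha hr, setIntegral_congr_fun measurableSet_Ioi e, integral_const_mul,
      Real.integral_rpow_mul_exp_neg_mul_Ioi ha hrt]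
    have h1 : 1 - t / r = (r - t) / r := by field_simp
    rw [h1, Real.rpow_neg (by positivity), Real.div_rpow hrt.le hr.le, one_div,
      Real.inv_rpow hrt.le]
    field_simp

/-- The integral diverges and therefore has value 0 by convention: if it were finite, it would
dominate `(1 - s/r)^{-a}` for all `s < r`, which is unbounded as `s` approaches `r`. -/
lemma mgf_gammaMeasure_of_le (ha : 0 < a) (hr : 0 < r) {t : ℝ} (ht : r ≤ t) :
    mgf id (gammaMeasure a r) t = 0 := by
  by_contra hne
  have hint : Integrable (fun x => Real.exp (t * x)) (gammaMeasure a r) := by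
    by_contra h
    exact hne (integral_undef h)
  have hle : ∀ s < r, (1 - s / r) ^ (-a) ≤ mgf id (gammaMeasure a r) t := by
    intro s hs
    rw [← (mgf_gammaMeasure ha hr hs).2]
    refine integral_mono_ae (mgf_gammaMeasure ha hr hs).1 hint ?_
    filter_upwards [ae_gammaMeasure_pos ha hr] with x hx
    simp only [id]
    gcongr
    linarith
  have hlim : Tendsto (fun y : ℝ => y ^ (-a)) (𝓝[>] 0) atTop := tendsto_rpow_neg_nhdsGT_zero (by linarith)
  obtain ⟨y, hy, hy0⟩ := ((hlim.eventually_gt_atTop (mgf id (gammaMeasure a r) t)).and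
    self_mem_nhdsWithin).exists
  have hy0 : 0 < y := hy0
  have := hle (r * (1 - y)) (by nlinarith)
  rw [mul_div_cancel_left₀ _ hr.ne', sub_sub_cancel] at this
  linarith

lemma zero_mem_interior_integrableExpSet_gammaMeasure (ha : 0 < a) (hr : 0 < r) :
    (0 : ℝ) ∈ interior (integrableExpSet id (gammaMeasure a r)) := by
  refine mem_interior.2 ⟨Set.Iio r, fun t ht => (mgf_gammaMeasure ha hr ht).1, isOpen_Iio, hr⟩

/-- A scaled sum of independent Gamma variables of the same rate is a Gamma variable. -/
lemma charFun_gammaMeasure_mul {c : ℝ} (hc : 0 < c) (hr : 0 < r) {s : ℝ} (hs : 0 < s) {K : ℕ}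
    (hK : 0 < K) (t : ℝ) :
    charFun (gammaMeasure (K * c) (r / s)) t = charFun (gammaMeasure c r) (s * t) ^ K := by
  have hK' : (0 : ℝ) < K := by exact_mod_cast hK
  have ha : 0 < K * c := by positivity
  have hrs : 0 < r / s := by positivity
  have hp1 : IsProbabilityMeasure (gammaMeasure c r) := isProbabilityMeasure_gammaMeasure hc hr
  have hp2 : IsProbabilityMeasure (gammaMeasure (K * c) (r / s)) :=
    isProbabilityMeasure_gammaMeasure ha hrs
  -- The two functions agree on all of `ℝ`: in the divergent range both vanish, as `K > 0`. Since 0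
  -- is interior to the domain of convergence, analytic continuation carries the equality to the
  -- imaginary axis.
  have hmgf : mgf id (gammaMeasure (K * c) (r / s))
      = mgf (fun x => s * x) (sumLaw (gammaMeasure c r) K) := by
    funext t
    have h1 : mgf (fun x => s * x) (sumLaw (gammaMeasure c r) K) t
        = mgf id (sumLaw (gammaMeasure c r) K) (s * t) := by
      simp only [mgf, id]
      congr 1
      funext x
      congr 1
      ring
    rw [h1, mgf_sumLaw]
    rcases lt_or_ge t (r / s) with ht | ht
    · have ht' : s * t < r := by rw [lt_div_iff₀ hs] at ht; linarith
      rw [(mgf_gammaMeasure ha hrs ht).2, (mgf_gammaMeasure hc hr ht').2, ← Real.rpow_natCast,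
        ← Real.rpow_mul]
      · congr 1
        · field_simp
        · ring
      · rw [sub_nonneg, div_le_one hr]; exact ht'.le
    · have ht' : r ≤ s * t := by rw [div_le_iff₀ hs] at ht; linarith
      rw [mgf_gammaMeasure_of_le ha hrs ht, mgf_gammaMeasure_of_le hc hr ht', zero_pow hK.ne']
  have h2 := eqOn_complexMGF_of_mgf hmgf (x := (t : ℂ) * Complex.I)
    (by simpa using zero_mem_interior_integrableExpSet_gammaMeasure ha hrs)
  rw [complexMGF_id_mul_I, complexMGF_mul_I (by fun_prop), charFun_map_mul, charFun_sumLaw] at h2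
  exact h2

end

/-! ### The law of a single cascade term -/

/-- The gain `|h_sr h_rn|` of a cascaded link of unit mean gains, as a function of the scattered
components. -/
noncomputable def unitGain (κ : ℝ) (p : ℂ × ℂ) : ℝ := ‖rician κ 1 p.1‖ * ‖rician κ 1 p.2‖

@[fun_prop]
lemma measurable_rician (κ α : ℝ) : Measurable (rician κ α) := by
  unfold rician; fun_prop

lemma measurable_norm_rician (κ α : ℝ) : Measurable fun w => ‖rician κ α w‖ := by
  fun_prop

@[fun_prop]
lemma measurable_unitGain (κ : ℝ) : Measurable (unitGain κ) := by
  unfold unitGain rician; fun_prop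

/-- The law of the gain of a cascaded link of unit mean gains. -/
noncomputable def unitGainLaw (κ : ℝ) : Measure ℝ :=
  ((complexNormal 1).prod (complexNormal 1)).map (unitGain κ)

instance isProbabilityMeasure_unitGainLaw (κ : ℝ) : IsProbabilityMeasure (unitGainLaw κ) :=
  Measure.isProbabilityMeasure_map (by fun_prop)

/-- The mean gain of a cascaded link of unit mean gains. -/
noncomputable def unitMean (κ : ℝ) : ℝ := Real.pi / (4 * (1 + κ)) * laguerreHalf (-κ) ^ 2

lemma norm_rician_eq (κ α : ℝ) (w : ℂ) :
    ‖rician κ α w‖ = Real.sqrt α * ‖rician κ 1 w‖ := by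
  simp [rician, abs_of_nonneg (Real.sqrt_nonneg α)]

lemma memLp_unitGainLaw {κ : ℝ} (hκ : 0 ≤ κ) : MemLp id 2 (unitGainLaw κ) := by
  rw [unitGainLaw, memLp_map_measure_iff aestronglyMeasurable_id (by fun_prop), Function.id_comp,
    memLp_two_iff_integrable_sq (by fun_prop)]
  simp only [unitGain, mul_pow]
  have h := (memLp_two_iff_integrable_sq
    (measurable_norm_rician κ 1).aestronglyMeasurable).1 (memLp_norm_rician (κ := κ) hκ one_pos)
  exact h.mul_prod h

lemma integral_unitGainLaw {κ : ℝ} (hκ : 0 ≤ κ) : ∫ x, x ∂unitGainLaw κ = unitMean κ := by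
  have hk : 0 < κ + 1 := by linarith
  rw [unitGainLaw, integral_map (by fun_prop) (by fun_prop)]
  simp only [unitGain]
  rw [integral_prod_mul (fun w => ‖rician κ 1 w‖) (fun w => ‖rician κ 1 w‖),
    integral_norm_rician hκ one_pos, unitMean]
  have h1 : Real.sqrt (1 / (κ + 1)) ^ 2 = 1 / (κ + 1) := Real.sq_sqrt (by positivity)
  have h2 : Real.sqrt Real.pi ^ 2 = Real.pi := Real.sq_sqrt Real.pi_pos.le
  calc _ = Real.sqrt (1 / (κ + 1)) ^ 2 * (Real.sqrt Real.pi ^ 2 / 4 * laguerreHalf (-κ) ^ 2) := by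
        ring
    _ = _ := by rw [h1, h2]; field_simp; ring

lemma variance_unitGainLaw {κ : ℝ} (hκ : 0 ≤ κ) : Var[id; unitGainLaw κ] = 1 - unitMean κ ^ 2 := by
  rw [variance_eq_sub (memLp_unitGainLaw hκ)]
  simp only [id_eq, integral_unitGainLaw hκ]
  congr 1
  change ∫ x, x ^ 2 ∂unitGainLaw κ = 1
  rw [unitGainLaw, integral_map (by fun_prop) (by fun_prop)]
  simp only [unitGain, mul_pow]
  rw [integral_prod_mul (fun w => ‖rician κ 1 w‖ ^ 2) (fun w => ‖rician κ 1 w‖ ^ 2),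
    integral_norm_rician_sq hκ one_pos, mul_one]

lemma unitMean_pos {κ : ℝ} (hκ : 0 ≤ κ) : 0 < unitMean κ := by
  have := laguerreHalf_pos hκ
  have := Real.pi_pos
  unfold unitMean
  positivity

lemma unitMean_sq_lt {κ : ℝ} (hκ : 0 ≤ κ) : 0 < 1 - unitMean κ ^ 2 := by
  have h1 := unitMean_pos hκ
  have h2 : unitMean κ < 1 := laguerreHalf_sq_lt hκ
  nlinarith

/-! ### The parameters of the matched Gamma law -/

namespace Params
variable {S : Params}

/-- The scale `√(α_sr α_rn)` of the cascade terms. -/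
noncomputable def cascadeScale (S : Params) : ℝ := Real.sqrt (S.αsr * S.αrn)

lemma cascadeScale_pos (hS : S.Valid) : 0 < S.cascadeScale :=
  Real.sqrt_pos.2 (mul_pos hS.αsr_pos hS.αrn_pos)

lemma μn_eq (S : Params) : S.μn = S.cascadeScale * unitMean S.κ := by
  rw [μn, cascadeScale, unitMean, add_comm 1 S.κ]; ring

lemma Ωn_eq (hS : S.Valid) : S.Ωn = S.cascadeScale ^ 2 * (1 - unitMean S.κ ^ 2) := by
  have := hS.κ_nonneg
  have hk : 0 < 1 + S.κ := by linarith
  rw [Ωn, cascadeScale, Real.sq_sqrt (mul_pos hS.αsr_pos hS.αrn_pos).le, unitMean]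
  field_simp
  ring

lemma μn_pos (hS : S.Valid) : 0 < S.μn := by
  rw [μn_eq]; exact mul_pos (cascadeScale_pos hS) (unitMean_pos hS.κ_nonneg)

lemma Ωn_pos (hS : S.Valid) : 0 < S.Ωn := by
  rw [Ωn_eq hS]
  exact mul_pos (pow_pos (cascadeScale_pos hS) 2) (unitMean_sq_lt hS.κ_nonneg)

lemma ϕn_pos (hS : S.Valid) : 0 < S.ϕn := div_pos (Ωn_pos hS) (μn_pos hS)

lemma φn_add_one_pos (hS : S.Valid) : 0 < S.φn + 1 := by
  have hK : (0 : ℝ) < S.K := by exact_mod_cast hS.K_pos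
  have := μn_pos hS
  have := Ωn_pos hS
  rw [φn, sub_add_cancel]; positivity

/-- The link gains enter only as a scale dividing the rate, and `K` only as a factor of the shape.
This exhibits the law as a scaled `K`-fold sum of Gamma variables determined by `κ`. -/
lemma gammaLaw_eq (hS : S.Valid) : S.gammaLaw =
    gammaMeasure (S.K * (unitMean S.κ ^ 2 / (1 - unitMean S.κ ^ 2)))
      (unitMean S.κ / (1 - unitMean S.κ ^ 2) / S.cascadeScale) := by
  have h1 := (cascadeScale_pos hS).ne'
  have h2 := (unitMean_pos hS.κ_nonneg).ne'
  have h3 := (unitMean_sq_lt hS.κ_nonneg).ne'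
  rw [gammaLaw, φn, ϕn, Ωn_eq hS, μn_eq, sub_add_cancel]
  congr 1 <;> field_simp

lemma isProbabilityMeasure_gammaLaw (hS : S.Valid) : IsProbabilityMeasure S.gammaLaw :=
  isProbabilityMeasure_gammaMeasure (φn_add_one_pos hS) (one_div_pos.2 (ϕn_pos hS))

lemma integral_gammaLaw (hS : S.Valid) : ∫ x, x ∂S.gammaLaw = S.K * S.μn := by
  have := (μn_pos hS).ne'
  have := (Ωn_pos hS).ne'
  rw [gammaLaw, integral_id_gammaMeasure (φn_add_one_pos hS) (one_div_pos.2 (ϕn_pos hS)), φn, ϕn]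
  field_simp
  ring

lemma variance_gammaLaw (hS : S.Valid) : Var[id; S.gammaLaw] = S.K * S.Ωn := by
  have := (μn_pos hS).ne'
  have := (Ωn_pos hS).ne'
  rw [gammaLaw, variance_id_gammaMeasure (φn_add_one_pos hS) (one_div_pos.2 (ϕn_pos hS)), φn, ϕn]
  field_simp
  ring

end Params

/-- The laws with the characteristic function of the cascade sum are uniformly close to the matched
Gamma law, for a large number of reflecting elements. -/
lemma exists_cascade_error {κ : ℝ} (hκ : 0 ≤ κ) : ∃ δ : ℕ → ℝ, Tendsto δ atTop (𝓝 0) ∧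
    ∀ S : Params, S.Valid → S.κ = κ → ∀ (m : Measure ℝ) [IsProbabilityMeasure m],
      (∀ t, charFun m t = charFun (unitGainLaw κ) (S.cascadeScale * t) ^ S.K) →
      ∀ x, |m.real (Set.Iic x) - S.gammaLaw.real (Set.Iic x)| ≤ δ S.K := by
  have hμ := unitMean_pos hκ
  have hv := unitMean_sq_lt hκ
  have hc : 0 < unitMean κ ^ 2 / (1 - unitMean κ ^ 2) := by positivity
  have hr : 0 < unitMean κ / (1 - unitMean κ ^ 2) := by positivity
  have hp := isProbabilityMeasure_gammaMeasure hc hr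
  have hvar : Var[id; gammaMeasure (unitMean κ ^ 2 / (1 - unitMean κ ^ 2))
      (unitMean κ / (1 - unitMean κ ^ 2))] = 1 - unitMean κ ^ 2 := by
    rw [variance_id_gammaMeasure hc hr]; field_simp
  have hmean : ∫ x, x ∂gammaMeasure (unitMean κ ^ 2 / (1 - unitMean κ ^ 2))
      (unitMean κ / (1 - unitMean κ ^ 2)) = unitMean κ := by
    rw [integral_id_gammaMeasure hc hr]; field_simp
  -- Triangle inequality through the common normal value: the Rician and Gamma summands have the
  -- same mean `unitMean κ` and variance `1 - unitMean κ ^ 2`.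
  refine ⟨fun K => cltError (unitGainLaw κ) K + cltError (gammaMeasure
    (unitMean κ ^ 2 / (1 - unitMean κ ^ 2)) (unitMean κ / (1 - unitMean κ ^ 2))) K, ?_, ?_⟩
  · have h1 := tendsto_cltError (unitGainLaw κ) (memLp_unitGainLaw hκ)
      (by rw [variance_unitGainLaw hκ]; exact hv)
    have h2 := tendsto_cltError (gammaMeasure (unitMean κ ^ 2 / (1 - unitMean κ ^ 2))
      (unitMean κ / (1 - unitMean κ ^ 2))) (memLp_gammaMeasure hc hr) (by rw [hvar]; exact hv)
    simpa using h1.add h2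
  · rintro S hS rfl m hm hchar x
    have hs := S.cascadeScale_pos hS
    have hpg := Params.isProbabilityMeasure_gammaLaw hS
    have h1 := abs_real_Iic_sub_gaussian_le _ hS.K_pos hs hchar x
    have h2 := abs_real_Iic_sub_gaussian_le (m := S.gammaLaw) _ hS.K_pos hs (fun t => by
      rw [Params.gammaLaw_eq hS]; exact charFun_gammaMeasure_mul hc hr hs hS.K_pos t) x
    rw [hvar, hmean] at h2
    rw [variance_unitGainLaw hκ, integral_unitGainLaw hκ] at h1
    rw [abs_sub_comm] at h2
    exact (abs_sub_le _ _ _).trans (add_le_add h1 h2)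

/-! ### The cascade sum -/

namespace Fading
variable {Ω : Type*} {K : ℕ}

/-- The gain of the `k`-th cascaded link, for unit mean gains. -/
noncomputable def linkGain (κ : ℝ) (F : Fading K Ω) (k : Fin K) (ω : Ω) : ℝ :=
  unitGain κ (F.wsr k ω, F.wrn k ω)

lemma cascade_eq {S : Params} (hS : S.Valid) (F : Fading S.K Ω) (ω : Ω) :
    F.cascade S ω = S.cascadeScale * ∑ k, F.linkGain S.κ k ω := by
  rw [cascade, Finset.mul_sum]
  refine Finset.sum_congr rfl fun k _ => ?_
  rw [norm_mul, hsr, hrn, norm_rician_eq, norm_rician_eq S.κ S.αrn, linkGain, unitGain,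
    Params.cascadeScale, Real.sqrt_mul']
  · ring
  · exact hS.αrn_pos.le

variable [MeasurableSpace Ω] {P : Measure Ω} {F : Fading K Ω} {ΩI : ℝ}

namespace IsRician

lemma aemeasurable (h : F.IsRician P ΩI) (i : Fin 2 ⊕ (Fin K ⊕ Fin K)) :
    AEMeasurable (Sum.elim ![F.wsn, F.hI] (Sum.elim F.wsr F.wrn) i) P := by
  rcases i with i | i | i
  · fin_cases i
    · exact h.law_sn.aemeasurable
    · exact h.law_I.aemeasurable
  · exact (h.law_sr i).aemeasurable
  · exact (h.law_rn i).aemeasurable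

lemma hasLaw_linkGain [IsProbabilityMeasure P] (h : F.IsRician P ΩI) (κ : ℝ) (k : Fin K) :
    HasLaw (F.linkGain κ k) (unitGainLaw κ) P := by
  have hi : IndepFun (F.wsr k) (F.wrn k) P :=
    h.indep.indepFun (i := Sum.inr (Sum.inl k)) (j := Sum.inr (Sum.inr k)) (by simp)
  have h1 := hi.hasLaw_prod (h.law_sr k) (h.law_rn k)
  exact HasLaw.comp ⟨by fun_prop, rfl⟩ h1

lemma indepFun_linkGain (h : F.IsRician P ΩI) (κ : ℝ) {j k : Fin K} (hjk : j ≠ k) :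
    IndepFun (F.linkGain κ j) (F.linkGain κ k) P :=
  (h.indep.indepFun_prodMk_prodMk₀ h.aemeasurable (Sum.inr (Sum.inl j)) (Sum.inr (Sum.inr j))
    (Sum.inr (Sum.inl k)) (Sum.inr (Sum.inr k)) (by simpa using hjk) (by simp) (by simp)
    (by simpa using hjk)).comp (measurable_unitGain κ) (measurable_unitGain κ)

/-- A cascaded link is independent of the sum of other cascaded links. -/
lemma indepFun_linkGain_sum (h : F.IsRician P ΩI) (κ : ℝ) {k : Fin K} {s : Finset (Fin K)}
    (hk : k ∉ s) : IndepFun (F.linkGain κ k) (fun ω => ∑ j ∈ s, F.linkGain κ j ω) P := by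
  let A : Finset (Fin 2 ⊕ (Fin K ⊕ Fin K)) := {Sum.inr (Sum.inl k), Sum.inr (Sum.inr k)}
  let B : Finset (Fin 2 ⊕ (Fin K ⊕ Fin K)) :=
    s.image (fun j => Sum.inr (Sum.inl j)) ∪ s.image (fun j => Sum.inr (Sum.inr j))
  have hAB : Disjoint A B := by
    simp only [A, B, Finset.disjoint_left]
    intro x hx hx'
    simp only [Finset.mem_insert, Finset.mem_singleton, Finset.mem_union, Finset.mem_image] at hx hx'
    rcases hx with rfl | rfl <;> rcases hx' with ⟨j, hj, e⟩ | ⟨j, hj, e⟩ <;> simp at e <;>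
      exact hk (e ▸ hj)
  have hB1 : ∀ j ∈ s, Sum.inr (Sum.inl j) ∈ B := fun j hj =>
    Finset.mem_union_left _ (Finset.mem_image_of_mem _ hj)
  have hB2 : ∀ j ∈ s, Sum.inr (Sum.inr j) ∈ B := fun j hj =>
    Finset.mem_union_right _ (Finset.mem_image_of_mem _ hj)
  have hi := h.indep.indepFun_finset₀ A B hAB h.aemeasurable
  have hφ : Measurable fun g : A → ℂ => unitGain κ
      (g ⟨Sum.inr (Sum.inl k), by simp [A]⟩, g ⟨Sum.inr (Sum.inr k), by simp [A]⟩) := by fun_prop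
  have hψ : Measurable fun g : B → ℂ => ∑ j ∈ s.attach, unitGain κ
      (g ⟨Sum.inr (Sum.inl j.1), hB1 j.1 j.2⟩, g ⟨Sum.inr (Sum.inr j.1), hB2 j.1 j.2⟩) := by fun_prop
  have h2 := hi.comp hφ hψ
  have e : (fun ω => ∑ j ∈ s, F.linkGain κ j ω) = fun ω => ∑ j ∈ s.attach, F.linkGain κ j.1 ω := by
    funext ω; exact (Finset.sum_attach s fun j => F.linkGain κ j ω).symm
  rw [e]
  exact h2

lemma charFun_sum_linkGain [IsProbabilityMeasure P] (h : F.IsRician P ΩI) (κ t : ℝ) (s : Finset (Fin K)) :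
    charFun (P.map fun ω => ∑ j ∈ s, F.linkGain κ j ω) t = charFun (unitGainLaw κ) t ^ s.card := by
  classical
  induction s using Finset.induction_on with
  | empty => simp
  | insert a s ha ih =>
    have hm : ∀ j, AEMeasurable (F.linkGain κ j) P := fun j => (h.hasLaw_linkGain κ j).aemeasurable
    simp_rw [Finset.sum_insert ha]
    rw [(h.indepFun_linkGain_sum κ ha).charFun_map_fun_add_eq_mul (hm a)
      (Finset.aemeasurable_fun_sum s fun j _ => hm j), Pi.mul_apply, ih,
      (h.hasLaw_linkGain κ a).map_eq, Finset.card_insert_of_notMem ha, pow_succ']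

end IsRician

section
variable [IsProbabilityMeasure P] {S : Params} {F : Fading S.K Ω}

lemma aemeasurable_cascade (h : F.IsRician P ΩI) (hS : S.Valid) : AEMeasurable (F.cascade S) P := by
  rw [funext (cascade_eq hS F)]
  exact (Finset.aemeasurable_fun_sum _ fun j _ =>
    (h.hasLaw_linkGain S.κ j).aemeasurable).const_mul _

lemma charFun_cascade (h : F.IsRician P ΩI) (hS : S.Valid) (t : ℝ) :
    charFun (P.map (F.cascade S)) t
      = charFun (unitGainLaw S.κ) (S.cascadeScale * t) ^ S.K := by
  have hm : AEMeasurable (fun ω => ∑ k, F.linkGain S.κ k ω) P := Finset.aemeasurable_fun_sum _ fun j _ =>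
    (h.hasLaw_linkGain S.κ j).aemeasurable
  have e : F.cascade S = (fun x => S.cascadeScale * x) ∘ fun ω => ∑ k, F.linkGain S.κ k ω :=
    funext (cascade_eq hS F)
  rw [e, ← AEMeasurable.map_map_of_aemeasurable (by fun_prop) hm, charFun_map_mul,
    h.charFun_sum_linkGain]
  simp

lemma memLp_linkGain (h : F.IsRician P ΩI) (hS : S.Valid) (k : Fin S.K) :
    MemLp (F.linkGain S.κ k) 2 P := by
  have hl := h.hasLaw_linkGain S.κ k
  have := memLp_unitGainLaw hS.κ_nonneg
  rw [← hl.map_eq, memLp_map_measure_iff aestronglyMeasurable_id hl.aemeasurable] at this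
  exact this

lemma memLp_cascade (h : F.IsRician P ΩI) (hS : S.Valid) : MemLp (F.cascade S) 2 P := by
  rw [funext (cascade_eq hS F)]
  exact (memLp_finsetSum _ fun k _ => memLp_linkGain h hS k).const_mul _

lemma integral_cascade (h : F.IsRician P ΩI) (hS : S.Valid) :
    P[F.cascade S] = S.K * S.μn := by
  simp_rw [cascade_eq hS F]
  rw [integral_const_mul, integral_finsetSum _ fun k _ => (memLp_linkGain h hS k).integrable one_le_two]
  simp_rw [fun k => (h.hasLaw_linkGain S.κ k).integral_eq, integral_unitGainLaw hS.κ_nonneg]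
  simp [S.μn_eq]
  ring

lemma variance_cascade (h : F.IsRician P ΩI) (hS : S.Valid) :
    Var[F.cascade S; P] = S.K * S.Ωn := by
  have e : F.cascade S = fun ω => S.cascadeScale * (∑ k, F.linkGain S.κ k) ω := by
    funext ω; rw [cascade_eq hS F]; simp
  rw [e, variance_const_mul, IndepFun.variance_sum (fun k _ => memLp_linkGain h hS k)
    fun j _ k _ hjk => h.indepFun_linkGain S.κ hjk]
  have e2 : ∀ k, Var[F.linkGain S.κ k; P] = 1 - unitMean S.κ ^ 2 := fun k => by
    rw [(h.hasLaw_linkGain S.κ k).variance_eq, variance_unitGainLaw hS.κ_nonneg]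
  simp_rw [e2]
  simp [Params.Ωn_eq hS]
  ring

/-- The direct link, the residual interference and the cascade sum are independent. -/
lemma hasLaw_direct_cascade (h : F.IsRician P ΩI) (hS : S.Valid) :
    HasLaw (fun ω => ((F.wsn ω, F.hI ω), F.cascade S ω))
      (((complexNormal 1).prod (complexNormal ΩI)).prod (P.map (F.cascade S))) P := by
  have h1 : HasLaw (fun ω => (F.wsn ω, F.hI ω)) ((complexNormal 1).prod (complexNormal ΩI)) P :=
    IndepFun.hasLaw_prod (h.law_sn) (h.law_I)
      (h.indep.indepFun (i := Sum.inl 0) (j := Sum.inl 1) (by simp))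
  refine IndepFun.hasLaw_prod h1 ⟨aemeasurable_cascade h hS, rfl⟩ ?_
  let A : Finset (Fin 2 ⊕ (Fin S.K ⊕ Fin S.K)) := Finset.univ.image Sum.inl
  let B : Finset (Fin 2 ⊕ (Fin S.K ⊕ Fin S.K)) := Finset.univ.image Sum.inr
  have hAB : Disjoint A B := by
    simp only [A, B, Finset.disjoint_left]
    intro x hx hx'
    simp only [Finset.mem_image, Finset.mem_univ, true_and] at hx hx'
    obtain ⟨i, rfl⟩ := hx
    simp at hx'
  have hi := h.indep.indepFun_finset₀ A B hAB h.aemeasurable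
  have hφ : Measurable fun g : A → ℂ => (g ⟨Sum.inl 0, by simp [A]⟩, g ⟨Sum.inl 1, by simp [A]⟩) := by
    fun_prop
  have hψ : Measurable fun g : B → ℂ => S.cascadeScale * ∑ j, unitGain S.κ
      (g ⟨Sum.inr (Sum.inl j), by simp [B]⟩, g ⟨Sum.inr (Sum.inr j), by simp [B]⟩) := by fun_prop
  rw [funext (cascade_eq hS F)]
  exact hi.comp hφ hψ

end

end Fading

/-! ### Coherent phase shifting -/

/-- Reduction to `[0, 2π)` changes the exponent by an integer multiple of `2πi`, and the shift
replaces the phase of `z` by `a`. For `z = 0` both sides vanish. -/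
lemma exp_coherent_mul (z : ℂ) (a : ℝ) :
    Complex.exp (Complex.I * ((toIcoMod Real.two_pi_pos 0 (a - Complex.arg z) : ℝ) : ℂ)) * z
      = ‖z‖ * Complex.exp (a * Complex.I) := by
  have h : toIcoMod Real.two_pi_pos 0 (a - Complex.arg z)
      = a - Complex.arg z - toIcoDiv Real.two_pi_pos 0 (a - Complex.arg z) * (2 * Real.pi) := by
    rw [← self_sub_toIcoDiv_zsmul, zsmul_eq_mul]
  conv_lhs => rw [h, ← Complex.norm_mul_exp_arg_mul_I z]
  rw [mul_left_comm, ← Complex.exp_add]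
  congr 1
  rw [Complex.exp_eq_exp_iff_exists_int]
  refine ⟨-toIcoDiv Real.two_pi_pos 0 (a - Complex.arg z), ?_⟩
  push_cast
  rw [Complex.norm_mul_exp_arg_mul_I z]
  ring

/-- All summands share the phase of the direct link, so their moduli add. A vanishing direct link is
no exception: any common phase serves. -/
lemma Fading.norm_endToEnd {S : Params} {Ω : Type*} (F : Fading S.K Ω) (ω : Ω) :
    ‖F.endToEnd S ω‖ = ‖F.hsn S ω‖ + F.cascade S ω := by
  have e : F.endToEnd S ω
      = ((‖F.hsn S ω‖ + F.cascade S ω : ℝ) : ℂ) * Complex.exp (Complex.arg (F.hsn S ω) * Complex.I) := by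
    have h1 : dotProduct (star fun k => star (F.hrn S k ω))
        (Matrix.mulVec (F.reflectingMatrix S ω) fun k => star (F.hsr S k ω))
        = ∑ k, ((‖F.hsr S k ω * F.hrn S k ω‖ : ℝ) : ℂ)
          * Complex.exp (Complex.arg (F.hsn S ω) * Complex.I) := by
      refine Finset.sum_congr rfl fun k _ => ?_
      have h2 := exp_coherent_mul (F.hrn S k ω * star (F.hsr S k ω)) (Complex.arg (F.hsn S ω))
      have h3 : ‖F.hrn S k ω * star (F.hsr S k ω)‖ = ‖F.hsr S k ω * F.hrn S k ω‖ := by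
        rw [norm_mul, norm_mul, norm_star, mul_comm]
      rw [← h3, ← h2, reflectingMatrix, Matrix.mulVec_diagonal, Pi.star_apply, star_star,
        Real.sqrt_one, Complex.ofReal_one, one_mul, coherentPhase]
      ring
    rw [endToEnd, h1, cascade, Complex.ofReal_add, Complex.ofReal_sum, add_mul, Finset.sum_mul,
      Complex.norm_mul_exp_arg_mul_I]
  have h0 : 0 ≤ ‖F.hsn S ω‖ + F.cascade S ω :=
    add_nonneg (norm_nonneg _) (Finset.sum_nonneg fun k _ => norm_nonneg _)
  rw [e, norm_mul, Complex.norm_exp_ofReal_mul_I, mul_one, Complex.norm_real, Real.norm_of_nonneg h0]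

/-! ### The outage event -/

namespace Params

/-- The outage probability when the cascade sum has law `m` and is independent of the direct link
and of the residual interference. -/
noncomputable def outageOfLaw (S : Params) (m : Measure ℝ) : ℝ :=
  S.outage (((complexNormal 1).prod (complexNormal S.ΩI)).prod m) 1
    (fun p : (ℂ × ℂ) × ℝ => (‖rician S.κ S.αsn p.1.1‖ + p.2) ^ 2)
    (fun p : (ℂ × ℂ) × ℝ => ‖p.1.2‖ ^ 2)

@[fun_prop]
lemma measurable_sinrNM (S : Params) : Measurable S.sinrNM := by
  unfold sinrNM; fun_prop

lemma measurableSet_second_outage (S : Params) : MeasurableSet {p : (ℂ × ℂ) × ℝ |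
    S.sinrNM ((‖rician S.κ S.αsn p.1.1‖ + p.2) ^ 2) > S.γthm ∧
      S.sinrN 1 ((‖rician S.κ S.αsn p.1.1‖ + p.2) ^ 2) (‖p.1.2‖ ^ 2) < S.γthn} := by
  unfold sinrN
  rw [Set.ofPred_and]
  refine MeasurableSet.inter ?_ ?_
  · exact measurableSet_lt (by fun_prop) (by fun_prop)
  · exact measurableSet_lt (by fun_prop) (by fun_prop)

lemma gammaOutage_eq (S : Params) : S.gammaOutage 1 = S.outageOfLaw S.gammaLaw := rfl

lemma outageProb_eq {S : Params} (hS : S.Valid) {Ω : Type*} [MeasurableSpace Ω] {P : Measure Ω}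
    [IsProbabilityMeasure P] {F : Fading S.K Ω} (h : F.IsRician P S.ΩI) :
    F.outageProb S P 1 = S.outageOfLaw (P.map (F.cascade S)) := by
  have hl := Fading.hasLaw_direct_cascade h hS
  have h1 := hl.measureReal_eq
    (p := fun p => S.sinrNM ((‖rician S.κ S.αsn p.1.1‖ + p.2) ^ 2) < S.γthm)
    (measurableSet_lt (by fun_prop) measurable_const)
  have h2 := hl.measureReal_eq
    (p := fun p => S.sinrNM ((‖rician S.κ S.αsn p.1.1‖ + p.2) ^ 2) > S.γthm ∧
      S.sinrN 1 ((‖rician S.κ S.αsn p.1.1‖ + p.2) ^ 2) (‖p.1.2‖ ^ 2) < S.γthn)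
    S.measurableSet_second_outage
  simp only [Fading.outageProb, outage, outageOfLaw, Fading.norm_endToEnd, Fading.hsn]
  rw [← h1, ← h2]

variable {S : Params}

lemma γthn_pos (hS : S.Valid) : 0 < S.γthn :=
  sub_pos.2 (Real.one_lt_rpow one_lt_two hS.Rn_pos)

lemma γthm_pos (hS : S.Valid) : 0 < S.γthm :=
  sub_pos.2 (Real.one_lt_rpow one_lt_two hS.Rm_pos)

lemma β_pos (hS : S.Valid) : 0 < S.β :=
  div_pos (γthn_pos hS) (mul_pos hS.an_pos hS.ρ_pos)

/-- The SINR stays strictly below its saturation level `a_m / a_n`, which here does not exceed the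
target. -/
lemma sinrNM_lt_of_le (hS : S.Valid) (h : S.am ≤ S.γthm * S.an) {g : ℝ} (hg : 0 ≤ g) :
    S.sinrNM g < S.γthm := by
  have := hS.ρ_pos
  have := hS.an_pos
  have h3 := γthm_pos hS
  rw [sinrNM, div_lt_iff₀ (by positivity)]
  nlinarith [mul_le_mul_of_nonneg_left h (by positivity : 0 ≤ g * S.ρ)]

lemma sinrNM_lt_iff (hS : S.Valid) (h : S.γthm * S.an < S.am) {g : ℝ} (hg : 0 ≤ g) :
    S.sinrNM g < S.γthm ↔ g < S.τ := by
  have := hS.ρ_pos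
  have := hS.an_pos
  rw [sinrNM, div_lt_iff₀ (by positivity), τ, lt_div_iff₀ (mul_pos hS.ρ_pos (sub_pos.2 h))]
  constructor <;> intro h <;> linarith

lemma lt_sinrNM_iff (hS : S.Valid) (h : S.γthm * S.an < S.am) {g : ℝ} (hg : 0 ≤ g) :
    S.sinrNM g > S.γthm ↔ S.τ < g := by
  have := hS.ρ_pos
  have := hS.an_pos
  rw [gt_iff_lt, sinrNM, lt_div_iff₀ (by positivity), τ, div_lt_iff₀ (mul_pos hS.ρ_pos (sub_pos.2 h))]
  constructor <;> intro h <;> linarith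

lemma sinrN_lt_iff (hS : S.Valid) (g : ℝ) {i : ℝ} (hi : 0 ≤ i) :
    S.sinrN 1 g i < S.γthn ↔ g < S.β * (i * S.ρ + 1) := by
  have := hS.ρ_pos
  have := hS.an_pos
  have h1 : 0 < S.an * S.ρ := by positivity
  rw [sinrN, one_mul, div_lt_iff₀ (by positivity), β, div_mul_eq_mul_div, lt_div_iff₀ h1]
  constructor <;> intro h <;> linarith

lemma outageOfLaw_eq_one (hS : S.Valid) (h : S.am ≤ S.γthm * S.an) (m : Measure ℝ)
    [IsProbabilityMeasure m] : S.outageOfLaw m = 1 := by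
  have h1 : ∀ p : (ℂ × ℂ) × ℝ, S.sinrNM ((‖rician S.κ S.αsn p.1.1‖ + p.2) ^ 2) < S.γthm := fun p =>
    sinrNM_lt_of_le hS h (sq_nonneg _)
  have h2 : ∀ p : (ℂ × ℂ) × ℝ, ¬ S.sinrNM ((‖rician S.κ S.αsn p.1.1‖ + p.2) ^ 2) > S.γthm := fun p =>
    (h1 p).not_gt
  simp [outageOfLaw, outage, h1, h2]

/-- The amplitude below which user `n` is in outage, as a function of the interference. -/
noncomputable def threshold (S : Params) (w : ℂ) : ℝ :=
  Real.sqrt (max S.τ (S.β * (‖w‖ ^ 2 * S.ρ + 1)))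

@[fun_prop]
lemma measurable_threshold (S : Params) : Measurable S.threshold := by
  unfold threshold; fun_prop

/-- For each fixed cascade value the direct link lies on a null circle, so atoms of `m` do no harm.
This discards the boundary case `γ_{n→m} = γ_{th_m}`, which neither strict inequality in the outage
formula covers. -/
lemma measure_gain_eq_zero (hS : S.Valid) (m : Measure ℝ) [IsProbabilityMeasure m] (c : ℝ) :
    (((complexNormal 1).prod (complexNormal S.ΩI)).prod m)
      {p : (ℂ × ℂ) × ℝ | ‖rician S.κ S.αsn p.1.1‖ + p.2 = c} = 0 := by
  rw [Measure.prod_apply_symm (measurableSet_eq_fun (by fun_prop) measurable_const)]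
  refine (lintegral_congr fun y => ?_).trans lintegral_zero
  have e : (fun q : ℂ × ℂ => (q, y)) ⁻¹' {p : (ℂ × ℂ) × ℝ | ‖rician S.κ S.αsn p.1.1‖ + p.2 = c}
      = {w | ‖rician S.κ S.αsn w‖ = c - y} ×ˢ Set.univ := by
    ext q; simp [eq_sub_iff_add_eq]
  rw [e, Measure.prod_prod, complexNormal_norm_rician_eq hS.κ_nonneg hS.αsn_pos, zero_mul]

/-- The two outage events are disjoint; off the null set where the gain equals `τ`, their union says
that the gain is below the larger of `τ` and `β(|h_I|²ρ + 1)`. Nonnegativity of the cascade permits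
taking square roots. -/
lemma outageOfLaw_eq (hS : S.Valid) (h : S.γthm * S.an < S.am) (m : Measure ℝ)
    [IsProbabilityMeasure m] (hm0 : ∀ᵐ y ∂m, 0 ≤ y) : S.outageOfLaw m =
      (((complexNormal 1).prod (complexNormal S.ΩI)).prod m).real
        {p : (ℂ × ℂ) × ℝ | ‖rician S.κ S.αsn p.1.1‖ + p.2 < S.threshold p.1.2} := by
  rw [outageOfLaw, outage, ← measureReal_union]
  · refine measureReal_congr ?_
    have h1 : ∀ᵐ p : (ℂ × ℂ) × ℝ ∂(((complexNormal 1).prod (complexNormal S.ΩI)).prod m),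
        ‖rician S.κ S.αsn p.1.1‖ + p.2 ≠ Real.sqrt S.τ := by
      rw [ae_iff]; simpa using measure_gain_eq_zero hS m (Real.sqrt S.τ)
    have h2 : ∀ᵐ p : (ℂ × ℂ) × ℝ ∂(((complexNormal 1).prod (complexNormal S.ΩI)).prod m),
        0 ≤ p.2 := Measure.quasiMeasurePreserving_snd.ae hm0
    filter_upwards [h1, h2] with p hp1 hp2
    have hg : 0 ≤ ‖rician S.κ S.αsn p.1.1‖ + p.2 := by positivity
    have hne : (‖rician S.κ S.αsn p.1.1‖ + p.2) ^ 2 ≠ S.τ := by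
      intro e; apply hp1; rw [← e, Real.sqrt_sq hg]
    refine propext ?_
    change (S.sinrNM ((‖rician S.κ S.αsn p.1.1‖ + p.2) ^ 2) < S.γthm ∨ _ ∧ _) ↔ _ < S.threshold p.1.2
    rw [sinrNM_lt_iff hS h (sq_nonneg _), lt_sinrNM_iff hS h (sq_nonneg _),
      sinrN_lt_iff hS _ (sq_nonneg _), threshold, Real.lt_sqrt hg, lt_max_iff]
    constructor
    · rintro (h | h)
      · exact Or.inl h
      · exact Or.inr h.2
    · rintro (h | h)
      · exact Or.inl h
      · rcases hne.lt_or_gt with h' | h'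
        · exact Or.inl h'
        · exact Or.inr ⟨h', h⟩
  · refine Set.disjoint_left.2 fun p hp1 hp2 => ?_
    exact lt_asymm hp1 hp2.1
  · exact S.measurableSet_second_outage

end Params

/-! ### Comparison of two cascade laws -/

lemma real_Iio_sub_le {m₁ m₂ : Measure ℝ} [IsProbabilityMeasure m₁] [IsProbabilityMeasure m₂]
    {ε : ℝ} (h : ∀ x, |m₁.real (Set.Iic x) - m₂.real (Set.Iic x)| ≤ ε) (x : ℝ) :
    |m₁.real (Set.Iio x) - m₂.real (Set.Iio x)| ≤ ε := by
  obtain ⟨u, hu, hux, hlim⟩ := exists_seq_strictMono_tendsto x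
  have key : ∀ (m : Measure ℝ) [IsProbabilityMeasure m],
      Tendsto (fun n => m.real (Set.Iic (u n))) atTop (𝓝 (m.real (Set.Iio x))) := by
    intro m _
    have hm : Monotone fun n => Set.Iic (u n) := fun i j hij => Set.Iic_subset_Iic.2 (hu.monotone hij)
    have := tendsto_measure_iUnion_atTop (μ := m) hm
    rw [iUnion_Iic_eq_Iio_of_lt_of_tendsto hux hlim] at this
    exact (ENNReal.tendsto_toReal (measure_ne_top _ _)).comp this
  exact le_of_tendsto ((key m₁).sub (key m₂)).abs (Eventually.of_forall fun n => h (u n))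

/-- For fixed direct link and interference the event is an open half-line in the cascade variable;
the bound on half-lines is integrated over a probability measure. -/
lemma Params.measureReal_outage_le {S : Params} {m₁ m₂ : Measure ℝ} [IsProbabilityMeasure m₁]
    [IsProbabilityMeasure m₂] {ε : ℝ}
    (h : ∀ x, m₁.real (Set.Iio x) ≤ m₂.real (Set.Iio x) + ε) (hε : 0 ≤ ε) :
    (((complexNormal 1).prod (complexNormal S.ΩI)).prod m₁).real
        {p : (ℂ × ℂ) × ℝ | ‖rician S.κ S.αsn p.1.1‖ + p.2 < S.threshold p.1.2}
      ≤ (((complexNormal 1).prod (complexNormal S.ΩI)).prod m₂).real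
        {p : (ℂ × ℂ) × ℝ | ‖rician S.κ S.αsn p.1.1‖ + p.2 < S.threshold p.1.2} + ε := by
  have hmeas : MeasurableSet
      {p : (ℂ × ℂ) × ℝ | ‖rician S.κ S.αsn p.1.1‖ + p.2 < S.threshold p.1.2} :=
    measurableSet_lt (by fun_prop) (by fun_prop)
  have hle : (((complexNormal 1).prod (complexNormal S.ΩI)).prod m₁)
        {p : (ℂ × ℂ) × ℝ | ‖rician S.κ S.αsn p.1.1‖ + p.2 < S.threshold p.1.2}
      ≤ (((complexNormal 1).prod (complexNormal S.ΩI)).prod m₂)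
        {p : (ℂ × ℂ) × ℝ | ‖rician S.κ S.αsn p.1.1‖ + p.2 < S.threshold p.1.2}
        + ENNReal.ofReal ε := by
    rw [Measure.prod_apply hmeas, Measure.prod_apply hmeas]
    calc _ ≤ ∫⁻ q, (m₂ (Prod.mk q ⁻¹' {p : (ℂ × ℂ) × ℝ |
              ‖rician S.κ S.αsn p.1.1‖ + p.2 < S.threshold p.1.2}) + ENNReal.ofReal ε)
            ∂((complexNormal 1).prod (complexNormal S.ΩI)) := by
          refine lintegral_mono fun q => ?_
          have e : Prod.mk q ⁻¹' {p : (ℂ × ℂ) × ℝ |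
              ‖rician S.κ S.αsn p.1.1‖ + p.2 < S.threshold p.1.2}
              = Set.Iio (S.threshold q.2 - ‖rician S.κ S.αsn q.1‖) := by
            ext y; simp [lt_sub_iff_add_lt']
          simp only [e]
          rw [← ofReal_measureReal, ← ofReal_measureReal (μ := m₂),
            ← ENNReal.ofReal_add measureReal_nonneg hε]
          exact ENNReal.ofReal_le_ofReal (h _)
      _ = _ := by
          rw [lintegral_add_right _ measurable_const]; simp
  have := ENNReal.toReal_mono (by finiteness) hle
  rwa [ENNReal.toReal_add (by finiteness) (by finiteness), ENNReal.toReal_ofReal hε] at this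

/-- The outage probability is stable under uniform perturbations of the distribution function of
the cascade sum. -/
lemma Params.abs_outageOfLaw_sub_le {S : Params} (hS : S.Valid) {m₁ m₂ : Measure ℝ}
    [IsProbabilityMeasure m₁] [IsProbabilityMeasure m₂] (h₁ : ∀ᵐ y ∂m₁, 0 ≤ y)
    (h₂ : ∀ᵐ y ∂m₂, 0 ≤ y) {ε : ℝ}
    (h : ∀ x, |m₁.real (Set.Iic x) - m₂.real (Set.Iic x)| ≤ ε) :
    |S.outageOfLaw m₁ - S.outageOfLaw m₂| ≤ ε := by
  have hε : 0 ≤ ε := (abs_nonneg _).trans (h 0)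
  rcases le_or_gt S.am (S.γthm * S.an) with ha | ha
  · simpa [outageOfLaw_eq_one hS ha] using hε
  · rw [outageOfLaw_eq hS ha m₁ h₁, outageOfLaw_eq hS ha m₂ h₂, abs_sub_le_iff]
    have h' := fun x => abs_sub_le_iff.1 (real_Iio_sub_le h x)
    constructor
    · have := measureReal_outage_le (S := S) (m₁ := m₁) (m₂ := m₂)
        (fun x => by linarith [(h' x).1]) hε
      linarith
    · have := measureReal_outage_le (S := S) (m₁ := m₂) (m₂ := m₁)
        (fun x => by linarith [(h' x).2]) hε
      linarith

/-! ### The distribution function of the surrogate amplitude -/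

/-- Near `π`, `sin t` is of order `π - t` and `cos t + 1` of order `(π - t)²`, hence the exponent
`2φ + 1`. It exceeds `-1` exactly when `φ + 1 > 0`, the condition on the Gamma shape. -/
lemma sin_mul_rpow_le (φ : ℝ) : ∃ C, 0 ≤ C ∧ ∀ t ∈ Set.Ioo 0 Real.pi,
    Real.sin t * (Real.cos t + 1) ^ φ ≤ C * (1 + (Real.pi - t) ^ (2 * φ + 1)) := by
  have hpi := Real.pi_pos
  rcases le_total 0 φ with hφ | hφ
  · refine ⟨2 ^ φ, by positivity, fun t ht => ?_⟩
    have h1 : (Real.cos t + 1) ^ φ ≤ 2 ^ φ :=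
      Real.rpow_le_rpow (by linarith [Real.neg_one_le_cos t]) (by linarith [Real.cos_le_one t]) hφ
    have h2 : 0 ≤ (Real.pi - t) ^ (2 * φ + 1) := Real.rpow_nonneg (by linarith [ht.2]) _
    have h3 : 0 ≤ (Real.cos t + 1) ^ φ :=
      Real.rpow_nonneg (by linarith [Real.neg_one_le_cos t]) _
    calc Real.sin t * (Real.cos t + 1) ^ φ ≤ 1 * 2 ^ φ :=
          mul_le_mul (Real.sin_le_one t) h1 h3 zero_le_one
      _ ≤ 2 ^ φ * (1 + (Real.pi - t) ^ (2 * φ + 1)) := by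
          rw [one_mul, mul_add, mul_one]
          exact le_add_of_nonneg_right (by positivity)
  · refine ⟨(2 / Real.pi ^ 2) ^ φ, by positivity, fun t ht => ?_⟩
    have hu : 0 < Real.pi - t := by linarith [ht.2]
    have h1 := Real.cos_le_one_sub_mul_cos_sq (x := Real.pi - t)
      (by rw [abs_of_pos hu]; linarith [ht.1])
    rw [Real.cos_pi_sub] at h1
    have h2 : (Real.cos t + 1) ^ φ ≤ (2 / Real.pi ^ 2 * (Real.pi - t) ^ 2) ^ φ :=
      Real.rpow_le_rpow_of_nonpos (by positivity) (by linarith) hφ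
    have h3 : Real.sin t ≤ Real.pi - t := by
      rw [← Real.sin_pi_sub]; exact Real.sin_le hu.le
    have h4 : (2 / Real.pi ^ 2 * (Real.pi - t) ^ 2) ^ φ
        = (2 / Real.pi ^ 2) ^ φ * (Real.pi - t) ^ (2 * φ) := by
      rw [Real.mul_rpow (by positivity) (by positivity), Real.rpow_mul hu.le, Real.rpow_two]
    calc Real.sin t * (Real.cos t + 1) ^ φ
        ≤ (Real.pi - t) * ((2 / Real.pi ^ 2) ^ φ * (Real.pi - t) ^ (2 * φ)) := by
          rw [← h4]
          exact mul_le_mul h3 h2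
            (Real.rpow_nonneg (by linarith [Real.neg_one_le_cos t]) _) hu.le
      _ = (2 / Real.pi ^ 2) ^ φ * (Real.pi - t) ^ (2 * φ + 1) := by
          rw [Real.rpow_add_one hu.ne']; ring
      _ ≤ _ := by
          rw [mul_add]
          exact le_add_of_nonneg_left (by positivity)

namespace Params

/-- The distribution function of `|h_sn| + Y`. -/
noncomputable def gainCdf (S : Params) (c : ℝ) : ℝ :=
  ((complexNormal 1).prod S.gammaLaw).real {p | ‖rician S.κ S.αsn p.1‖ + p.2 < c}

/-- The integrand of the distribution function of `|h_sn| + Y` after the trigonometric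
substitution. -/
noncomputable def cosineIntegrand (S : Params) (c t : ℝ) : ℝ :=
  1 / 2 * S.Φ * c ^ (S.φn + 1) * (Real.sin t * (Real.cos t + 1) ^ S.φn)
    * Real.exp (-((Real.cos t + 1) * c / (2 * S.ϕn)))
    * (1 - marcumQ (Real.sqrt (2 * S.κ))
      ((c - (Real.cos t + 1) * c / 2) * Real.sqrt (2 * (S.κ + 1) / S.αsn)))

variable {S : Params}

lemma real_rician_add_lt (hS : S.Valid) {c y : ℝ} (h : y < c) :
    (complexNormal 1).real {w | ‖rician S.κ S.αsn w‖ + y < c} = 1 - marcumQ (Real.sqrt (2 * S.κ))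
      ((c - y) * Real.sqrt (2 * (S.κ + 1) / S.αsn)) := by
  rw [← complexNormal_real_norm_rician_le hS.κ_nonneg hS.αsn_pos (sub_nonneg.2 h.le)]
  refine measureReal_congr ?_
  have h1 : ∀ᵐ w ∂complexNormal 1, ‖rician S.κ S.αsn w‖ ≠ c - y := by
    rw [ae_iff]; simpa using complexNormal_norm_rician_eq hS.κ_nonneg hS.αsn_pos (c - y)
  filter_upwards [h1] with w hw
  refine propext ?_
  change ‖rician S.κ S.αsn w‖ + y < c ↔ ‖rician S.κ S.αsn w‖ ≤ c - y
  rw [← lt_sub_iff_add_lt, hw.le_iff_lt]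

lemma measurableSet_gain_lt (S : Params) (c : ℝ) :
    MeasurableSet {p : ℂ × ℝ | ‖rician S.κ S.αsn p.1‖ + p.2 < c} :=
  measurableSet_lt (by fun_prop) measurable_const

/-- Condition on the Gamma variable `y`; for `y ≥ c` the section is empty because moduli are
nonnegative, which cuts the integral at `c`. -/
lemma gainCdf_eq_setIntegral (hS : S.Valid) (c : ℝ) :
    S.gainCdf c = ∫ y in Set.Ioo 0 c, (1 / S.ϕn) ^ (S.φn + 1) / Real.Gamma (S.φn + 1)
      * y ^ S.φn * Real.exp (-(1 / S.ϕn * y)) * (1 - marcumQ (Real.sqrt (2 * S.κ))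
      ((c - y) * Real.sqrt (2 * (S.κ + 1) / S.αsn))) := by
  have hp := isProbabilityMeasure_gammaLaw hS
  rw [gainCdf, measureReal_def, Measure.prod_apply_symm (S.measurableSet_gain_lt c),
    ← integral_toReal (measurable_measure_prodMk_right (S.measurableSet_gain_lt c)).aemeasurable
      (ae_of_all _ fun _ => measure_lt_top _ _), gammaLaw,
    integral_gammaMeasure (φn_add_one_pos hS) (one_div_pos.2 (ϕn_pos hS)),
    setIntegral_eq_of_subset_of_forall_sdiff_eq_zero (s := Set.Ioo 0 c) measurableSet_Ioi
      (fun y hy => hy.1) ?_]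
  · refine setIntegral_congr_fun measurableSet_Ioo fun y hy => ?_
    simp only [add_sub_cancel_right]
    rw [← real_rician_add_lt hS hy.2]
    rfl
  · intro y hy
    have hcy : c ≤ y := by
      by_contra! h; exact hy.2 ⟨hy.1, h⟩
    have e : (fun x : ℂ => (x, y)) ⁻¹' {p : ℂ × ℝ | ‖rician S.κ S.αsn p.1‖ + p.2 < c} = ∅ := by
      ext w
      have := norm_nonneg (rician S.κ S.αsn w)
      simp only [Set.mem_preimage, Set.mem_ofPred_eq, Set.mem_empty_iff_false, iff_false, not_lt]
      linarith
    rw [e]; simp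

lemma image_cos_Ioo {c : ℝ} (hc : 0 < c) :
    (fun t => (Real.cos t + 1) * c / 2) '' Set.Ioo 0 Real.pi = Set.Ioo 0 c := by
  ext y
  constructor
  · rintro ⟨t, ht, rfl⟩
    have h1 : Real.cos t < Real.cos 0 := Real.cos_lt_cos_of_nonneg_of_le_pi le_rfl ht.2.le ht.1
    have h2 : Real.cos Real.pi < Real.cos t := Real.cos_lt_cos_of_nonneg_of_le_pi ht.1.le le_rfl ht.2
    rw [Real.cos_zero] at h1
    rw [Real.cos_pi] at h2
    constructor <;> simp only <;> nlinarith
  · rintro ⟨h0, h1⟩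
    have h2 : 0 < y / c := by positivity
    have h3 : y / c < 1 := (div_lt_one hc).2 h1
    have h4 : Real.cos (Real.arccos (2 * (y / c) - 1)) = 2 * (y / c) - 1 :=
      Real.cos_arccos (by linarith) (by linarith)
    refine ⟨Real.arccos (2 * (y / c) - 1), ⟨Real.arccos_pos.2 (by linarith), ?_⟩, ?_⟩
    · refine (Real.arccos_le_pi _).lt_of_ne fun h => ?_
      rw [h, Real.cos_pi] at h4
      linarith
    · simp only [h4]; field_simp; ring

lemma cos_add_one_pos {t : ℝ} (ht : t ∈ Set.Ioo 0 Real.pi) : 0 < Real.cos t + 1 := by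
  have h2 : Real.cos Real.pi < Real.cos t := Real.cos_lt_cos_of_nonneg_of_le_pi ht.1.le le_rfl ht.2
  rw [Real.cos_pi] at h2
  linarith

/-- The substitution `y = (cos t + 1) c / 2` makes Chebyshev nodes equally spaced in `t`. The factor
`2^{-φ_n}` in `Φ` comes from `y^{φ_n}`, the extra `1/2` from the Jacobian. -/
lemma gainCdf_eq (hS : S.Valid) {c : ℝ} (hc : 0 < c) :
    S.gainCdf c = ∫ t in 0..Real.pi, S.cosineIntegrand c t := by
  have hϕ := ϕn_pos hS
  have hG := Real.Gamma_pos_of_pos (φn_add_one_pos hS)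
  rw [gainCdf_eq_setIntegral hS, ← image_cos_Ioo hc,
    integral_image_eq_integral_abs_deriv_smul (f' := fun t => -Real.sin t * c / 2) measurableSet_Ioo,
    intervalIntegral.integral_of_le Real.pi_pos.le, integral_Ioc_eq_integral_Ioo]
  · refine setIntegral_congr_fun measurableSet_Ioo fun t ht => ?_
    have hs := Real.sin_pos_of_pos_of_lt_pi ht.1 ht.2
    have hx := cos_add_one_pos ht
    have h1 : |-Real.sin t * c / 2| = Real.sin t * c / 2 := by
      rw [neg_mul, neg_div, abs_neg, abs_of_pos (by positivity)]
    have h2 : ((Real.cos t + 1) * c / 2) ^ S.φn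
        = (Real.cos t + 1) ^ S.φn * c ^ S.φn / 2 ^ S.φn := by
      rw [Real.div_rpow (by positivity) (by positivity), Real.mul_rpow hx.le hc.le]
    have h3 : (1 / S.ϕn) ^ (S.φn + 1) = 1 / S.ϕn ^ (S.φn + 1) := by
      rw [Real.div_rpow zero_le_one hϕ.le, Real.one_rpow]
    have h4 : 1 / S.ϕn * ((Real.cos t + 1) * c / 2) = (Real.cos t + 1) * c / (2 * S.ϕn) := by
      field_simp
    have h5 : 0 < S.ϕn ^ (S.φn + 1) := Real.rpow_pos_of_pos hϕ _
    have h6 : (0 : ℝ) < 2 ^ S.φn := Real.rpow_pos_of_pos two_pos _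
    simp only [smul_eq_mul]
    rw [h1, h2, h3, h4, cosineIntegrand, Φ, Real.rpow_add_one hc.ne']
    field_simp
  · intro t _
    exact ((((Real.hasDerivAt_cos t).add_const 1).mul_const c).div_const 2).hasDerivWithinAt
  · intro x hx y hy hxy
    have h : Real.cos x = Real.cos y := by
      simp only at hxy
      have := mul_right_cancel₀ hc.ne' (by linarith : (Real.cos x + 1) * c = (Real.cos y + 1) * c)
      linarith
    exact Real.injOn_cos ⟨hx.1.le, hx.2.le⟩ ⟨hy.1.le, hy.2.le⟩ h

lemma gainCdf_mono (hS : S.Valid) : Monotone S.gainCdf := by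
  have hp := isProbabilityMeasure_gammaLaw hS
  exact fun a b hab => measureReal_mono fun p (hp : _ < a) => lt_of_lt_of_le hp hab

lemma tendsto_gainCdf (hS : S.Valid) : Tendsto S.gainCdf atTop (𝓝 1) := by
  have hp := isProbabilityMeasure_gammaLaw hS
  have hm : Monotone fun c : ℝ => {p : ℂ × ℝ | ‖rician S.κ S.αsn p.1‖ + p.2 < c} :=
    fun a b hab p (hp : _ < a) => lt_of_lt_of_le hp hab
  have h := tendsto_measure_iUnion_atTop (μ := (complexNormal 1).prod S.gammaLaw) hm
  have e : ⋃ c : ℝ, {p : ℂ × ℝ | ‖rician S.κ S.αsn p.1‖ + p.2 < c} = Set.univ :=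
    Set.eq_univ_of_forall fun p => Set.mem_iUnion.2 (exists_gt _)
  rw [e, measure_univ] at h
  exact (ENNReal.tendsto_toReal ENNReal.one_ne_top).comp h

/-- Conditioning on the interference power, which has an exponential law. -/
lemma gammaOutage_eq_integral (hS : S.Valid) (h : S.γthm * S.an < S.am) (hτ : S.τ ≤ S.β) :
    S.gammaOutage 1 = ∫ x in Set.Ioi 0, S.gainCdf (S.χ 1 x) * Real.exp (-x) := by
  have hp := isProbabilityMeasure_gammaLaw hS
  have hβ := β_pos hS
  have hρ := hS.ρ_pos
  have hpos : ∀ᵐ y ∂S.gammaLaw, 0 ≤ y :=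
    (ae_gammaMeasure_pos (φn_add_one_pos hS) (one_div_pos.2 (ϕn_pos hS))).mono fun _ => le_of_lt
  have hmeasH : Measurable S.gainCdf := (gainCdf_mono hS).measurable
  -- Here `τ ≤ β` enters: the second entry of the maximum is at least `β` for every interference
  -- power.
  have hthr : ∀ w, S.threshold w = Real.sqrt (S.β * (‖w‖ ^ 2 * S.ρ + 1)) := by
    intro w
    rw [threshold, max_eq_right]
    have : 0 ≤ S.β * (‖w‖ ^ 2 * S.ρ) := by positivity
    linarith
  have hset : MeasurableSet
      {p : (ℂ × ℂ) × ℝ | ‖rician S.κ S.αsn p.1.1‖ + p.2 < S.threshold p.1.2} :=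
    measurableSet_lt (by fun_prop) (by fun_prop)
  rw [gammaOutage_eq, outageOfLaw_eq hS h _ hpos, measureReal_def]
  have key : (((complexNormal 1).prod (complexNormal S.ΩI)).prod S.gammaLaw)
      {p : (ℂ × ℂ) × ℝ | ‖rician S.κ S.αsn p.1.1‖ + p.2 < S.threshold p.1.2}
      = ∫⁻ x in Set.Ioi 0, ENNReal.ofReal (S.gainCdf (S.χ 1 x) * Real.exp (-x)) := by
    rw [Measure.prod_apply hset, lintegral_prod_symm _
      (measurable_measure_prodMk_left hset).aemeasurable]
    have e : ∀ w₂ : ℂ, ∫⁻ w₁, S.gammaLaw (Prod.mk (w₁, w₂) ⁻¹'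
        {p : (ℂ × ℂ) × ℝ | ‖rician S.κ S.αsn p.1.1‖ + p.2 < S.threshold p.1.2}) ∂complexNormal 1
        = ENNReal.ofReal (S.gainCdf (Real.sqrt (S.β * (‖w₂‖ ^ 2 * S.ρ + 1)))) := by
      intro w₂
      rw [gainCdf, ofReal_measureReal, Measure.prod_apply (S.measurableSet_gain_lt _)]
      simp only [hthr]
      rfl
    simp_rw [e]
    rw [lintegral_norm_sq_complexNormal hS.ΩI_pos
      (g := fun i => ENNReal.ofReal (S.gainCdf (Real.sqrt (S.β * (i * S.ρ + 1)))))
      (by fun_prop)]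
    refine lintegral_congr fun x => ?_
    have e2 : S.ΩI * x * S.ρ + 1 = 1 * x * S.ΩI * S.ρ + 1 := by ring
    rw [χ, mul_comm, e2, gainCdf, ENNReal.ofReal_mul measureReal_nonneg]
  rw [key, ← integral_eq_lintegral_of_nonneg_ae]
  · exact ae_of_all _ fun x => mul_nonneg measureReal_nonneg (Real.exp_nonneg _)
  · refine Measurable.aestronglyMeasurable ?_
    unfold χ
    fun_prop

lemma chebyshevAngle_mem_Ioo {U u : ℕ} (hu : u ∈ Finset.Icc 1 U) :
    (2 * (u : ℝ) - 1) / (2 * (U : ℝ)) * Real.pi ∈ Set.Ioo 0 Real.pi := by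
  obtain ⟨h1, h2⟩ := Finset.mem_Icc.1 hu
  have h1' : (1 : ℝ) ≤ u := by exact_mod_cast h1
  have h2' : (u : ℝ) ≤ U := by exact_mod_cast h2
  have hU : (0 : ℝ) < 2 * U := by linarith
  have hpi := Real.pi_pos
  have h3 : 0 < (2 * (u : ℝ) - 1) / (2 * (U : ℝ)) := div_pos (by linarith) hU
  have h4 : (2 * (u : ℝ) - 1) / (2 * (U : ℝ)) < 1 := (div_lt_one hU).2 (by linarith)
  exact ⟨by positivity, by nlinarith⟩

/-- At a Chebyshev node `√(1 - x_u²)` is the sine of the angle, so `b_u` is half the midpoint weight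
times that sine; `cosineIntegrand` contains both factors. -/
lemma quadratureOutage_eq (S : Params) (P U : ℕ) :
    S.quadratureOutage 1 P U = gaussLaguerre P fun x => ∑ u ∈ Finset.Icc 1 U,
      Real.pi / U * S.cosineIntegrand (S.χ 1 x) ((2 * (u : ℝ) - 1) / (2 * (U : ℝ)) * Real.pi) := by
  rw [quadratureOutage, gaussLaguerre, Finset.mul_sum]
  refine Finset.sum_congr rfl fun x _ => ?_
  rw [Finset.mul_sum, Finset.mul_sum]
  refine Finset.sum_congr rfl fun u hu => ?_
  have ht := chebyshevAngle_mem_Ioo hu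
  have hs : Real.sqrt (1 - chebyshevNode U u ^ 2)
      = Real.sin ((2 * (u : ℝ) - 1) / (2 * (U : ℝ)) * Real.pi) := by
    rw [chebyshevNode, ← Real.sin_sq, Real.sqrt_sq (Real.sin_pos_of_pos_of_lt_pi ht.1 ht.2).le]
  rw [chebyshevWeight, hs, chebyshevNode, cosineIntegrand]
  ring

/-! ### Convergence of the double sum -/

lemma χ_pos (hS : S.Valid) {x : ℝ} (hx : 0 ≤ x) : 0 < S.χ 1 x := by
  have := β_pos hS
  have := hS.ρ_pos
  have := hS.ΩI_pos
  unfold χ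
  positivity

@[fun_prop]
lemma continuous_χ (S : Params) : Continuous (S.χ 1) := by
  unfold χ; fun_prop

lemma tendsto_χ (hS : S.Valid) : Tendsto (S.χ 1) atTop atTop := by
  have := hS.ρ_pos
  have := hS.ΩI_pos
  unfold χ
  refine Real.tendsto_sqrt_atTop.comp (Tendsto.const_mul_atTop (β_pos hS) ?_)
  refine tendsto_atTop_add_const_right _ _ ?_
  simp only [one_mul, mul_assoc]
  exact tendsto_id.atTop_mul_const (by positivity)

lemma Φ_pos (hS : S.Valid) : 0 < S.Φ := by
  have hG := Real.Gamma_pos_of_pos (φn_add_one_pos hS)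
  have := Real.rpow_pos_of_pos (ϕn_pos hS) (S.φn + 1)
  unfold Φ
  positivity

lemma continuousOn_cosineIntegrand (hS : S.Valid) : ContinuousOn
    (Function.uncurry S.cosineIntegrand) (Set.Ici 0 ×ˢ Set.Ioo 0 Real.pi) := by
  have hφ := φn_add_one_pos hS
  have hc : (0 : ℝ) ≤ Real.sqrt (2 * (S.κ + 1) / S.αsn) := Real.sqrt_nonneg _
  have h1 : ContinuousOn (fun p : ℝ × ℝ => (Real.cos p.2 + 1) ^ S.φn)
      (Set.Ici 0 ×ˢ Set.Ioo 0 Real.pi) :=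
    ContinuousOn.rpow_const (by fun_prop) fun p hp => Or.inl (cos_add_one_pos hp.2).ne'
  have h2 : Continuous fun p : ℝ × ℝ => p.1 ^ (S.φn + 1) :=
    continuous_fst.rpow_const fun p => Or.inr hφ.le
  have h3 : ContinuousOn (fun p : ℝ × ℝ => 1 - marcumQ (Real.sqrt (2 * S.κ))
      ((p.1 - (Real.cos p.2 + 1) * p.1 / 2) * Real.sqrt (2 * (S.κ + 1) / S.αsn)))
      (Set.Ici 0 ×ˢ Set.Ioo 0 Real.pi) := by
    refine (continuousOn_one_sub_marcumQ (κ := S.κ) hc).comp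
      (f := fun p : ℝ × ℝ => p.1 - (Real.cos p.2 + 1) * p.1 / 2) (by fun_prop) fun p hp => ?_
    have h0 : 0 ≤ p.1 := hp.1
    have h1 := Real.cos_le_one p.2
    simp only [Set.mem_Ici]
    nlinarith
  unfold Function.uncurry cosineIntegrand
  have h4 : Continuous fun p : ℝ × ℝ => Real.exp (-((Real.cos p.2 + 1) * p.1 / (2 * S.ϕn))) := by
    fun_prop
  have h5 : Continuous fun p : ℝ × ℝ => Real.sin p.2 := by fun_prop
  exact (((continuousOn_const.mul h2.continuousOn).mul (h5.continuousOn.mul h1)).mul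
    h4.continuousOn).mul h3

/-- The Marcum factor is a probability and the exponential is at most 1. What remains separates `c`
from `t`. -/
lemma abs_cosineIntegrand_le (hS : S.Valid) {c t : ℝ} (hc : 0 ≤ c) (ht : t ∈ Set.Ioo 0 Real.pi) :
    |S.cosineIntegrand c t|
      ≤ 1 / 2 * S.Φ * c ^ (S.φn + 1) * (Real.sin t * (Real.cos t + 1) ^ S.φn) := by
  have hΦ := Φ_pos hS
  have hϕ := ϕn_pos hS
  have hx := cos_add_one_pos ht
  have hs := Real.sin_pos_of_pos_of_lt_pi ht.1 ht.2
  have hr : 0 ≤ c - (Real.cos t + 1) * c / 2 := by nlinarith [Real.cos_le_one t]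
  have hx' : 0 ≤ (Real.cos t + 1) ^ S.φn := Real.rpow_nonneg hx.le _
  have hc' : 0 ≤ c ^ (S.φn + 1) := Real.rpow_nonneg hc _
  have h0 : 0 ≤ 1 / 2 * S.Φ * c ^ (S.φn + 1) * (Real.sin t * (Real.cos t + 1) ^ S.φn) := by
    positivity
  have h1 : Real.exp (-((Real.cos t + 1) * c / (2 * S.ϕn))) ≤ 1 := by
    rw [Real.exp_le_one_iff, neg_nonpos]; positivity
  rw [cosineIntegrand, ← complexNormal_real_norm_rician_le hS.κ_nonneg hS.αsn_pos hr,
    abs_of_nonneg (by positivity)]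
  exact mul_le_of_le_one_right (by positivity) measureReal_le_one |>.trans
    (mul_le_of_le_one_right h0 h1)

lemma χ_rpow_le (hS : S.Valid) : ∃ (C : ℝ) (M : ℕ), 0 ≤ C ∧ ∀ x, 0 ≤ x →
    S.χ 1 x ^ (S.φn + 1) ≤ C * (1 + x) ^ M := by
  have hβ := β_pos hS
  have hρ := hS.ρ_pos
  have hΩ := hS.ΩI_pos
  have hφ := φn_add_one_pos hS
  refine ⟨Real.sqrt (S.β * (S.ΩI * S.ρ + 1)) ^ (S.φn + 1), ⌈S.φn + 1⌉₊, by positivity,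
    fun x hx => ?_⟩
  have h1 : S.χ 1 x ≤ Real.sqrt (S.β * (S.ΩI * S.ρ + 1)) * (1 + x) := by
    rw [χ, ← Real.sqrt_sq (by linarith : 0 ≤ 1 + x), ← Real.sqrt_mul (by positivity)]
    refine Real.sqrt_le_sqrt ?_
    rw [mul_assoc S.β]
    refine mul_le_mul_of_nonneg_left ?_ hβ.le
    have : 0 < S.ΩI * S.ρ := by positivity
    nlinarith [mul_nonneg this.le hx, mul_nonneg this.le (sq_nonneg x), sq_nonneg x]
  calc S.χ 1 x ^ (S.φn + 1)
      ≤ (Real.sqrt (S.β * (S.ΩI * S.ρ + 1)) * (1 + x)) ^ (S.φn + 1) :=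
        Real.rpow_le_rpow (χ_pos hS hx).le h1 hφ.le
    _ = Real.sqrt (S.β * (S.ΩI * S.ρ + 1)) ^ (S.φn + 1) * (1 + x) ^ (S.φn + 1) :=
        Real.mul_rpow (by positivity) (by positivity)
    _ ≤ _ := by
        refine mul_le_mul_of_nonneg_left ?_ (by positivity)
        rw [← Real.rpow_natCast]
        exact Real.rpow_le_rpow_of_exponent_le (by linarith) (Nat.le_ceil _)

lemma sin_mul_rpow_nonneg (φ : ℝ) {t : ℝ} (ht : t ∈ Set.Ioo 0 Real.pi) :
    0 ≤ Real.sin t * (Real.cos t + 1) ^ φ :=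
  mul_nonneg (Real.sin_pos_of_pos_of_lt_pi ht.1 ht.2).le
    (Real.rpow_nonneg (cos_add_one_pos ht).le _)

/-- Midpoint sums of an integrable singularity converge, hence are eventually bounded; the
convergence result is used with a one-point parameter space. -/
lemma eventually_sum_sin_mul_rpow_le {φ : ℝ} (hφ : 0 < φ + 1) : ∃ B, ∀ᶠ U : ℕ in atTop,
    ∑ u ∈ Finset.Icc 1 U, Real.pi / U *
      (Real.sin ((2 * (u : ℝ) - 1) / (2 * (U : ℝ)) * Real.pi)
        * (Real.cos ((2 * (u : ℝ) - 1) / (2 * (U : ℝ)) * Real.pi) + 1) ^ φ) ≤ B := by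
  obtain ⟨C, hC, hsin⟩ := sin_mul_rpow_le φ
  have hcont : ContinuousOn (Function.uncurry fun (_ : Unit) t =>
      Real.sin t * (Real.cos t + 1) ^ φ) (Set.univ ×ˢ Set.Ioo 0 Real.pi) := by
    have h1 : Continuous fun p : Unit × ℝ => Real.sin p.2 := by fun_prop
    have h2 : Continuous fun p : Unit × ℝ => Real.cos p.2 + 1 := by fun_prop
    exact h1.continuousOn.mul
      (h2.continuousOn.rpow_const fun p hp => Or.inl (cos_add_one_pos hp.2).ne')
  have hsum := (tendsto_midpoint_sum hcont (Set.mem_univ ()) hC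
    (by linarith : -1 < 2 * φ + 1) (Eventually.of_forall fun _ t ht => by
      rw [abs_of_nonneg (sin_mul_rpow_nonneg φ ht)]
      exact hsin t ht)).1
  have hpair : Tendsto (fun U : ℕ => (U, ())) atTop (atTop ×ˢ 𝓝[Set.univ] ()) :=
    tendsto_id.prodMk (tendsto_const_pure.mono_right (pure_le_nhdsWithin (Set.mem_univ ())))
  exact ⟨_, ((hsum.comp hpair).eventually_lt_const (lt_add_one _)).mono fun U hU => hU.le⟩

lemma eventually_abs_cosineIntegrand_le (hS : S.Valid) (x₀ : ℝ) : ∃ D, 0 ≤ D ∧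
    ∀ᶠ x in 𝓝 x₀, ∀ t ∈ Set.Ioo 0 Real.pi,
      |S.cosineIntegrand (S.χ 1 x) t| ≤ D * (1 + (Real.pi - t) ^ (2 * S.φn + 1)) := by
  have hφ := φn_add_one_pos hS
  have hΦ := Φ_pos hS
  obtain ⟨C, hC, hsin⟩ := sin_mul_rpow_le S.φn
  have hcx : ContinuousAt (fun x => S.χ 1 x ^ (S.φn + 1)) x₀ :=
    ((continuous_χ S).rpow_const fun _ => Or.inr hφ.le).continuousAt
  have h0 : 0 ≤ S.χ 1 x₀ ^ (S.φn + 1) := Real.rpow_nonneg (Real.sqrt_nonneg _) _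
  refine ⟨1 / 2 * S.Φ * (S.χ 1 x₀ ^ (S.φn + 1) + 1) * C, by positivity, ?_⟩
  filter_upwards [hcx.eventually_lt_const (lt_add_one _)] with x hx t ht
  refine (abs_cosineIntegrand_le hS (Real.sqrt_nonneg _) ht).trans ?_
  rw [mul_assoc _ C]
  exact mul_le_mul (mul_le_mul_of_nonneg_left hx.le (by positivity)) (hsin t ht)
    (sin_mul_rpow_nonneg _ ht) (by positivity)

/-- The factor `χ^{φ_n+1}` grows at most polynomially in `x`, and the remaining sum does not involve
`x`. This is the tail majorant for the joint limit, uniform in `U` once `U` is large. -/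
lemma eventually_abs_sum_cosineIntegrand_le (hS : S.Valid) : ∃ (C : ℝ) (M : ℕ),
    ∀ᶠ U : ℕ in atTop, ∀ x, 0 ≤ x → |∑ u ∈ Finset.Icc 1 U, Real.pi / U *
        S.cosineIntegrand (S.χ 1 x) ((2 * (u : ℝ) - 1) / (2 * (U : ℝ)) * Real.pi)|
      ≤ C * (1 + x) ^ M := by
  have hΦ := Φ_pos hS
  obtain ⟨A, M, hA, hχ⟩ := χ_rpow_le hS
  obtain ⟨B, hB⟩ := eventually_sum_sin_mul_rpow_le (φn_add_one_pos hS)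
  refine ⟨1 / 2 * S.Φ * A * B, M, ?_⟩
  filter_upwards [hB] with U hU x hx
  have hw : (0 : ℝ) ≤ Real.pi / U := div_nonneg Real.pi_pos.le (Nat.cast_nonneg _)
  have hsum : 0 ≤ ∑ u ∈ Finset.Icc 1 U, Real.pi / U *
      (Real.sin ((2 * (u : ℝ) - 1) / (2 * (U : ℝ)) * Real.pi)
        * (Real.cos ((2 * (u : ℝ) - 1) / (2 * (U : ℝ)) * Real.pi) + 1) ^ S.φn) :=
    Finset.sum_nonneg fun u hu => mul_nonneg hw (sin_mul_rpow_nonneg _ (chebyshevAngle_mem_Ioo hu))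
  calc |∑ u ∈ Finset.Icc 1 U, Real.pi / U *
        S.cosineIntegrand (S.χ 1 x) ((2 * (u : ℝ) - 1) / (2 * (U : ℝ)) * Real.pi)|
      ≤ ∑ u ∈ Finset.Icc 1 U, 1 / 2 * S.Φ * S.χ 1 x ^ (S.φn + 1) * (Real.pi / U *
      (Real.sin ((2 * (u : ℝ) - 1) / (2 * (U : ℝ)) * Real.pi)
        * (Real.cos ((2 * (u : ℝ) - 1) / (2 * (U : ℝ)) * Real.pi) + 1) ^ S.φn)) := by
        refine (Finset.abs_sum_le_sum_abs _ _).trans (Finset.sum_le_sum fun u hu => ?_)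
        rw [abs_mul, abs_of_nonneg hw, mul_left_comm _ (Real.pi / (U : ℝ))]
        exact mul_le_mul_of_nonneg_left (abs_cosineIntegrand_le hS (Real.sqrt_nonneg _)
          (chebyshevAngle_mem_Ioo hu)) hw
    _ ≤ 1 / 2 * S.Φ * (A * (1 + x) ^ M) * B := by
        rw [← Finset.mul_sum]
        exact mul_le_mul (mul_le_mul_of_nonneg_left (hχ x hx) (by positivity)) hU hsum
          (by positivity)
    _ = _ := by ring

/-- The midpoint sums converge to the distribution function, locally uniformly in the
interference power. -/
lemma tendstoLocallyUniformlyOn_gainCdf (hS : S.Valid) :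
    TendstoLocallyUniformlyOn (fun (U : ℕ) x => ∑ u ∈ Finset.Icc 1 U,
      Real.pi / U * S.cosineIntegrand (S.χ 1 x) ((2 * (u : ℝ) - 1) / (2 * (U : ℝ)) * Real.pi))
      (fun x => S.gainCdf (S.χ 1 x)) atTop (Set.Ici 0) ∧
    ContinuousOn (fun x => S.gainCdf (S.χ 1 x)) (Set.Ici 0) := by
  have hφ := φn_add_one_pos hS
  have hcont : ContinuousOn (Function.uncurry fun x => S.cosineIntegrand (S.χ 1 x))
      (Set.Ici 0 ×ˢ Set.Ioo 0 Real.pi) := by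
    have hc : Continuous fun p : ℝ × ℝ => (S.χ 1 p.1, p.2) := by fun_prop
    exact (continuousOn_cosineIntegrand hS).comp hc.continuousOn
      fun p hp => ⟨Real.sqrt_nonneg _, hp.2⟩
  have hbound : ∀ x₀ ∈ Set.Ici (0 : ℝ), ∃ D, 0 ≤ D ∧ ∀ᶠ x in 𝓝[Set.Ici 0] x₀,
      ∀ t ∈ Set.Ioo 0 Real.pi,
        |S.cosineIntegrand (S.χ 1 x) t| ≤ D * (1 + (Real.pi - t) ^ (2 * S.φn + 1)) := by
    intro x₀ _
    obtain ⟨D, hD, hx⟩ := eventually_abs_cosineIntegrand_le hS x₀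
    exact ⟨D, hD, nhdsWithin_le_nhds hx⟩
  obtain ⟨hunif, hcontInt⟩ := tendstoLocallyUniformlyOn_midpoint_sum hcont
    (by linarith : -1 < 2 * S.φn + 1) hbound
  have hEq : Set.EqOn (fun x => ∫ t in (0 : ℝ)..Real.pi, S.cosineIntegrand (S.χ 1 x) t)
      (fun x => S.gainCdf (S.χ 1 x)) (Set.Ici 0) :=
    fun x hx => (gainCdf_eq hS (χ_pos hS hx)).symm
  exact ⟨hunif.congr_right hEq, hcontInt.congr hEq.symm⟩

/-- The double sum converges to the outage probability for the Gamma law. -/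
lemma tendsto_quadratureOutage (hS : S.Valid) (h : S.γthm * S.an < S.am) (hτ : S.τ ≤ S.β) :
    Tendsto (fun N : ℕ × ℕ => S.quadratureOutage 1 N.1 N.2) atTop (𝓝 (S.gammaOutage 1)) := by
  obtain ⟨hunif, hcont⟩ := tendstoLocallyUniformlyOn_gainCdf hS
  obtain ⟨C, M, hev⟩ := eventually_abs_sum_cosineIntegrand_le hS
  rw [gammaOutage_eq_integral hS h hτ]
  refine (tendsto_gaussLaguerre_joint
    ((gainCdf_mono hS).measurable.comp (continuous_χ S).measurable) hcont
    ((tendsto_gainCdf hS).comp (tendsto_χ hS)) hunif hev).congr fun N => ?_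
  exact (quadratureOutage_eq S N.1 N.2).symm

end Params

end StarRis

/-! ### The theorem. -/

theorem theorem1 :
    ∃ δ : ℝ → ℕ → ℝ, (∀ κ : ℝ, 0 ≤ κ → Tendsto (δ κ) atTop (𝓝 0)) ∧
      ∀ (S : Params), S.Valid →
      ∀ (Ω : Type*) [MeasurableSpace Ω] (P : Measure Ω) [IsProbabilityMeasure P]
        (F : Fading S.K Ω), F.IsRician P S.ΩI →
        -- the Gamma law matches the mean and the variance of the cascade sum
        (MemLp (F.cascade S) 2 P ∧
          P[F.cascade S] = (∫ x, x ∂S.gammaLaw) ∧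
          Var[F.cascade S; P] = Var[id; S.gammaLaw]) ∧
        -- and approximates its distribution, uniformly
        (∀ x : ℝ, |P.real {ω | F.cascade S ω ≤ x} - S.gammaLaw.real (Set.Iic x)| ≤ δ S.κ S.K) ∧
        -- the replacement changes the outage probability with imperfect cancellation little
        |F.outageProb S P 1 - S.gammaOutage 1| ≤ δ S.κ S.K ∧
        -- and the double sum converges to the result of the replacement
        (S.γthm * S.an < S.am → S.τ ≤ S.β →
          Tendsto (fun N : ℕ × ℕ => S.quadratureOutage 1 N.1 N.2) atTop
            (𝓝 (S.gammaOutage 1))) := by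
  choose! δ hδ hclose using fun (κ : ℝ) (hκ : 0 ≤ κ) => exists_cascade_error hκ
  refine ⟨δ, hδ, fun S hS Ω _ P _ F hF => ?_⟩
  have hm := Fading.aemeasurable_cascade hF hS
  have hp := Params.isProbabilityMeasure_gammaLaw hS
  have hpX : IsProbabilityMeasure (P.map (F.cascade S)) := Measure.isProbabilityMeasure_map hm
  -- This one uniform bound yields both the distributional claim and the outage claim, with the same
  -- `δ`.
  have hcdf := hclose S.κ hS.κ_nonneg S hS rfl (P.map (F.cascade S)) (Fading.charFun_cascade hF hS)
  refine ⟨⟨Fading.memLp_cascade hF hS, ?_, ?_⟩, fun x => ?_, ?_,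
    Params.tendsto_quadratureOutage hS⟩
  · rw [Fading.integral_cascade hF hS, Params.integral_gammaLaw hS]
  · rw [Fading.variance_cascade hF hS, Params.variance_gammaLaw hS]
  · have h := hcdf x
    rwa [map_measureReal_apply_of_aemeasurable hm measurableSet_Iic] at h
  · rw [Params.outageProb_eq hS hF, Params.gammaOutage_eq]
    refine Params.abs_outageOfLaw_sub_le hS ?_ ?_ hcdf
    · rw [ae_map_iff hm measurableSet_Ici]
      exact ae_of_all _ fun ω => Finset.sum_nonneg fun k _ => norm_nonneg _
    · exact (ae_gammaMeasure_pos (Params.φn_add_one_pos hS)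
        (one_div_pos.2 (Params.ϕn_pos hS))).mono fun _ => le_of_lt
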